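/- **Setting (caching with action predictions).** A cache of size $k\ge 2$ has a known initial content of at most $k$ pages. Requests $r_1,r_2,\dots,r_T$ arrive online; after each request the requested page must be in the cache. The cost is the number of pages loaded into the cache. $\mathrm{OPT}$ denotes the number of page faults of Belady's (optimal offline) algorithm, started from the same initial cache; on a page fault with a full cache, it evicts a page whose next request is furthest in the future, with ties broken arbitrarily. A predictor has, for each time $t$, a predicted cache content $P_t$ (at most $k$ pages, otherwise arbitrary). In a query at time $t$ the algorithm names a finite set $D$ of pages known to it (pages that were in the initial cache or requested before time $t$) and a number $m$, and receives $m$ pages of $D\setminus P_t$ of the predictor's choice (all of them if there are fewer). The error of a prediction received at time $t$ is $|B_t\setminus P_t|$, where $B_t$ is the cache of Belady's algorithm after serving $r_t$; $\eta$ denotes the expected total error of the predictions that the algorithm receives. **Theorem.** There is an absolute constant $C>0$ such that the following holds for all integers $k\ge 2$ and $1\le a\le k$, and every strictly increasing convex function $f\colon[0,\infty)\to[0,\infty)$ with $f(0)=0$, $f(1)=1$ and $f(i)\le 2^i-1$ for all integers $i\ge 0$. There is $\alpha\in\mathbb R$ (independent of the set of pages, the initial cache, the input and the predictions) such that for every set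 of pages and every initial cache there is a randomized online caching algorithm $\mathrm{ALG}$ with the following properties, for every request sequence and every predictor: 1. any two queries to the predictor are at least $a$ time steps apart, in every run; 2. in every run, the number of queries and the total number of page indices asked for are each at most $C f(\log_2 k)\cdot\mathrm{OPT}$; 3. ($O(1)$-consistency) if the predictions are perfect, i.e. $P_t=B_t$ for all $t$, then $\mathbb E[\mathrm{cost}(\mathrm{ALG})]\le C\cdot\mathrm{OPT}+\alpha$; 4. ($O(\log k)$-robustness) for arbitrary predictions, $\mathbb E[\mathrm{cost}(\mathrm{ALG})]\le C\log_2 k\cdot\mathrm{OPT}+\alpha$; 5. (smoothness) for arbitrary predictions, $\mathbb E[\mathrm{cost}(\mathrm{ALG})]\le C\bigl(1+f^{-1}(a\eta/\mathrm{OPT})\bigr)\mathrm{OPT}+\alpha$ (when $\mathrm{OPT}=0$, the first term is $0$). -/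

import Mathlib

open scoped ENNReal

universe u

namespace Caching

/-- One query to the predictor: at step `time` the algorithm asks for `number` indices of pages
of the finite set `pages` that are absent from the predicted cache. -/
structure Query (Page : Type u) where
  time : ℕ
  pages : Finset Page
  number : ℕ

/-- A predictor of cache contents (action predictions) for cache size `k`. `state t` is the
predicted cache content just after request number `t` (requests are numbered from `0`) has been
served. `report t D m` answers a query made at step `t`: it consists of `m` pages of `D` that are
absent from the predicted cache (all of them if there are fewer than `m`); which ones is up to
the predictor. Nothing is assumed about the quality of the predictions. -/
structure Predictor (Page : Type u) [DecidableEq Page] (k : ℕ) where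
  state : ℕ → Finset Page
  card_state : ∀ t, (state t).card ≤ k
  report : ℕ → Finset Page → ℕ → Finset Page
  report_subset : ∀ t D m, report t D m ⊆ D \ state t
  card_report : ∀ t D m, (report t D m).card = min m (D \ state t).card

/-- A randomized online caching algorithm with cache size `k` and initial cache content `init`,
with access to a predictor. When page `r` is requested in internal state `s`, the algorithm first
decides by `ask s r` whether to query the predictor, and for what; it then draws its next internal
state from `move s r R`, where `R` is the predictor's answer (`∅` if there was no query). The
requested page has to be in the new cache. Internal states may record the whole past. -/
structure OnlineAlgorithm (Page : Type u) (k : ℕ) (init : Finset Page) where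
  State : Type u
  start : State
  cache : State → Finset Page
  cache_start : cache start = init
  card_cache : ∀ s, (cache s).card ≤ k
  ask : State → Page → Option (Finset Page × ℕ)
  move : State → Page → Finset Page → PMF State
  mem_cache : ∀ s r R, ∀ s' ∈ (move s r R).support, r ∈ cache s'

/-- `B t` is the cache content of (a run of) Belady's algorithm before request number `t`, on the
request sequence `req 0, …, req (T - 1)`: nothing changes if the requested page is in the cache;
on a page fault the page is loaded, and if the cache is full a page `p` is evicted whose next
request is furthest in the future, i.e. whenever `p` is requested later, every page `q` of the
cache is requested no later than that. Ties are broken arbitrarily. -/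
structure IsBelady {Page : Type u} [DecidableEq Page] (k : ℕ) (init : Finset Page)
    (req : ℕ → Page) (T : ℕ) (B : ℕ → Finset Page) : Prop where
  zero : B 0 = init
  hit : ∀ t < T, req t ∈ B t → B (t + 1) = B t
  load : ∀ t < T, req t ∉ B t → (B t).card < k → B (t + 1) = insert (req t) (B t)
  evict : ∀ t < T, req t ∉ B t → k ≤ (B t).card →
    ∃ p ∈ B t,
      (∀ q ∈ B t, ∀ s, t < s → s < T → req s = p → ∃ s', t < s' ∧ s' ≤ s ∧ req s' = q) ∧
      B (t + 1) = insert (req t) ((B t).erase p)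

/-- The number of page faults among the first `T` requests of a run with cache contents `B`. -/
def faults {Page : Type u} [DecidableEq Page] (req : ℕ → Page) (T : ℕ)
    (B : ℕ → Finset Page) : ℕ :=
  ((Finset.range T).filter fun t => req t ∉ B t).card

/-- Total error, with respect to the run `B`, of the predictions received in the given queries:
each prediction contributes the number of pages in the cache of `B` that are absent from the
predicted cache. -/
def totalError {Page : Type u} [DecidableEq Page] {k : ℕ} (P : Predictor Page k)
    (B : ℕ → Finset Page) (L : List (Query Page)) : ℕ :=
  (L.map fun q => (B (q.time + 1) \ P.state q.time).card).sum

/-- Expectation of an `ℕ`-valued quantity. -/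
noncomputable def expect {α : Type u} (p : PMF α) (X : α → ℕ) : ℝ≥0∞ :=
  ∑' x, p x * (X x : ℝ≥0∞)

namespace OnlineAlgorithm

variable {Page : Type u} [DecidableEq Page] {k : ℕ} {init : Finset Page}

/-- What has happened up to some step: the current internal state, the number of pages loaded so
far, and the queries made so far (most recent first). -/
structure Outcome (A : OnlineAlgorithm Page k init) where
  state : A.State
  cost : ℕ
  queries : List (Query Page)

/-- Serving request number `t`. The cost is the number of pages loaded into the cache. -/
noncomputable def step (A : OnlineAlgorithm Page k init) (P : Predictor Page k)
    (req : ℕ → Page) (t : ℕ) (o : A.Outcome) : PMF A.Outcome :=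
  match A.ask o.state (req t) with
  | none =>
      (A.move o.state (req t) ∅).map fun s =>
        ⟨s, o.cost + (A.cache s \ A.cache o.state).card, o.queries⟩
  | some (D, m) =>
      (A.move o.state (req t) (P.report t D m)).map fun s =>
        ⟨s, o.cost + (A.cache s \ A.cache o.state).card, ⟨t, D, m⟩ :: o.queries⟩

/-- The distribution of the outcome after the first `T` requests. -/
noncomputable def run (A : OnlineAlgorithm Page k init) (P : Predictor Page k)
    (req : ℕ → Page) : ℕ → PMF A.Outcome
  | 0 => PMF.pure ⟨A.start, 0, []⟩
  | t + 1 => (run A P req t).bind (A.step P req t)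

/-- Expected cost of the algorithm on the first `T` requests. -/
noncomputable def expectedCost (A : OnlineAlgorithm Page k init) (P : Predictor Page k)
    (req : ℕ → Page) (T : ℕ) : ℝ≥0∞ :=
  expect (A.run P req T) fun o => o.cost

/-- Expected total error, with respect to `B`, of the predictions that the algorithm receives. -/
noncomputable def expectedError (A : OnlineAlgorithm Page k init) (P : Predictor Page k)
    (req : ℕ → Page) (T : ℕ) (B : ℕ → Finset Page) : ℝ≥0∞ :=
  expect (A.run P req T) fun o => totalError P B o.queries

/-- In every run, the moments of the queries are separated by at least `a` time steps. -/
def WellSeparated (A : OnlineAlgorithm Page k init) (a : ℕ) : Prop :=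
  ∀ (P : Predictor Page k) (req : ℕ → Page) (T : ℕ), ∀ o ∈ (A.run P req T).support,
    o.queries.Pairwise fun later earlier => earlier.time + a ≤ later.time

/-- The algorithm only asks about pages it was given initially or that were requested earlier. -/
def AsksAboutKnownPages (A : OnlineAlgorithm Page k init) : Prop :=
  ∀ (P : Predictor Page k) (req : ℕ → Page) (T : ℕ), ∀ o ∈ (A.run P req T).support,
    ∀ q ∈ o.queries, q.pages ⊆ init ∪ (Finset.range q.time).image req

/-- In every run, at most `b * OPT` predictions are used: this bounds both the number of queries
and the total number of indices asked for. `OPT` is the number of page faults of Belady's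
algorithm. -/
def UsesPredictions (A : OnlineAlgorithm Page k init) (b : ℝ) : Prop :=
  ∀ (P : Predictor Page k) (req : ℕ → Page) (T : ℕ) (B : ℕ → Finset Page),
    IsBelady k init req T B → ∀ o ∈ (A.run P req T).support,
      (o.queries.length : ℝ) ≤ b * faults req T B ∧
      (((o.queries.map fun q => q.number).sum : ℕ) : ℝ) ≤ b * faults req T B

/-- Competitive ratio at most `r` (with additive constant `α`) with perfect predictions. -/
def IsConsistent (A : OnlineAlgorithm Page k init) (r α : ℝ) : Prop :=
  ∀ (P : Predictor Page k) (req : ℕ → Page) (T : ℕ) (B : ℕ → Finset Page),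
    IsBelady k init req T B → (∀ t < T, P.state t = B (t + 1)) →
      A.expectedCost P req T ≤ ENNReal.ofReal (r * faults req T B + α)

/-- Competitive ratio at most `r` (with additive constant `α`) with arbitrary predictions. -/
def IsRobust (A : OnlineAlgorithm Page k init) (r α : ℝ) : Prop :=
  ∀ (P : Predictor Page k) (req : ℕ → Page) (T : ℕ) (B : ℕ → Finset Page),
    IsBelady k init req T B →
      A.expectedCost P req T ≤ ENNReal.ofReal (r * faults req T B + α)

/-- Competitive ratio at most `g η OPT` (with additive constant `α`), where `η` is the
(expected) total error of the predictions received, with respect to Belady's algorithm, and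
`OPT` is the number of page faults of Belady's algorithm. -/
def IsSmooth (A : OnlineAlgorithm Page k init) (g : ℝ → ℝ → ℝ) (α : ℝ) : Prop :=
  ∀ (P : Predictor Page k) (req : ℕ → Page) (T : ℕ) (B : ℕ → Finset Page),
    IsBelady k init req T B →
      A.expectedCost P req T ≤
        ENNReal.ofReal
          (g (A.expectedError P req T B).toReal (faults req T B) * faults req T B + α)

end OnlineAlgorithm

end Caching

/-!
Split the requests into phases of `k` distinct pages, and each phase into epochs that end when the
number of new pages in the phase has doubled. The weight of an epoch is that number at its start;
the total weight of all epochs is at most `4 * OPT`.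

In an epoch of weight `w` the algorithm climbs through levels `0, 1, …, L = ⌊log₂ k⌋`. On a level
`i < L` a fault starts a period of `N i` queries that are `a` steps apart. The answer to one of
them, chosen uniformly at random, determines a reference set that the cache follows from then on;
until then pages are evicted uniformly at random. A period has `N i * a ≤ 2 * k` steps, so that an
eviction causes `O(1)` further faults in expectation, and the level costs `O(w)`. It is given up
after `7 * w` requests outside of the reference set. New pages and faults of Belady's algorithm do
not explain that many, and the random choice makes the expected total error of the answers at least
`N i` times the error of the adopted one, so that giving up the level is paid for by an error of
`N i * w`. On level `L` the algorithm does without predictions and is the marking algorithm, of cost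
`O(w log k)`.

For `N i = ⌈(f (i + 1) - f i) / a⌉`, reaching level `i` costs `O((1 + i) * w)` and requires an error
of about `f i * w / a`. As `f` is convex, it lies above its secant line through `j` and `j + 1`, so
that weighing the error with the reciprocal of the slope bounds the cost of all epochs together;
the smoothness bound is the case `j = ⌊f⁻¹ (a * η / OPT)⌋`. Each level can use
`O(N i * w)` predictions, in total `O(f L * w)`.
-/

namespace Caching

/-! ### Expectations under finitely supported distributions -/

section mean

variable {α β : Type*} {p : PMF α}

/-- Expectation of a real-valued quantity; meaningful only if the sum converges, which is why the
lemmas below assume that `p` has finite support. -/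
noncomputable def mean (p : PMF α) (X : α → ℝ) : ℝ := ∑' x, (p x).toReal * X x

lemma mean_eq_sum {s : Finset α} (hs : p.support ⊆ s) (X : α → ℝ) :
    mean p X = ∑ x ∈ s, (p x).toReal * X x := by
  refine tsum_eq_sum fun x hx ↦ ?_
  have hpx : p x = 0 := (p.apply_eq_zero_iff x).2 fun h ↦ hx (hs h)
  rw [hpx, ENNReal.toReal_zero, zero_mul]

lemma sum_toReal_eq_one {s : Finset α} (hs : p.support ⊆ s) : ∑ x ∈ s, (p x).toReal = 1 := by
  have hsum : ∑ x ∈ s, p x = 1 := by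
    rw [← p.tsum_coe]
    exact (tsum_eq_sum fun x hx ↦ (p.apply_eq_zero_iff x).2 fun h ↦ hx (hs h)).symm
  rw [← ENNReal.toReal_sum fun x _ ↦ p.apply_ne_top x, hsum, ENNReal.toReal_one]

lemma mean_mono (hp : p.support.Finite) {X Y : α → ℝ} (h : ∀ x ∈ p.support, X x ≤ Y x) :
    mean p X ≤ mean p Y := by
  rw [mean_eq_sum hp.coe_toFinset.ge X, mean_eq_sum hp.coe_toFinset.ge Y]
  exact Finset.sum_le_sum fun x hx ↦
    mul_le_mul_of_nonneg_left (h x (hp.mem_toFinset.1 hx)) ENNReal.toReal_nonneg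

lemma mean_const (hp : p.support.Finite) (c : ℝ) : mean p (fun _ ↦ c) = c := by
  rw [mean_eq_sum hp.coe_toFinset.ge, ← Finset.sum_mul, sum_toReal_eq_one hp.coe_toFinset.ge,
    one_mul]

lemma mean_add (hp : p.support.Finite) (X Y : α → ℝ) :
    mean p (fun x ↦ X x + Y x) = mean p X + mean p Y := by
  simp only [mean_eq_sum hp.coe_toFinset.ge, mul_add, Finset.sum_add_distrib]

lemma mean_const_mul (hp : p.support.Finite) (c : ℝ) (X : α → ℝ) :
    mean p (fun x ↦ c * X x) = c * mean p X := by
  simp only [mean_eq_sum hp.coe_toFinset.ge, Finset.mul_sum, mul_left_comm]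

lemma mean_le_of_forall_le (hp : p.support.Finite) {X : α → ℝ} {c : ℝ}
    (h : ∀ x ∈ p.support, X x ≤ c) : mean p X ≤ c :=
  (mean_mono hp h).trans_eq (mean_const hp c)

lemma mean_nonneg {X : α → ℝ} (h : ∀ x, 0 ≤ X x) : 0 ≤ mean p X :=
  tsum_nonneg fun x ↦ mul_nonneg ENNReal.toReal_nonneg (h x)

lemma mean_pure (a : α) (X : α → ℝ) : mean (PMF.pure a) X = X a := by
  have hs : (PMF.pure a).support ⊆ ({a} : Finset α) := by simp
  rw [mean_eq_sum hs, Finset.sum_singleton, PMF.pure_apply_self, ENNReal.toReal_one, one_mul]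

lemma finite_support_pure (a : α) : (PMF.pure a).support.Finite := by
  rw [PMF.support_pure]
  exact Set.finite_singleton a

lemma finite_support_bind {g : α → PMF β} (hp : p.support.Finite)
    (hg : ∀ a ∈ p.support, (g a).support.Finite) : (p.bind g).support.Finite := by
  rw [PMF.support_bind]
  exact hp.biUnion hg

lemma finite_support_map (f : α → β) (hp : p.support.Finite) : (p.map f).support.Finite := by
  rw [PMF.support_map]
  exact hp.image f

lemma toReal_bind_apply (hp : p.support.Finite) (g : α → PMF β) (x : β) :
    (p.bind g x).toReal = mean p fun a ↦ (g a x).toReal := by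
  have hbind : p.bind g x = ∑ a ∈ hp.toFinset, p a * g a x := by
    rw [PMF.bind_apply]
    refine tsum_eq_sum fun a ha ↦ ?_
    rw [(p.apply_eq_zero_iff a).2 fun h ↦ ha (hp.mem_toFinset.2 h), zero_mul]
  rw [hbind, mean_eq_sum hp.coe_toFinset.ge, ENNReal.toReal_sum fun a _ ↦
    ENNReal.mul_ne_top (p.apply_ne_top a) ((g a).apply_ne_top x)]
  simp only [ENNReal.toReal_mul]

lemma mean_bind {g : α → PMF β} (hp : p.support.Finite)
    (hg : ∀ a ∈ p.support, (g a).support.Finite) (X : β → ℝ) :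
    mean (p.bind g) X = mean p fun a ↦ mean (g a) X := by
  have hb := finite_support_bind hp hg
  have hsupp : ∀ a ∈ hp.toFinset, (g a).support ⊆ hb.toFinset := fun a ha x hx ↦ by
    rw [hb.coe_toFinset]
    exact (PMF.mem_support_bind_iff _ _ _).2 ⟨a, hp.mem_toFinset.1 ha, hx⟩
  calc mean (p.bind g) X
      = ∑ x ∈ hb.toFinset, ∑ a ∈ hp.toFinset, (p a).toReal * (g a x).toReal * X x := by
        simp only [mean_eq_sum hb.coe_toFinset.ge, toReal_bind_apply hp,
          mean_eq_sum hp.coe_toFinset.ge, Finset.sum_mul]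
    _ = ∑ a ∈ hp.toFinset, (p a).toReal * ∑ x ∈ hb.toFinset, (g a x).toReal * X x := by
        rw [Finset.sum_comm]
        simp only [Finset.mul_sum, mul_assoc]
    _ = ∑ a ∈ hp.toFinset, (p a).toReal * mean (g a) X :=
        Finset.sum_congr rfl fun a ha ↦ by rw [mean_eq_sum (hsupp a ha)]
    _ = mean p fun a ↦ mean (g a) X := (mean_eq_sum hp.coe_toFinset.ge _).symm

lemma mean_map (hp : p.support.Finite) (f : α → β) (X : β → ℝ) :
    mean (p.map f) X = mean p fun a ↦ X (f a) := by
  rw [PMF.map, mean_bind (g := PMF.pure ∘ f) hp fun a _ ↦ finite_support_pure (f a)]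
  simp only [Function.comp, mean_pure]

lemma mean_uniformOfFinset (s : Finset α) (hs : s.Nonempty) (X : α → ℝ) :
    mean (PMF.uniformOfFinset s hs) X = (∑ x ∈ s, X x) / s.card := by
  rw [mean_eq_sum (PMF.support_uniformOfFinset hs).le, Finset.sum_div]
  refine Finset.sum_congr rfl fun x hx ↦ ?_
  rw [PMF.uniformOfFinset_apply_of_mem hs hx, ENNReal.toReal_inv, ENNReal.toReal_natCast,
    div_eq_inv_mul]

lemma expect_eq_ofReal_mean {α : Type u} {p : PMF α} (hp : p.support.Finite) (X : α → ℕ) :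
    expect p X = ENNReal.ofReal (mean p fun x ↦ (X x : ℝ)) := by
  have hsum : expect p X = ∑ x ∈ hp.toFinset, p x * (X x : ℝ≥0∞) := by
    refine tsum_eq_sum fun x hx ↦ ?_
    rw [(p.apply_eq_zero_iff x).2 fun h ↦ hx (hp.mem_toFinset.2 h), zero_mul]
  rw [hsum, mean_eq_sum hp.coe_toFinset.ge, ENNReal.ofReal_sum_of_nonneg
    fun x _ ↦ mul_nonneg ENNReal.toReal_nonneg (Nat.cast_nonneg _)]
  refine Finset.sum_congr rfl fun x _ ↦ ?_
  rw [ENNReal.ofReal_mul ENNReal.toReal_nonneg, ENNReal.ofReal_toReal (p.apply_ne_top x),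
    ENNReal.ofReal_natCast]

end mean

/-! ### Runs of an online algorithm -/

namespace OnlineAlgorithm

variable {Page : Type u} [DecidableEq Page] {k : ℕ} {init : Finset Page}

/-- All random choices of the algorithm are among finitely many alternatives, so that expectations
over its runs are finite sums. -/
def FinitelyBranching (A : OnlineAlgorithm Page k init) : Prop :=
  ∀ s r R, (A.move s r R).support.Finite

/-- The set of pages handed over by the predictor at step `t`, empty if there is no query. -/
noncomputable def answer (A : OnlineAlgorithm Page k init) (P : Predictor Page k) (req : ℕ → Page)
    (t : ℕ) (s : A.State) : Finset Page :=
  match A.ask s (req t) with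
  | none => ∅
  | some (D, m) => P.report t D m

/-- The list of queries after step `t`, if the step starts from the outcome `o`. -/
noncomputable def newQueries (A : OnlineAlgorithm Page k init) (req : ℕ → Page) (t : ℕ)
    (o : A.Outcome) : List (Query Page) :=
  match A.ask o.state (req t) with
  | none => o.queries
  | some (D, m) => ⟨t, D, m⟩ :: o.queries

lemma step_eq_map (A : OnlineAlgorithm Page k init) (P : Predictor Page k) (req : ℕ → Page)
    (t : ℕ) (o : A.Outcome) :
    A.step P req t o = (A.move o.state (req t) (A.answer P req t o.state)).map fun s ↦
      ⟨s, o.cost + (A.cache s \ A.cache o.state).card, A.newQueries req t o⟩ := by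
  unfold step answer newQueries
  rcases A.ask o.state (req t) with _ | ⟨D, m⟩ <;> rfl

variable {A : OnlineAlgorithm Page k init}

lemma FinitelyBranching.step (hA : A.FinitelyBranching) (P : Predictor Page k)
    (req : ℕ → Page) (t : ℕ) (o : A.Outcome) : (A.step P req t o).support.Finite := by
  rw [step_eq_map]
  exact finite_support_map _ (hA _ _ _)

lemma FinitelyBranching.run (hA : A.FinitelyBranching) (P : Predictor Page k)
    (req : ℕ → Page) : ∀ T, (A.run P req T).support.Finite
  | 0 => finite_support_pure _
  | T + 1 => finite_support_bind (FinitelyBranching.run hA P req T) fun o _ ↦ hA.step P req T o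

lemma FinitelyBranching.mean_step (hA : A.FinitelyBranching) (P : Predictor Page k)
    (req : ℕ → Page) (t : ℕ) (o : A.Outcome) (Z : A.Outcome → ℝ) :
    mean (A.step P req t o) Z = mean (A.move o.state (req t) (A.answer P req t o.state)) fun s ↦
      Z ⟨s, o.cost + (A.cache s \ A.cache o.state).card, A.newQueries req t o⟩ := by
  rw [step_eq_map, mean_map (hA _ _ _)]

lemma run_induction (P : Predictor Page k) (req : ℕ → Page) (Inv : ℕ → A.Outcome → Prop)
    (zero : Inv 0 ⟨A.start, 0, []⟩)
    (step : ∀ t o, Inv t o → ∀ s ∈ (A.move o.state (req t) (A.answer P req t o.state)).support,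
      Inv (t + 1) ⟨s, o.cost + (A.cache s \ A.cache o.state).card, A.newQueries req t o⟩) :
    ∀ T, ∀ o ∈ (A.run P req T).support, Inv T o
  | 0, o, ho => by
      obtain rfl : o = ⟨A.start, 0, []⟩ := by simpa only [run, PMF.mem_support_pure_iff] using ho
      exact zero
  | T + 1, o, ho => by
      obtain ⟨o', ho', hstep⟩ := (PMF.mem_support_bind_iff _ _ _).1 ho
      rw [step_eq_map, PMF.mem_support_map_iff] at hstep
      obtain ⟨s, hs, rfl⟩ := hstep
      exact step T o' (run_induction P req Inv zero step T o' ho') s hs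

lemma FinitelyBranching.mean_run_le_of_mean_step_le (hA : A.FinitelyBranching)
    (P : Predictor Page k) (req : ℕ → Page) (Z : ℕ → A.Outcome → ℝ) :
    ∀ T, (∀ t < T, ∀ o ∈ (A.run P req t).support, mean (A.step P req t o) (Z (t + 1)) ≤ Z t o) →
      mean (A.run P req T) (Z T) ≤ Z 0 ⟨A.start, 0, []⟩
  | 0, _ => (mean_pure _ _).le
  | T + 1, hstep => by
      change mean ((A.run P req T).bind (A.step P req T)) _ ≤ _
      rw [mean_bind (hA.run P req T) fun o _ ↦ hA.step P req T o]
      exact (mean_mono (hA.run P req T) (hstep T T.lt_succ_self)).trans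
        (mean_run_le_of_mean_step_le hA P req Z T fun t ht ↦ hstep t (ht.trans T.lt_succ_self))

lemma FinitelyBranching.expectedCost_eq (hA : A.FinitelyBranching) (P : Predictor Page k)
    (req : ℕ → Page) (T : ℕ) :
    A.expectedCost P req T = ENNReal.ofReal (mean (A.run P req T) fun o ↦ (o.cost : ℝ)) :=
  expect_eq_ofReal_mean (hA.run P req T) _

lemma FinitelyBranching.toReal_expectedError (hA : A.FinitelyBranching) (P : Predictor Page k)
    (req : ℕ → Page) (T : ℕ) (B : ℕ → Finset Page) :
    (A.expectedError P req T B).toReal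
      = mean (A.run P req T) fun o ↦ (totalError P B o.queries : ℝ) := by
  rw [expectedError, expect_eq_ofReal_mean (hA.run P req T),
    ENNReal.toReal_ofReal (mean_nonneg fun _ ↦ Nat.cast_nonneg _)]

lemma time_lt_of_mem_run (P : Predictor Page k) (req : ℕ → Page) (T : ℕ) (o : A.Outcome)
    (ho : o ∈ (A.run P req T).support) : ∀ q ∈ o.queries, q.time < T := by
  refine run_induction P req (fun t o ↦ ∀ q ∈ o.queries, q.time < t) (by simp) ?_ T o ho
  intro t o htime s _ q hq
  simp only [newQueries] at hq
  split at hq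
  · exact (htime q hq).trans t.lt_succ_self
  · rcases List.mem_cons.1 hq with rfl | hq
    · exact t.lt_succ_self
    · exact (htime q hq).trans t.lt_succ_self

lemma expectedError_eq_zero (A : OnlineAlgorithm Page k init) {P : Predictor Page k} {T : ℕ}
    {B : ℕ → Finset Page} (hP : ∀ t < T, P.state t = B (t + 1)) (req : ℕ → Page) :
    A.expectedError P req T B = 0 := by
  refine ENNReal.tsum_eq_zero.2 fun o ↦ ?_
  by_cases ho : o ∈ (A.run P req T).support
  · have herror : totalError P B o.queries = 0 := by
      refine List.sum_eq_zero fun n hn ↦ ?_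
      obtain ⟨q, hq, rfl⟩ := List.mem_map.1 hn
      rw [hP _ (time_lt_of_mem_run P req T o ho q hq), Finset.sdiff_self, Finset.card_empty]
    simp only [herror, Nat.cast_zero, mul_zero]
  · rw [(PMF.apply_eq_zero_iff _ o).2 ho, zero_mul]

lemma UsesPredictions.mono {b b' : ℝ} (h : A.UsesPredictions b) (hb : b ≤ b') :
    A.UsesPredictions b' := fun P req T B hB o ho ↦
  have hle := mul_le_mul_of_nonneg_right hb (Nat.cast_nonneg (faults req T B))
  ⟨(h P req T B hB o ho).1.trans hle, (h P req T B hB o ho).2.trans hle⟩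

lemma IsConsistent.mono {r r' α : ℝ} (h : A.IsConsistent r α) (hr : r ≤ r') :
    A.IsConsistent r' α := fun P req T B hB hP ↦
  (h P req T B hB hP).trans <| ENNReal.ofReal_le_ofReal <| by gcongr

lemma IsSmooth.mono {g g' : ℝ → ℝ → ℝ} {α : ℝ} (h : A.IsSmooth g α)
    (hg : ∀ η x, 0 ≤ η → 0 ≤ x → g η x ≤ g' η x) : A.IsSmooth g' α := fun P req T B hB ↦
  (h P req T B hB).trans <| ENNReal.ofReal_le_ofReal <| by
    gcongr
    exact hg _ _ ENNReal.toReal_nonneg (Nat.cast_nonneg _)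

end OnlineAlgorithm

/-! ### Harmonic numbers -/

lemma harmonic_nonneg (n : ℕ) : (0 : ℝ) ≤ harmonic n := by
  exact_mod_cast (Finset.sum_nonneg fun i _ ↦ by positivity : 0 ≤ harmonic n)

lemma harmonic_mono {m n : ℕ} (h : m ≤ n) : (harmonic m : ℝ) ≤ harmonic n := by
  exact_mod_cast (Finset.sum_le_sum_of_subset_of_nonneg (Finset.range_mono h)
    fun i _ _ ↦ by positivity : harmonic m ≤ harmonic n)

lemma cast_harmonic_succ (n : ℕ) : (harmonic (n + 1) : ℝ) = harmonic n + 1 / ((n : ℝ) + 1) := by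
  rw [harmonic_succ]
  push_cast
  rw [one_div]

lemma sum_range_harmonic_succ (n : ℕ) :
    ∑ j ∈ Finset.range n, (harmonic (j + 1) : ℝ) = (n + 1) * harmonic n - n := by
  induction n with
  | zero => simp
  | succ n ih =>
    rw [Finset.sum_range_succ, ih, cast_harmonic_succ]
    push_cast
    field_simp
    ring

lemma harmonic_le_three_mul_log {k : ℕ} (hk : 2 ≤ k) : (harmonic k : ℝ) ≤ 3 * Nat.log 2 k := by
  have hlog_le : Real.log k ≤ (Nat.log 2 k + 1) * Real.log 2 := by
    have hlt : k < 2 ^ (Nat.log 2 k + 1) := Nat.lt_pow_succ_log_self one_lt_two k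
    have h := Real.log_le_log (by positivity) (by exact_mod_cast hlt.le :
      (k : ℝ) ≤ 2 ^ (Nat.log 2 k + 1))
    rw [Real.log_pow] at h
    exact_mod_cast h
  have hlog_two : Real.log 2 ≤ 1 := Real.log_two_lt_d9.le.trans (by norm_num)
  have hone : (1 : ℝ) ≤ Nat.log 2 k := by exact_mod_cast Nat.log_pos one_lt_two hk
  nlinarith [harmonic_le_one_add_log k]

/-! ### Weights of missing pages -/

section weights

variable {Page : Type u} [DecidableEq Page]

/-- Weight of a missing page `y` before request `t`, if evictions are uniformly random during the
next `n` steps: a power of `1 + 1 / k` that is larger the earlier `y` is requested. -/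
noncomputable def randWeight (k : ℕ) (req : ℕ → Page) (y : Page) : ℕ → ℕ → ℝ
  | _, 0 => 0
  | t, n + 1 => if req t = y then (1 + 1 / (k : ℝ)) ^ n else randWeight k req y (t + 1) n

/-- Weight of a missing page `y` before request `t`, if unmarked pages are evicted uniformly at
random, the set of marked pages is `M` and there are `n` more steps. The harmonic number is the
expected number of faults that the marking algorithm still suffers on an unmarked page. -/
noncomputable def markWeight (k : ℕ) (req : ℕ → Page) (y : Page) : Finset Page → ℕ → ℕ → ℝ
  | _, _, 0 => 0
  | M, t, n + 1 => if req t = y then (harmonic (k - M.card) : ℝ)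
      else markWeight k req y (insert (req t) M) (t + 1) n

lemma sum_le_add_sum_erase (A : Finset Page) (x : Page) {g : Page → ℝ} (hx : 0 ≤ g x) :
    ∑ y ∈ A, g y ≤ g x + ∑ y ∈ A.erase x, g y := by
  by_cases h : x ∈ A
  · rw [Finset.add_sum_erase _ _ h]
  · rw [Finset.erase_eq_of_notMem h]
    exact le_add_of_nonneg_left hx

section randWeight

variable (k : ℕ) (req : ℕ → Page)

lemma one_le_growth : 1 ≤ 1 + 1 / (k : ℝ) := le_add_of_nonneg_right (by positivity)

lemma growth_pow_le_eight {k n : ℕ} (hn : n ≤ 2 * k) : (1 + 1 / (k : ℝ)) ^ n ≤ 8 := by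
  have hgrowth : 1 + 1 / (k : ℝ) ≤ Real.exp (1 / k) :=
    (add_comm _ _).trans_le (Real.add_one_le_exp _)
  have hexponent : (n : ℝ) * (1 / k) ≤ 2 := by
    rw [mul_one_div]
    exact div_le_of_le_mul₀ (Nat.cast_nonneg k) zero_le_two (by exact_mod_cast hn)
  calc (1 + 1 / (k : ℝ)) ^ n
      ≤ Real.exp (1 / k) ^ n := pow_le_pow_left₀ (by positivity) hgrowth n
    _ = Real.exp (n * (1 / k)) := (Real.exp_nat_mul _ n).symm
    _ ≤ Real.exp (1 + 1) := Real.exp_le_exp.2 (by linarith)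
    _ = Real.exp 1 * Real.exp 1 := Real.exp_add 1 1
    _ ≤ 8 := by nlinarith [Real.exp_one_lt_d9, Real.exp_pos 1]

lemma randWeight_nonneg (y : Page) (t n : ℕ) : 0 ≤ randWeight k req y t n := by
  induction n generalizing t with
  | zero => exact le_rfl
  | succ n ih =>
    rw [randWeight]
    split_ifs
    · positivity
    · exact ih _

lemma randWeight_le_growth_pow (y : Page) (t n : ℕ) :
    randWeight k req y t n ≤ (1 + 1 / (k : ℝ)) ^ n := by
  induction n generalizing t with
  | zero => exact zero_le_one
  | succ n ih =>
    have hpow := pow_le_pow_right₀ (one_le_growth k) n.le_succ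
    rw [randWeight]
    split_ifs
    · exact hpow
    · exact (ih _).trans hpow

lemma randWeight_self (t n : ℕ) :
    randWeight k req (req t) t (n + 1) = (1 + 1 / (k : ℝ)) ^ n := if_pos rfl

lemma randWeight_of_ne {y : Page} {t : ℕ} (h : y ≠ req t) (n : ℕ) :
    randWeight k req y t (n + 1) = randWeight k req y (t + 1) n := if_neg h.symm

variable {k} in
lemma sum_randWeight_le (hk : 0 < k) (A : Finset Page) (t n : ℕ) :
    ∑ y ∈ A, randWeight k req y t n ≤ k * ((1 + 1 / (k : ℝ)) ^ n - 1) := by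
  induction n generalizing t A with
  | zero => simp [randWeight]
  | succ n ih =>
    calc ∑ y ∈ A, randWeight k req y t (n + 1)
        ≤ randWeight k req (req t) t (n + 1)
            + ∑ y ∈ A.erase (req t), randWeight k req y t (n + 1) :=
          sum_le_add_sum_erase A (req t) (randWeight_nonneg _ _ _ _ _)
      _ = (1 + 1 / (k : ℝ)) ^ n + ∑ y ∈ A.erase (req t), randWeight k req y (t + 1) n := by
          rw [randWeight_self, Finset.sum_congr rfl fun y hy ↦
            randWeight_of_ne k req (Finset.ne_of_mem_erase hy) n]
      _ ≤ (1 + 1 / (k : ℝ)) ^ n + k * ((1 + 1 / (k : ℝ)) ^ n - 1) := by gcongr; exact ih _ _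
      _ = k * ((1 + 1 / (k : ℝ)) ^ (n + 1) - 1) := by
          rw [pow_succ]
          field_simp
          ring

end randWeight

section markWeight

variable (k : ℕ) (req : ℕ → Page)

lemma markWeight_nonneg (y : Page) (M : Finset Page) (t n : ℕ) :
    0 ≤ markWeight k req y M t n := by
  induction n generalizing t M with
  | zero => exact le_rfl
  | succ n ih =>
    rw [markWeight]
    split_ifs
    · exact harmonic_nonneg _
    · exact ih _ _

lemma markWeight_le_harmonic (y : Page) (M : Finset Page) (t n : ℕ) :
    markWeight k req y M t n ≤ harmonic k := by
  induction n generalizing t M with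
  | zero => exact harmonic_nonneg _
  | succ n ih =>
    rw [markWeight]
    split_ifs
    · exact harmonic_mono (Nat.sub_le _ _)
    · exact ih _ _

lemma markWeight_self (M : Finset Page) (t n : ℕ) :
    markWeight k req (req t) M t (n + 1) = harmonic (k - M.card) := if_pos rfl

lemma markWeight_of_ne {y : Page} {t : ℕ} (h : y ≠ req t) (M : Finset Page) (n : ℕ) :
    markWeight k req y M t (n + 1) = markWeight k req y (insert (req t) M) (t + 1) n :=
  if_neg h.symm

lemma harmonic_add_sum_range_le (n : ℕ) :
    (harmonic n : ℝ) + ∑ j ∈ Finset.range (n - 1), (harmonic (j + 1) : ℝ)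
      ≤ ∑ j ∈ Finset.range n, (harmonic (j + 1) : ℝ) := by
  cases n with
  | zero => simp
  | succ n => rw [Nat.add_sub_cancel, Finset.sum_range_succ, add_comm]

lemma sum_markWeight_le {A M : Finset Page} (hAM : Disjoint A M) (t n : ℕ) :
    ∑ y ∈ A, markWeight k req y M t n
      ≤ ∑ j ∈ Finset.range (k - M.card), (harmonic (j + 1) : ℝ) := by
  induction n generalizing t A M with
  | zero =>
    simp only [markWeight, Finset.sum_const_zero]
    exact Finset.sum_nonneg fun j _ ↦ harmonic_nonneg _
  | succ n ih =>
    by_cases hM : req t ∈ M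
    · have hne : ∀ y ∈ A, y ≠ req t := fun y hy h ↦ Finset.disjoint_left.1 hAM hy (h ▸ hM)
      rw [Finset.sum_congr rfl fun y hy ↦ markWeight_of_ne k req (hne y hy) M n,
        Finset.insert_eq_of_mem hM]
      exact ih hAM (t + 1)
    · have hdisj : Disjoint (A.erase (req t)) (insert (req t) M) :=
        Finset.disjoint_insert_right.2
          ⟨Finset.notMem_erase _ _, hAM.mono_left (Finset.erase_subset _ _)⟩
      calc ∑ y ∈ A, markWeight k req y M t (n + 1)
          ≤ markWeight k req (req t) M t (n + 1)
              + ∑ y ∈ A.erase (req t), markWeight k req y M t (n + 1) :=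
            sum_le_add_sum_erase A (req t) (markWeight_nonneg _ _ _ _ _ _)
        _ = harmonic (k - M.card)
              + ∑ y ∈ A.erase (req t), markWeight k req y (insert (req t) M) (t + 1) n := by
            rw [markWeight_self, Finset.sum_congr rfl fun y hy ↦
              markWeight_of_ne k req (Finset.ne_of_mem_erase hy) M n]
        _ ≤ harmonic (k - M.card)
              + ∑ j ∈ Finset.range (k - M.card - 1), (harmonic (j + 1) : ℝ) := by
            rw [Nat.sub_sub, ← Finset.card_insert_of_notMem hM]
            gcongr
            exact ih hdisj (t + 1)
        _ ≤ _ := harmonic_add_sum_range_le _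

lemma sum_markWeight_div_card_le {A M : Finset Page} {r : Page} (hAM : Disjoint A M)
    (hA : A.card = k - M.card) (hpos : 0 < A.card) (hrA : r ∉ A) (hrM : r ∉ M) (t n : ℕ) :
    (∑ y ∈ A, markWeight k req y (insert r M) t n) / A.card ≤ (harmonic (k - M.card) : ℝ) - 1 := by
  obtain ⟨v, hv⟩ : ∃ v, A.card = v + 1 := Nat.exists_eq_add_of_lt hpos |>.imp fun v h ↦ by omega
  have hsum := sum_markWeight_le k req (Finset.disjoint_insert_right.2 ⟨hrA, hAM⟩) t n
  rw [Finset.card_insert_of_notMem hrM, show k - (M.card + 1) = v by omega,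
    sum_range_harmonic_succ] at hsum
  rw [← hA, hv, cast_harmonic_succ, div_le_iff₀ (by positivity)]
  refine hsum.trans_eq ?_
  push_cast
  field_simp
  ring

end markWeight

end weights

/-! ### Belady's algorithm -/

lemma exists_evicted {Page : Type u} {B : ℕ → Finset Page} {s t : ℕ} {p : Page} (hst : s ≤ t)
    (hs : p ∈ B s) (ht : p ∉ B t) :
    ∃ v, (s ≤ v ∧ v < t) ∧ p ∈ B v ∧ p ∉ B (v + 1) := by
  induction t, hst using Nat.le_induction with
  | base => exact absurd hs ht
  | succ t hst ih =>
    by_cases hp : p ∈ B t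
    · exact ⟨t, ⟨hst, t.lt_succ_self⟩, hp, ht⟩
    · obtain ⟨v, ⟨hsv, hvt⟩, hv⟩ := ih hp
      exact ⟨v, ⟨hsv, by omega⟩, hv⟩

section Requested

variable {Page : Type u} [DecidableEq Page]

/-- The set of pages requested at the times `s, …, t - 1`. -/
def requested (req : ℕ → Page) (s t : ℕ) : Finset Page := (Finset.Ico s t).image req

variable {req : ℕ → Page} {s s' t : ℕ} {p : Page}

lemma mem_requested : p ∈ requested req s t ↔ ∃ i, (s ≤ i ∧ i < t) ∧ req i = p := by
  simp only [requested, Finset.mem_image, Finset.mem_Ico]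

lemma requested_self (req : ℕ → Page) (s : ℕ) : requested req s s = ∅ := by
  simp [requested]

lemma requested_succ (req : ℕ → Page) (h : s ≤ t) :
    requested req s (t + 1) = insert (req t) (requested req s t) := by
  rw [requested, ← Finset.insert_Ico_right_eq_Ico_add_one h, Finset.image_insert, requested]

lemma requested_union_requested (req : ℕ → Page) (hs : s' ≤ s) (ht : s ≤ t) :
    requested req s' s ∪ requested req s t = requested req s' t := by
  rw [requested, requested, ← Finset.image_union, Finset.Ico_union_Ico_eq_Ico hs ht, requested]

lemma faults_succ (req : ℕ → Page) (B : ℕ → Finset Page) (t : ℕ) :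
    faults req (t + 1) B = faults req t B + if req t ∈ B t then 0 else 1 := by
  rw [faults, Finset.range_add_one, Finset.filter_insert, faults]
  split_ifs
  · rfl
  · rw [Finset.card_insert_of_notMem (by simp)]

lemma faults_mono (req : ℕ → Page) (B : ℕ → Finset Page) (h : s ≤ t) :
    faults req s B ≤ faults req t B :=
  Finset.card_le_card (Finset.filter_subset_filter _ (Finset.range_mono h))

end Requested

namespace IsBelady

variable {Page : Type u} [DecidableEq Page] {k : ℕ} {init : Finset Page} {req : ℕ → Page}
  {T s s' t v x : ℕ} {B : ℕ → Finset Page} {p : Page}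

lemma subset_insert (h : IsBelady k init req T B) (ht : t < T) :
    B (t + 1) ⊆ insert (req t) (B t) := by
  by_cases hmem : req t ∈ B t
  · rw [h.hit t ht hmem]
    exact Finset.subset_insert _ _
  by_cases hcard : (B t).card < k
  · rw [h.load t ht hmem hcard]
  · obtain ⟨p, -, -, hB⟩ := h.evict t ht hmem (not_lt.1 hcard)
    rw [hB]
    exact Finset.insert_subset_insert _ (Finset.erase_subset _ _)

lemma mem_succ (h : IsBelady k init req T B) (ht : t < T) : req t ∈ B (t + 1) := by
  by_cases hmem : req t ∈ B t
  · rwa [h.hit t ht hmem]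
  by_cases hcard : (B t).card < k
  · rw [h.load t ht hmem hcard]
    exact Finset.mem_insert_self _ _
  · obtain ⟨p, -, -, hB⟩ := h.evict t ht hmem (not_lt.1 hcard)
    rw [hB]
    exact Finset.mem_insert_self _ _

lemma card_succ (h : IsBelady k init req T B) (ht : t < T) :
    (B (t + 1)).card = (B t).card ∨
      (B t).card < k ∧ (B (t + 1)).card = (B t).card + 1 := by
  by_cases hmem : req t ∈ B t
  · rw [h.hit t ht hmem]
    exact Or.inl rfl
  by_cases hcard : (B t).card < k
  · rw [h.load t ht hmem hcard, Finset.card_insert_of_notMem hmem]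
    exact Or.inr ⟨hcard, rfl⟩
  · obtain ⟨p, hp, -, hB⟩ := h.evict t ht hmem (not_lt.1 hcard)
    rw [hB, Finset.card_insert_of_notMem fun h' ↦ hmem (Finset.mem_of_mem_erase h'),
      Finset.card_erase_add_one hp]
    exact Or.inl rfl

lemma card_le (h : IsBelady k init req T B) (hinit : init.card ≤ k) : ∀ t ≤ T, (B t).card ≤ k
  | 0, _ => by rwa [h.zero]
  | t + 1, ht => by
    have := h.card_le hinit t (by omega)
    rcases h.card_succ ht with hcard | hcard <;> omega

lemma card_mono (h : IsBelady k init req T B) (hst : s ≤ t) (ht : t ≤ T) :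
    (B s).card ≤ (B t).card := by
  induction t, hst using Nat.le_induction with
  | base => exact le_rfl
  | succ t _ ih =>
    have := ih (by omega)
    rcases h.card_succ ht with hcard | hcard <;> omega

lemma of_evicted (h : IsBelady k init req T B) (ht : t < T) (hp : p ∈ B t)
    (hp' : p ∉ B (t + 1)) :
    k ≤ (B t).card ∧ req t ∉ B t ∧
      ∀ q ∈ B t, ∀ s, t < s → s < T → req s = p → ∃ s', t < s' ∧ s' ≤ s ∧ req s' = q := by
  by_cases hmem : req t ∈ B t
  · rw [h.hit t ht hmem] at hp'
    exact absurd hp hp'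
  by_cases hcard : (B t).card < k
  · rw [h.load t ht hmem hcard] at hp'
    exact absurd (Finset.mem_insert_of_mem hp) hp'
  · obtain ⟨p', -, hlast, hB⟩ := h.evict t ht hmem (not_lt.1 hcard)
    obtain rfl : p = p' := by
      by_contra hne
      rw [hB] at hp'
      exact hp' (Finset.mem_insert_of_mem (Finset.mem_erase.2 ⟨hne, hp⟩))
    exact ⟨not_lt.1 hcard, hmem, hlast⟩

lemma subset_union (h : IsBelady k init req T B) (hst : s ≤ t) (ht : t ≤ T) :
    B t ⊆ B s ∪ requested req s t := by
  induction t, hst using Nat.le_induction with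
  | base => exact Finset.subset_union_left
  | succ t hst ih =>
    rw [requested_succ req hst, Finset.union_insert]
    exact (h.subset_insert ht).trans (Finset.insert_subset_insert _ (ih (by omega)))

lemma card_sdiff_add_faults_le (h : IsBelady k init req T B) (hst : s ≤ t) (ht : t ≤ T) :
    (requested req s t \ B s).card + faults req s B ≤ faults req t B := by
  induction t, hst using Nat.le_induction with
  | base => simp [requested_self]
  | succ t hst ih =>
    have ih := ih (by omega)
    rw [faults_succ, requested_succ req hst]
    by_cases hmem : req t ∈ B t
    · have hsub : insert (req t) (requested req s t) \ B s ⊆ requested req s t \ B s := by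
        have := h.subset_union hst (by omega) hmem
        intro y
        simp only [Finset.mem_sdiff, Finset.mem_insert, Finset.mem_union] at this ⊢
        grind
      have := Finset.card_le_card hsub
      rw [if_pos hmem]
      omega
    · have hcard : (insert (req t) (requested req s t) \ B s).card
          ≤ (requested req s t \ B s).card + 1 :=
        (Finset.card_le_card (by grind)).trans (Finset.card_insert_le (req t) _)
      rw [if_neg hmem]
      omega

/-- An eviction at time `z` of a page that is requested again at time `x < t` would mean that
between `z` and `x` all `k` cached pages are requested, besides the page loaded at time `z`. -/
lemma mem_of_card_requested_le (h : IsBelady k init req T B) (hsv : s ≤ v) (hvx : v ≤ x)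
    (hxt : x < t) (ht : t ≤ T) (hcard : (requested req s t).card ≤ k) (hv : req x ∈ B v) :
    req x ∈ B x := by
  by_contra hx
  obtain ⟨z, ⟨hvz, hzx⟩, hz, hz'⟩ := exists_evicted hvx hv hx
  obtain ⟨hfull, hfault, hlast⟩ := h.of_evicted (by omega) hz hz'
  have hsub : insert (req z) (B z) ⊆ requested req s t := by
    intro q hq
    rw [mem_requested]
    rcases Finset.mem_insert.1 hq with rfl | hq
    · exact ⟨z, by omega, rfl⟩
    · obtain ⟨i, hzi, hix, hi⟩ := hlast q hq x hzx (by omega) rfl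
      exact ⟨i, by omega, hi⟩
  have := Finset.card_le_card hsub
  rw [Finset.card_insert_of_notMem hfault] at this
  omega

lemma faults_le_add_card_sdiff (h : IsBelady k init req T B) (hst : s ≤ t) (ht : t ≤ T)
    (hcard : (requested req s t).card ≤ k) :
    faults req t B ≤ faults req s B + (requested req s t \ B s).card := by
  induction t, hst using Nat.le_induction with
  | base => exact Nat.le_add_right _ _
  | succ t hst ih =>
    have hsub : requested req s t ⊆ requested req s (t + 1) := by
      rw [requested_succ req hst]
      exact Finset.subset_insert _ _
    have ih := ih (by omega) ((Finset.card_le_card hsub).trans hcard)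
    rw [faults_succ]
    by_cases hmem : req t ∈ B t
    · have := Finset.card_le_card (Finset.sdiff_subset_sdiff hsub (le_refl (B s)))
      rw [if_pos hmem]
      omega
    · have hnot : req t ∉ B s := fun hs ↦
        hmem (h.mem_of_card_requested_le le_rfl hst t.lt_succ_self ht hcard hs)
      have hnew : req t ∉ requested req s t := fun hr ↦ by
        obtain ⟨z, hz, hzt⟩ := mem_requested.1 hr
        have := hzt ▸ h.mem_succ (t := z) (by omega)
        exact hmem (h.mem_of_card_requested_le (v := z + 1) (by omega) (by omega)
          t.lt_succ_self ht hcard this)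
      rw [if_neg hmem, requested_succ req hst, Finset.insert_sdiff_of_notMem _ hnot,
        Finset.card_insert_of_notMem fun hr ↦ hnew (Finset.mem_sdiff.1 hr).1]
      omega

lemma subset_requested_of_evicted (h : IsBelady k init req T B) (hsv : s' ≤ v) (hvs : v < s)
    (ht : t ≤ T) (hp : p ∈ B v) (hp' : p ∉ B (v + 1)) (hpt : p ∈ requested req s t) :
    B s ⊆ requested req s' t := by
  obtain ⟨x, hx, rfl⟩ := mem_requested.1 hpt
  obtain ⟨-, -, hlast⟩ := h.of_evicted (by omega) hp hp'
  intro q hq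
  rw [mem_requested]
  rcases Finset.mem_union.1 (h.subset_union hvs.le (by omega) hq) with hqv | hqv
  · obtain ⟨i, hvi, hix, hi⟩ := hlast q hqv x (by omega) (by omega) rfl
    exact ⟨i, by omega, hi⟩
  · obtain ⟨i, hvi, hi⟩ := mem_requested.1 hqv
    exact ⟨i, by omega, hi⟩

/-- If Belady's algorithm has dropped a page of `[s', s)` that is needed again before `t`, then its
whole cache at time `s` is requested in `[s', t)`. -/
lemma card_reloaded_le (h : IsBelady k init req T B) (ht : t ≤ T)
    (hcard : (requested req s' s).card = k) :
    ((requested req s t ∩ requested req s' s) \ B s).card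
      ≤ (requested req s t \ requested req s' s).card := by
  obtain hempty | ⟨p, hp⟩ :=
    ((requested req s t ∩ requested req s' s) \ B s).eq_empty_or_nonempty
  · simp [hempty]
  obtain ⟨⟨hpt, hps⟩, hpB⟩ := by simpa only [Finset.mem_sdiff, Finset.mem_inter] using hp
  obtain ⟨z, hz, hzp⟩ := mem_requested.1 hps
  obtain ⟨x, hx, -⟩ := mem_requested.1 hpt
  obtain ⟨v, hv, hpv, hpv'⟩ := exists_evicted (s := z + 1) (t := s) (by omega)
    (hzp ▸ h.mem_succ (by omega)) hpB
  have hfull : (requested req s' s).card ≤ (B s).card :=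
    hcard.trans_le ((h.of_evicted (by omega) hpv hpv').1.trans (h.card_mono hv.2.le (by omega)))
  have hcached : B s ⊆ requested req s' s ∪ requested req s t := by
    rw [requested_union_requested req (by omega) (by omega)]
    exact h.subset_requested_of_evicted (by omega) hv.2 ht hpv hpv' hpt
  calc ((requested req s t ∩ requested req s' s) \ B s).card
      ≤ (requested req s' s \ B s).card :=
        Finset.card_le_card (Finset.sdiff_subset_sdiff Finset.inter_subset_right le_rfl)
    _ ≤ (B s \ requested req s' s).card := Finset.card_sdiff_le_card_sdiff_iff.2 hfull
    _ ≤ (requested req s t \ requested req s' s).card :=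
        Finset.card_le_card fun q hq ↦ Finset.mem_sdiff.2
          ⟨(Finset.mem_union.1 (hcached (Finset.mem_sdiff.1 hq).1)).resolve_left
            (Finset.mem_sdiff.1 hq).2, (Finset.mem_sdiff.1 hq).2⟩

end IsBelady

/-! ### Phases and epochs -/

/-- The bookkeeping that depends on the requests only. A phase is a maximal interval with requests
to at most `k` pages; `marked` is the set of pages requested so far in the current phase and `base`
is the set of pages of the previous phase (in the first phase, the initial cache). A phase is
divided into epochs: an epoch of weight `w` lasts until `2 * w` pages outside of `base` have been
requested in the phase. -/
structure PhaseData (Page : Type u) where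
  base : Finset Page
  marked : Finset Page
  weight : ℕ

namespace PhaseData

variable {Page : Type u} [DecidableEq Page]

/-- The number of pages requested in the current phase, but not in the previous one. -/
def clean (d : PhaseData Page) : ℕ := (d.marked \ d.base).card

/-- The pages of the current and the previous phase. -/
def pages (d : PhaseData Page) : Finset Page := d.base ∪ d.marked

/-- The request `r` starts a new phase. -/
abbrev NewPhase (k : ℕ) (d : PhaseData Page) (r : Page) : Prop :=
  r ∉ d.marked ∧ k ≤ d.marked.card

/-- The request `r` starts a new epoch; the first epoch of a phase starts with the phase. -/
abbrev NewEpoch (k : ℕ) (d : PhaseData Page) (r : Page) : Prop :=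
  d.NewPhase k r ∨ (r ∉ d.pages ∧ 2 * d.weight ≤ d.clean + 1)

/-- The phase and epoch data after request `r`. -/
def next (k : ℕ) (d : PhaseData Page) (r : Page) : PhaseData Page :=
  if d.NewPhase k r then ⟨d.marked, {r}, 1⟩
  else ⟨d.base, insert r d.marked, if d.NewEpoch k r then d.clean + 1 else d.weight⟩

/-- Properties that hold at all times. -/
structure Valid (k : ℕ) (d : PhaseData Page) : Prop where
  card_base : d.base.card ≤ k
  card_marked : d.marked.card ≤ k
  clean_lt : 0 < d.clean → d.clean < 2 * d.weight
  weight_le : d.weight ≤ d.clean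

variable {k : ℕ} {d : PhaseData Page} {r : Page}

lemma valid_start {init : Finset Page} (hinit : init.card ≤ k) :
    (⟨init, ∅, 0⟩ : PhaseData Page).Valid k :=
  ⟨hinit, by simp, by simp [clean], by simp⟩

lemma next_of_newPhase (h : d.NewPhase k r) : d.next k r = ⟨d.marked, {r}, 1⟩ := if_pos h

lemma clean_next_of_newPhase (h : d.NewPhase k r) : (d.next k r).clean = 1 := by
  rw [next_of_newPhase h, clean,
    Finset.sdiff_eq_self_of_disjoint (Finset.disjoint_singleton_left.2 h.1), Finset.card_singleton]

lemma base_next (h : ¬ d.NewPhase k r) : (d.next k r).base = d.base := by rw [next, if_neg h]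

lemma marked_next (h : ¬ d.NewPhase k r) : (d.next k r).marked = insert r d.marked := by
  rw [next, if_neg h]

lemma pages_next (h : ¬ d.NewPhase k r) : (d.next k r).pages = insert r d.pages := by
  rw [pages, base_next h, marked_next h, Finset.union_insert, pages]

lemma clean_next (h : ¬ d.NewPhase k r) :
    (d.next k r).clean = d.clean + if r ∈ d.pages then 0 else 1 := by
  rw [clean, base_next h, marked_next h, clean, pages]
  by_cases hbase : r ∈ d.base
  · simp [Finset.insert_sdiff_of_mem _ hbase, hbase]
  by_cases hmarked : r ∈ d.marked
  · simp [Finset.insert_eq_of_mem hmarked, hmarked]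
  · rw [Finset.insert_sdiff_of_notMem _ hbase, Finset.card_insert_of_notMem (by simp [hmarked])]
    simp [hbase, hmarked]

lemma not_mem_pages_of_newEpoch (h : ¬ d.NewPhase k r) (he : d.NewEpoch k r) : r ∉ d.pages :=
  (he.resolve_left h).1

lemma clean_next_of_newEpoch (h : ¬ d.NewPhase k r) (he : d.NewEpoch k r) :
    (d.next k r).clean = d.clean + 1 := by
  rw [clean_next h, if_neg (not_mem_pages_of_newEpoch h he)]

lemma weight_next_of_newEpoch (he : d.NewEpoch k r) : (d.next k r).weight = (d.next k r).clean := by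
  by_cases h : d.NewPhase k r
  · rw [clean_next_of_newPhase h, next_of_newPhase h]
  · rw [clean_next_of_newEpoch h he, next, if_neg h, if_pos he]

lemma clean_next_pos (he : d.NewEpoch k r) : 0 < (d.next k r).clean := by
  by_cases h : d.NewPhase k r
  · rw [clean_next_of_newPhase h]
    exact zero_lt_one
  · rw [clean_next_of_newEpoch h he]
    exact d.clean.succ_pos

lemma not_newPhase (he : ¬ d.NewEpoch k r) : ¬ d.NewPhase k r := fun h ↦ he (Or.inl h)

lemma next_of_not_newEpoch (he : ¬ d.NewEpoch k r) :
    d.next k r = ⟨d.base, insert r d.marked, d.weight⟩ := by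
  rw [next, if_neg (not_newPhase he), if_neg he]

lemma mem_marked_next (k : ℕ) (d : PhaseData Page) (r : Page) : r ∈ (d.next k r).marked := by
  by_cases h : d.NewPhase k r
  · simp [next_of_newPhase h]
  · simp [marked_next h]

lemma mem_pages_next (k : ℕ) (d : PhaseData Page) (r : Page) : r ∈ (d.next k r).pages :=
  Finset.mem_union_right _ (mem_marked_next k d r)

lemma card_pages (d : PhaseData Page) : d.pages.card = d.base.card + d.clean := by
  rw [pages, Finset.union_comm, add_comm, clean, Finset.card_sdiff_add_card]

lemma Valid.next (hk : 0 < k) (hd : d.Valid k) (r : Page) : (d.next k r).Valid k := by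
  by_cases h : d.NewPhase k r
  · have hclean := clean_next_of_newPhase h
    rw [next_of_newPhase h] at hclean ⊢
    exact ⟨hd.card_marked, by simpa using Nat.succ_le_of_lt hk,
      fun _ ↦ by rw [hclean]; exact one_lt_two, hclean.ge⟩
  refine ⟨base_next h ▸ hd.card_base, ?_, ?_, ?_⟩
  · rw [marked_next h]
    by_cases hr : r ∈ d.marked
    · rw [Finset.insert_eq_of_mem hr]
      exact hd.card_marked
    · rw [Finset.card_insert_of_notMem hr]
      exact not_le.1 fun hcard ↦ h ⟨hr, hcard⟩
  · by_cases he : d.NewEpoch k r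
    · have := weight_next_of_newEpoch he
      omega
    · have hweight : (d.next k r).weight = d.weight := by rw [next_of_not_newEpoch he]
      rw [clean_next h, hweight]
      split_ifs with hr
      · exact hd.clean_lt
      · exact fun _ ↦ not_le.1 fun hw ↦ he (Or.inr ⟨hr, hw⟩)
  · by_cases he : d.NewEpoch k r
    · exact (weight_next_of_newEpoch he).le
    · rw [clean_next h, next_of_not_newEpoch he]
      exact hd.weight_le.trans (Nat.le_add_right _ _)

end PhaseData

section Phases

open PhaseData

variable {Page : Type u} [DecidableEq Page] (k : ℕ) (init : Finset Page) (req : ℕ → Page)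

/-- The phase and epoch data before request `t`. -/
def phaseAt : ℕ → PhaseData Page
  | 0 => ⟨init, ∅, 0⟩
  | t + 1 => (phaseAt t).next k (req t)

/-- The total weight of all epochs started before request `t`. -/
def totalWeight : ℕ → ℕ
  | 0 => 0
  | t + 1 => totalWeight t +
      if (phaseAt k init req t).NewEpoch k (req t) then (phaseAt k init req (t + 1)).weight else 0

/-- The time of the first request of the phase that is current before request `t`. -/
def phaseStart : ℕ → ℕ
  | 0 => 0
  | t + 1 => if (phaseAt k init req t).NewPhase k (req t) then t else phaseStart t

/-- The time of the first request of the phase before the current one (`0` in the first phase). -/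
def prevStart : ℕ → ℕ
  | 0 => 0
  | t + 1 => if (phaseAt k init req t).NewPhase k (req t) then phaseStart k init req t
      else prevStart t

/-- The bookkeeping before request `t` describes the requests of the current and the previous
phase. -/
structure Describes (t : ℕ) : Prop where
  valid : (phaseAt k init req t).Valid k
  phaseStart_le : phaseStart k init req t ≤ t
  prevStart_le : prevStart k init req t ≤ phaseStart k init req t
  marked_eq : (phaseAt k init req t).marked = requested req (phaseStart k init req t) t
  base_eq : (prevStart k init req t = 0 ∧ phaseStart k init req t = 0 ∧
      (phaseAt k init req t).base = init) ∨
    ((phaseAt k init req t).base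
        = requested req (prevStart k init req t) (phaseStart k init req t) ∧
      (phaseAt k init req t).base.card = k)

variable {k init}

lemma phaseStart_succ_of_newPhase {t : ℕ} (h : (phaseAt k init req t).NewPhase k (req t)) :
    phaseStart k init req (t + 1) = t := if_pos h

lemma phaseStart_succ {t : ℕ} (h : ¬ (phaseAt k init req t).NewPhase k (req t)) :
    phaseStart k init req (t + 1) = phaseStart k init req t := if_neg h

lemma prevStart_succ_of_newPhase {t : ℕ} (h : (phaseAt k init req t).NewPhase k (req t)) :
    prevStart k init req (t + 1) = phaseStart k init req t := if_pos h

lemma prevStart_succ {t : ℕ} (h : ¬ (phaseAt k init req t).NewPhase k (req t)) :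
    prevStart k init req (t + 1) = prevStart k init req t := if_neg h

lemma describes (hk : 0 < k) (hinit : init.card ≤ k) : ∀ t, Describes k init req t
  | 0 =>
    { valid := valid_start hinit
      phaseStart_le := le_rfl
      prevStart_le := le_rfl
      marked_eq := (requested_self req 0).symm
      base_eq := Or.inl ⟨rfl, rfl, rfl⟩ }
  | t + 1 => by
    have ih := describes hk hinit t
    by_cases h : (phaseAt k init req t).NewPhase k (req t)
    · have hat : phaseAt k init req (t + 1) = ⟨(phaseAt k init req t).marked, {req t}, 1⟩ :=
        next_of_newPhase h
      refine ⟨ih.valid.next hk _, ?_, ?_, ?_, Or.inr ?_⟩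
      · rw [phaseStart_succ_of_newPhase req h]
        exact t.le_succ
      · rw [phaseStart_succ_of_newPhase req h, prevStart_succ_of_newPhase req h]
        exact ih.phaseStart_le
      · rw [phaseStart_succ_of_newPhase req h, hat, requested_succ req le_rfl, requested_self]
        rfl
      · rw [phaseStart_succ_of_newPhase req h, prevStart_succ_of_newPhase req h, hat]
        exact ⟨ih.marked_eq, le_antisymm ih.valid.card_marked h.2⟩
    · refine ⟨ih.valid.next hk _, ?_, ?_, ?_, ?_⟩ <;> rw [phaseStart_succ req h]
      · exact ih.phaseStart_le.trans t.le_succ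
      · rw [prevStart_succ req h]
        exact ih.prevStart_le
      · rw [phaseAt, marked_next h, ih.marked_eq, requested_succ req ih.phaseStart_le]
      · rw [prevStart_succ req h, phaseAt, base_next h]
        exact ih.base_eq

variable {req} {T t : ℕ} {B : ℕ → Finset Page}

lemma faults_le_add_clean (hk : 0 < k) (hinit : init.card ≤ k) (h : IsBelady k init req T B)
    (ht : t ≤ T) :
    faults req t B ≤ faults req (phaseStart k init req t) B + 2 * (phaseAt k init req t).clean := by
  have hdesc := describes req hk hinit t
  have hcard := hdesc.marked_eq ▸ hdesc.valid.card_marked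
  have hfaults := h.faults_le_add_card_sdiff hdesc.phaseStart_le ht hcard
  rw [← hdesc.marked_eq] at hfaults
  set d := phaseAt k init req t
  set S := B (phaseStart k init req t) with hS
  have hmissing : (d.marked \ S).card ≤ 2 * d.clean := by
    rcases hdesc.base_eq with ⟨-, hstart, hbase⟩ | ⟨hbase, hfull⟩
    · rw [hS, hstart, h.zero, ← hbase]
      exact Nat.le_mul_of_pos_left _ two_pos
    · have hreloaded := h.card_reloaded_le ht (hbase ▸ hfull)
      rw [← hbase, ← hdesc.marked_eq] at hreloaded
      have hsub : d.marked \ S ⊆ (d.marked \ d.base) ∪ ((d.marked ∩ d.base) \ S) := by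
        intro y
        simp only [Finset.mem_sdiff, Finset.mem_union, Finset.mem_inter]
        tauto
      calc (d.marked \ S).card
          ≤ (d.marked \ d.base).card + ((d.marked ∩ d.base) \ S).card :=
            (Finset.card_le_card hsub).trans (Finset.card_union_le _ _)
        _ ≤ d.clean + d.clean := Nat.add_le_add_left hreloaded _
        _ = 2 * d.clean := (two_mul _).symm
  omega

lemma clean_add_faults_le (hk : 0 < k) (hinit : init.card ≤ k) (h : IsBelady k init req T B)
    (ht : t ≤ T) :
    (phaseAt k init req t).clean + faults req (prevStart k init req t) B ≤ faults req t B := by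
  have hdesc := describes req hk hinit t
  have hle := hdesc.prevStart_le.trans hdesc.phaseStart_le
  refine le_trans (Nat.add_le_add_right ?_ _) (h.card_sdiff_add_faults_le hle ht)
  rcases hdesc.base_eq with ⟨hprev, hstart, hbase⟩ | ⟨hbase, hfull⟩
  · rw [hprev, h.zero, clean, hbase, hdesc.marked_eq, hstart]
  · have hpages : (phaseAt k init req t).pages = requested req (prevStart k init req t) t := by
      rw [pages, hbase, hdesc.marked_eq,
        requested_union_requested req hdesc.prevStart_le hdesc.phaseStart_le]
    have hcard := (phaseAt k init req t).card_pages
    have hcache := h.card_le hinit (prevStart k init req t) (by omega)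
    have := Finset.le_card_sdiff (B (prevStart k init req t)) (phaseAt k init req t).pages
    rw [← hpages]
    omega

lemma totalWeight_le_of_phases (hk : 0 < k) (hinit : init.card ≤ k) (h : IsBelady k init req T B) :
    ∀ t ≤ T, totalWeight k init req t ≤ 2 * faults req (prevStart k init req t) B
      + 2 * faults req (phaseStart k init req t) B + 2 * (phaseAt k init req t).weight
  | 0, _ => Nat.zero_le _
  | t + 1, ht => by
    have ih := totalWeight_le_of_phases hk hinit h t (by omega)
    have hvalid := (describes (init := init) req hk hinit t).valid
    have hat : phaseAt k init req (t + 1) = (phaseAt k init req t).next k (req t) := rfl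
    rw [totalWeight, hat]
    by_cases hp : (phaseAt k init req t).NewPhase k (req t)
    · have hclean := clean_add_faults_le hk hinit h (t := t) (by omega)
      have hle := hvalid.weight_le
      rw [if_pos (Or.inl hp), phaseStart_succ_of_newPhase req hp,
        prevStart_succ_of_newPhase req hp, next_of_newPhase hp]
      change _ + 1 ≤ _ + 2 * 1
      omega
    rw [phaseStart_succ req hp, prevStart_succ req hp]
    by_cases he : (phaseAt k init req t).NewEpoch k (req t)
    · have hclean := clean_next_of_newEpoch hp he
      have hweight := weight_next_of_newEpoch he
      have hlarge := (he.resolve_left hp).2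
      rw [if_pos he]
      omega
    · rw [if_neg he, next_of_not_newEpoch he]
      exact ih

lemma totalWeight_le (hk : 0 < k) (hinit : init.card ≤ k) (h : IsBelady k init req T B)
    (ht : t ≤ T) : totalWeight k init req t ≤ 4 * faults req t B := by
  have hdesc := describes (init := init) req hk hinit t
  have hphases := totalWeight_le_of_phases hk hinit h t ht
  have hclean := clean_add_faults_le hk hinit h ht
  have hweight := hdesc.valid.weight_le
  have hmono := faults_mono req B hdesc.phaseStart_le
  omega

end Phases

/-! ### The algorithm -/

section Trim

variable {α : Type*} {n : ℕ} {A : Finset α}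

/-- Some subset with at most `n` elements, as large as possible. -/
noncomputable def trim (n : ℕ) (A : Finset α) : Finset α :=
  if h : n ≤ A.card then (Finset.exists_subset_card_eq h).choose else A

lemma trim_subset (n : ℕ) (A : Finset α) : trim n A ⊆ A := by
  unfold trim
  split_ifs with h
  · exact (Finset.exists_subset_card_eq h).choose_spec.1
  · exact le_rfl

lemma card_trim (n : ℕ) (A : Finset α) : (trim n A).card = min n A.card := by
  unfold trim
  split_ifs with h
  · rw [(Finset.exists_subset_card_eq h).choose_spec.2, min_eq_left h]
  · rw [min_eq_right (not_le.1 h).le]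

lemma trim_eq_self (h : A.card ≤ n) : trim n A = A :=
  Finset.eq_of_subset_of_card_le (trim_subset n A) (by rw [card_trim, min_eq_right h])

end Trim

section Evict

variable {Page : Type u} [DecidableEq Page] {k : ℕ} {r : Page} {X M Y : Finset Page}

/-- The distribution of the cache after page `r` has been brought into the cache `X`, evicting a
random page outside of `M` if necessary. If all pages of a full cache belong to `M`, then only `r`
is kept; the algorithm never uses this case. -/
noncomputable def evict (k : ℕ) (r : Page) (X M : Finset Page) : PMF (Finset Page) :=
  if r ∈ X then PMF.pure X
  else if X.card < k then PMF.pure (insert r X)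
  else if h : (X \ M).Nonempty then
    (PMF.uniformOfFinset (X \ M) h).map fun p ↦ insert r (X.erase p)
  else PMF.pure {r}

lemma finite_support_evict (k : ℕ) (r : Page) (X M : Finset Page) :
    (evict k r X M).support.Finite := by
  unfold evict
  split_ifs with _ _ h
  · exact finite_support_pure _
  · exact finite_support_pure _
  · refine finite_support_map _ ?_
    rw [PMF.support_uniformOfFinset]
    exact (X \ M).finite_toSet
  · exact finite_support_pure _

lemma mem_of_mem_support_evict (hY : Y ∈ (evict k r X M).support) : r ∈ Y := by
  unfold evict at hY
  split_ifs at hY with hr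
  · rw [PMF.support_pure] at hY
    rwa [Set.mem_singleton_iff.1 hY]
  · rw [PMF.support_pure] at hY
    rw [Set.mem_singleton_iff.1 hY]
    exact Finset.mem_insert_self _ _
  · obtain ⟨p, -, rfl⟩ := (PMF.mem_support_map_iff _ _ _).1 hY
    exact Finset.mem_insert_self _ _
  · rw [PMF.support_pure] at hY
    rw [Set.mem_singleton_iff.1 hY]
    exact Finset.mem_singleton_self _

lemma card_le_of_mem_support_evict (hk : 0 < k) (hX : X.card ≤ k)
    (hY : Y ∈ (evict k r X M).support) : Y.card ≤ k := by
  unfold evict at hY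
  split_ifs at hY with hr hcard
  · rw [PMF.support_pure] at hY
    rwa [Set.mem_singleton_iff.1 hY]
  · rw [PMF.support_pure] at hY
    rw [Set.mem_singleton_iff.1 hY, Finset.card_insert_of_notMem hr]
    exact hcard
  · obtain ⟨p, hp, rfl⟩ := (PMF.mem_support_map_iff _ _ _).1 hY
    rw [PMF.support_uniformOfFinset] at hp
    refine (Finset.card_insert_le _ _).trans ?_
    rwa [Finset.card_erase_add_one (Finset.mem_sdiff.1 hp).1]
  · rw [PMF.support_pure] at hY
    rwa [Set.mem_singleton_iff.1 hY, Finset.card_singleton]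

lemma mem_support_evict_cases (hX : X.card ≤ k) (hne : r ∉ X → X.card = k → (X \ M).Nonempty)
    (hY : Y ∈ (evict k r X M).support) :
    (r ∈ X ∧ Y = X) ∨ (r ∉ X ∧ X.card < k ∧ Y = insert r X) ∨
      (r ∉ X ∧ X.card = k ∧ ∃ p ∈ X \ M, Y = insert r (X.erase p)) := by
  unfold evict at hY
  split_ifs at hY with hr hcard hout
  · rw [PMF.support_pure] at hY
    exact Or.inl ⟨hr, hY⟩
  · rw [PMF.support_pure] at hY
    exact Or.inr (Or.inl ⟨hr, hcard, hY⟩)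
  · obtain ⟨p, hp, rfl⟩ := (PMF.mem_support_map_iff _ _ _).1 hY
    rw [PMF.support_uniformOfFinset] at hp
    exact Or.inr (Or.inr ⟨hr, hX.antisymm (not_lt.1 hcard), p, hp, rfl⟩)
  · exact absurd (hne hr (hX.antisymm (not_lt.1 hcard))) hout

end Evict

/-- The configuration of the algorithm. `cached` is the content of the cache and `ref` is a set of
pages believed to contain the cache of the optimal solution. The algorithm counts in `misses` the
requests outside of `ref`; if there are too many, it proceeds to the next level. On the last level
it evicts at random pages that are not in `recent`, the set of pages requested on that level,
without predictions. On the other levels, the first fault starts a period, in which the predictor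
is queried `queries` times; `elapsed` is the number of steps of the period that are over. The
answer to the query number `chosen`, drawn at random, becomes the new reference set. If the level
changes, then `chosen` is withdrawn and the period is no longer `fresh`. -/
structure Conf (Page : Type u) where
  phase : PhaseData Page
  cached : Finset Page
  ref : Finset Page
  recent : Finset Page
  level : ℕ
  misses : ℕ
  queries : ℕ
  elapsed : ℕ
  chosen : Option ℕ
  fresh : Bool

namespace Conf

/-- The actual cache content. For the configurations that are reached, it is `s.cached`. -/
def cache {Page : Type u} (k : ℕ) (s : Conf Page) : Finset Page :=
  if s.cached.card ≤ k then s.cached else ∅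

lemma card_cache_le {Page : Type u} (k : ℕ) (s : Conf Page) : (s.cache k).card ≤ k := by
  unfold cache
  split_ifs with h
  · exact h
  · exact Nat.zero_le _

variable {Page : Type u} [DecidableEq Page]

/-- The request `r` makes the algorithm proceed to the next level. -/
abbrev Fails (k L : ℕ) (s : Conf Page) (r : Page) : Prop :=
  ¬ s.phase.NewEpoch k r ∧ s.level < L ∧ 7 * s.phase.weight < s.misses + if r ∈ s.ref then 0 else 1

/-- The configuration when request `r` starts a new epoch. -/
noncomputable def startEpoch (k : ℕ) (s : Conf Page) (r : Page) : Conf Page :=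
  { phase := s.phase.next k r
    cached := if s.phase.NewPhase k r then trim k s.phase.marked else s.cache k
    ref := (s.phase.next k r).pages, recent := ∅, level := 0, misses := 0
    queries := s.queries, elapsed := s.elapsed, chosen := none, fresh := false }

/-- The configuration when request `r` makes the algorithm proceed to the next level. -/
def climb (k : ℕ) (s : Conf Page) (r : Page) : Conf Page :=
  { phase := s.phase.next k r
    cached := s.cache k
    ref := (s.phase.next k r).pages, recent := ∅, level := s.level + 1, misses := 0
    queries := s.queries, elapsed := s.elapsed, chosen := none, fresh := false }

/-- The configuration when request `r` does not change epoch and level. -/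
def stay (k : ℕ) (s : Conf Page) (r : Page) : Conf Page :=
  { s with
    phase := s.phase.next k r
    cached := s.cache k
    ref := insert r s.ref
    misses := s.misses + if r ∈ s.ref then 0 else 1 }

/-- The update of epoch and level upon request `r`, before the request is served. -/
noncomputable def update (k L : ℕ) (s : Conf Page) (r : Page) : Conf Page :=
  if s.phase.NewEpoch k r then s.startEpoch k r
  else if s.Fails k L r then s.climb k r
  else s.stay k r

/-- There is a fault outside of a period. -/
abbrev StartsPeriod (a L : ℕ) (N : ℕ → ℕ) (s : Conf Page) (r : Page) : Prop :=
  s.queries * a ≤ s.elapsed ∧ r ∉ s.cached ∧ s.level < L ∧ 0 < N s.level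

/-- Start a new period in which query number `l` is used. -/
def startPeriod (N : ℕ → ℕ) (s : Conf Page) (l : ℕ) : Conf Page :=
  { s with queries := N s.level, elapsed := 0, chosen := some l, fresh := true }

/-- A query is made in the current step. -/
abbrev Asks (a : ℕ) (s : Conf Page) : Prop := s.elapsed < s.queries * a ∧ a ∣ s.elapsed + 1

/-- The answer to the query in the current step is used. -/
abbrev Adopts (a : ℕ) (s : Conf Page) : Prop :=
  s.Asks a ∧ s.chosen = some ((s.elapsed + 1) / a - 1)

/-- The cache content derived from the answer `R` of the predictor, when `r` is requested. -/
noncomputable def adopted (k : ℕ) (s : Conf Page) (r : Page) (R : Finset Page) : Finset Page :=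
  insert r (trim (k - 1) (s.ref.erase r \ R))

/-- Adopt the answer `R` of the predictor. -/
noncomputable def adopt (k : ℕ) (s : Conf Page) (r : Page) (R : Finset Page) : Conf Page :=
  { s with
    cached := s.adopted k r R
    ref := s.adopted k r R
    elapsed := s.elapsed + 1
    chosen := none }

/-- Proceed to cache content `X`. -/
def serve (a L : ℕ) (s : Conf Page) (r : Page) (X : Finset Page) : Conf Page :=
  { s with
    cached := X
    recent := if s.level < L then s.recent else insert r s.recent
    elapsed := if s.elapsed < s.queries * a then s.elapsed + 1 else s.elapsed }

/-- Serve the request. -/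
noncomputable def finish (k a L : ℕ) (s : Conf Page) (r : Page) (R : Finset Page) :
    PMF (Conf Page) :=
  if s.Adopts a then PMF.pure (s.adopt k r R)
  else (evict k r s.cached s.recent).map (s.serve a L r)

/-- The reaction to request `r` and answer `R`. -/
noncomputable def move (k a L : ℕ) (N : ℕ → ℕ) (s : Conf Page) (r : Page) (R : Finset Page) :
    PMF (Conf Page) :=
  if h : (s.update k L r).StartsPeriod a L N r then
    (PMF.uniformOfFinset (Finset.range (N (s.update k L r).level))
      (Finset.nonempty_range_iff.2 h.2.2.2.ne')).bind
      fun l ↦ ((s.update k L r).startPeriod N l).finish k a L r R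
  else (s.update k L r).finish k a L r R

/-- The configuration in which it is decided whether there is a query. The decision does not
depend on the number of the query to be used, so that number is set to `0` here. -/
noncomputable def lead (k a L : ℕ) (N : ℕ → ℕ) (s : Conf Page) (r : Page) : Conf Page :=
  if (s.update k L r).StartsPeriod a L N r then (s.update k L r).startPeriod N 0
  else s.update k L r

/-- The query in reaction to request `r`. The answer is large enough to leave at most `k - 1`
candidates, provided that the predicted cache contains `r`. -/
noncomputable def ask (k a L : ℕ) (N : ℕ → ℕ) (s : Conf Page) (r : Page) :
    Option (Finset Page × ℕ) :=
  if (s.lead k a L N r).Asks a then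
    some ((s.update k L r).ref.erase r, ((s.update k L r).ref.erase r).card + 1 - k)
  else none

variable {k a L : ℕ} {N : ℕ → ℕ} {s s' : Conf Page} {r : Page} {R : Finset Page}

lemma update_of_newEpoch (h : s.phase.NewEpoch k r) : s.update k L r = s.startEpoch k r := if_pos h

lemma update_of_fails (h : s.Fails k L r) : s.update k L r = s.climb k r := by
  rw [update, if_neg h.1, if_pos h]

lemma update_of_not_fails (he : ¬ s.phase.NewEpoch k r) (hf : ¬ s.Fails k L r) :
    s.update k L r = s.stay k r := by
  rw [update, if_neg he, if_neg hf]

lemma phase_update (k L : ℕ) (s : Conf Page) (r : Page) :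
    (s.update k L r).phase = s.phase.next k r := by
  unfold update
  split_ifs <;> rfl

lemma queries_update (k L : ℕ) (s : Conf Page) (r : Page) :
    (s.update k L r).queries = s.queries := by
  unfold update
  split_ifs <;> rfl

lemma elapsed_update (k L : ℕ) (s : Conf Page) (r : Page) :
    (s.update k L r).elapsed = s.elapsed := by
  unfold update
  split_ifs <;> rfl

lemma card_cached_update_le (s : Conf Page) (r : Page) : (s.update k L r).cached.card ≤ k := by
  unfold update
  split_ifs
  · rw [startEpoch]
    split_ifs
    · exact (card_trim _ _).trans_le (min_le_left _ _)
    · exact card_cache_le k s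
  all_goals exact card_cache_le k s

lemma finite_support_finish (s : Conf Page) (r : Page) (R : Finset Page) :
    (s.finish k a L r R).support.Finite := by
  unfold finish
  split_ifs
  · exact finite_support_pure _
  · exact finite_support_map _ (finite_support_evict _ _ _ _)

lemma finite_support_move (s : Conf Page) (r : Page) (R : Finset Page) :
    (s.move k a L N r R).support.Finite := by
  unfold move
  split_ifs
  · refine finite_support_bind ?_ fun l _ ↦ finite_support_finish _ _ _
    rw [PMF.support_uniformOfFinset]
    exact Finset.finite_toSet _
  · exact finite_support_finish _ _ _

lemma mem_support_finish (h : s' ∈ (s.finish k a L r R).support) :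
    (s.Adopts a ∧ s' = s.adopt k r R) ∨
      (¬ s.Adopts a ∧ ∃ X ∈ (evict k r s.cached s.recent).support, s' = s.serve a L r X) := by
  unfold finish at h
  split_ifs at h with hadopts
  · rw [PMF.support_pure] at h
    exact Or.inl ⟨hadopts, h⟩
  · obtain ⟨X, hX, rfl⟩ := (PMF.mem_support_map_iff _ _ _).1 h
    exact Or.inr ⟨hadopts, X, hX, rfl⟩

lemma mem_support_move (h : s' ∈ (s.move k a L N r R).support) :
    ((s.update k L r).StartsPeriod a L N r ∧ ∃ l < N (s.update k L r).level,
        s' ∈ (((s.update k L r).startPeriod N l).finish k a L r R).support) ∨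
      (¬ (s.update k L r).StartsPeriod a L N r ∧
        s' ∈ ((s.update k L r).finish k a L r R).support) := by
  unfold move at h
  split_ifs at h with hstart
  · obtain ⟨l, hl, h⟩ := (PMF.mem_support_bind_iff _ _ _).1 h
    rw [PMF.support_uniformOfFinset] at hl
    exact Or.inl ⟨hstart, l, Finset.mem_range.1 hl, h⟩
  · exact Or.inr ⟨hstart, h⟩

lemma mem_and_card_le_of_mem_support_finish (hk : 0 < k) (hs : s.cached.card ≤ k)
    (h : s' ∈ (s.finish k a L r R).support) : r ∈ s'.cached ∧ s'.cached.card ≤ k := by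
  rcases mem_support_finish h with ⟨-, rfl⟩ | ⟨-, X, hX, rfl⟩
  · refine ⟨Finset.mem_insert_self _ _, (Finset.card_insert_le _ _).trans ?_⟩
    have := card_trim (k - 1) (s.ref.erase r \ R)
    omega
  · exact ⟨mem_of_mem_support_evict hX, card_le_of_mem_support_evict hk hs hX⟩

lemma mem_and_card_le_of_mem_support_move (hk : 0 < k)
    (h : s' ∈ (s.move k a L N r R).support) : r ∈ s'.cached ∧ s'.cached.card ≤ k := by
  have hcard : (s.update k L r).cached.card ≤ k := card_cached_update_le s r
  rcases mem_support_move h with ⟨-, l, -, h⟩ | ⟨-, h⟩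
  · exact mem_and_card_le_of_mem_support_finish hk (s := (s.update k L r).startPeriod N l) hcard h
  · exact mem_and_card_le_of_mem_support_finish hk hcard h

end Conf

/-- The algorithm with `L` levels and periods with `N i` queries, at distance `a`, on level `i`. -/
noncomputable def levelAlgorithm {Page : Type u} [DecidableEq Page] (k a L : ℕ) (N : ℕ → ℕ)
    (hk : 0 < k) (init : Finset Page) (hinit : init.card ≤ k) : OnlineAlgorithm Page k init where
  State := Conf Page
  start :=
    { phase := ⟨init, ∅, 0⟩, cached := init, ref := init, recent := ∅, level := 0, misses := 0
      queries := 0, elapsed := 0, chosen := none, fresh := false }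
  cache := Conf.cache k
  cache_start := if_pos hinit
  card_cache := Conf.card_cache_le k
  ask := Conf.ask k a L N
  move := Conf.move k a L N
  mem_cache := by
    intro s r R s' hs'
    obtain ⟨hmem, hcard⟩ := Conf.mem_and_card_le_of_mem_support_move hk hs'
    rwa [Conf.cache, if_pos hcard]

/-! ### Invariants of the algorithm -/

namespace Conf

variable {Page : Type u} [DecidableEq Page]

/-- Invariants of the cache and of the sets that determine the evictions. -/
structure CacheInvariant (k : ℕ) (s : Conf Page) : Prop where
  valid : s.phase.Valid k
  cached_subset : s.cached ⊆ s.ref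
  ref_subset : s.ref ⊆ s.phase.pages
  card_cached : s.cached.card ≤ k
  recent_subset : s.recent ⊆ s.cached
  recent_subset_marked : s.recent ⊆ s.phase.marked

/-- Invariants of the level and of the number of requests outside of the reference set. -/
structure LevelInvariant (L : ℕ) (s : Conf Page) : Prop where
  level_le : s.level ≤ L
  recent_eq : s.level < L → s.recent = ∅
  ref_eq : s.level = L → s.ref = s.phase.pages
  not_fresh : s.level = L → s.fresh = false
  misses_le : s.level < L → s.misses ≤ 7 * s.phase.weight

/-- Invariants of the periods with queries. -/
structure PeriodInvariant (a L : ℕ) (N : ℕ → ℕ) (s : Conf Page) : Prop where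
  chosen_lt : ∀ l, s.chosen = some l → l < s.queries
  elapsed_lt : ∀ l, s.chosen = some l → s.elapsed < (l + 1) * a
  fresh_of_chosen : ∀ l, s.chosen = some l → s.fresh = true
  queries_eq : s.fresh = true → s.queries = N s.level
  queries_cases : s.queries = 0 ∨ ∃ i < L, s.queries = N i
  elapsed_le : s.elapsed ≤ s.queries * a
  weight_pos : s.queries ≠ 0 → 0 < s.phase.weight

/-- Invariants that hold at all times. -/
structure Core (k a L : ℕ) (N : ℕ → ℕ) (s : Conf Page) : Prop
    extends CacheInvariant k s, LevelInvariant L s, PeriodInvariant a L N s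

/-- Invariants between two requests. -/
structure Settled (k a L : ℕ) (N : ℕ → ℕ) (s : Conf Page) : Prop extends Core k a L N s where
  card_eq : s.cached.card = min k s.phase.pages.card

/-- Invariants while request `r` is served. -/
structure Ready (k a L : ℕ) (N : ℕ → ℕ) (r : Page) (s : Conf Page) : Prop
    extends Core k a L N s where
  mem_ref : r ∈ s.ref
  mem_marked : r ∈ s.phase.marked
  full : s.cached.card = k ∨ (s.cached.card < k ∧ s.phase.pages = insert r s.cached)
  mem_of_weight_eq_zero : s.phase.weight = 0 → r ∈ s.cached

variable {k a L : ℕ} {N : ℕ → ℕ} {s s' : Conf Page} {r : Page} {R X : Finset Page}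

lemma Core.cache_eq (h : s.Core k a L N) : s.cache k = s.cached := if_pos h.card_cached

lemma Core.level_lt_of_chosen (h : s.Core k a L N) {l : ℕ} (hl : s.chosen = some l) :
    s.level < L :=
  h.level_le.lt_of_ne fun hL ↦
    Bool.false_ne_true ((h.not_fresh hL).symm.trans (h.fresh_of_chosen l hl))

lemma Core.chosen_eq_none (h : s.Core k a L N) (hle : s.queries * a ≤ s.elapsed) :
    s.chosen = none :=
  Option.eq_none_iff_forall_ne_some.2 fun l hl ↦
    ((h.elapsed_lt l hl).trans_le (Nat.mul_le_mul_right a (h.chosen_lt l hl))).not_ge hle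

lemma Core.elapsed_succ_lt (ha : 0 < a) (h : s.Core k a L N) (hadopts : ¬ s.Adopts a) {l : ℕ}
    (hl : s.chosen = some l) : s.elapsed + 1 < (l + 1) * a := by
  have hlt := h.elapsed_lt l hl
  have hle : (l + 1) * a ≤ s.queries * a := Nat.mul_le_mul_right a (h.chosen_lt l hl)
  refine lt_of_le_of_ne hlt fun heq ↦ hadopts ⟨⟨by omega, l + 1, by rw [heq, mul_comm]⟩, ?_⟩
  rw [hl, heq, Nat.mul_div_cancel _ ha, Nat.add_sub_cancel]

lemma Ready.card_sdiff_pages_le (h : s.Ready k a L N r) :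
    (s.phase.pages \ s.cached).card ≤ 2 * s.phase.weight := by
  rcases h.full with hfull | ⟨-, hpages⟩
  · have hcard := s.phase.card_pages
    have hbase := h.valid.card_base
    have hclean := h.valid.clean_lt
    rw [Finset.card_sdiff_of_subset (h.cached_subset.trans h.ref_subset)]
    omega
  · by_cases hr : r ∈ s.cached
    · simp [hpages, Finset.insert_eq_of_mem hr]
    · have hweight : s.phase.weight ≠ 0 := fun h0 ↦ hr (h.mem_of_weight_eq_zero h0)
      rw [hpages, Finset.insert_sdiff_of_notMem _ hr, Finset.sdiff_self,
        insert_empty_eq, Finset.card_singleton]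
      omega

lemma Ready.card_sdiff_le (h : s.Ready k a L N r) :
    (s.ref \ s.cached).card ≤ 2 * s.phase.weight :=
  (Finset.card_le_card (Finset.sdiff_subset_sdiff h.ref_subset le_rfl)).trans
    h.card_sdiff_pages_le

section Update

lemma Settled.full_next (h : s.Settled k a L N) (hp : ¬ s.phase.NewPhase k r) :
    s.cached.card = k ∨
      (s.cached.card < k ∧ (s.phase.next k r).pages = insert r s.cached) := by
  refine h.card_cached.eq_or_lt.imp_right fun hlt ↦ ⟨hlt, ?_⟩
  have hcard := h.card_eq
  rw [PhaseData.pages_next hp,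
    Finset.eq_of_subset_of_card_le (h.cached_subset.trans h.ref_subset) (by omega)]

lemma Core.cached_subset_next (h : s.Core k a L N) (hp : ¬ s.phase.NewPhase k r) :
    s.cached ⊆ (s.phase.next k r).pages := by
  rw [PhaseData.pages_next hp]
  exact (h.cached_subset.trans h.ref_subset).trans (Finset.subset_insert _ _)

/-- At weight `0` there are at most `k` pages, so all of them are in the cache. -/
lemma Settled.mem_cached_of_weight_eq_zero (h : s.Settled k a L N)
    (he : ¬ s.phase.NewEpoch k r) (hw : s.phase.weight = 0) : r ∈ s.cached := by
  have hcard := h.card_eq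
  have hpages := s.phase.card_pages
  have hbase := h.valid.card_base
  have hclean := h.valid.clean_lt
  rw [Finset.eq_of_subset_of_card_le (h.cached_subset.trans h.ref_subset) (by omega)]
  by_contra hr
  exact he (Or.inr ⟨hr, by omega⟩)

lemma Settled.startEpoch (hk : 0 < k) (h : s.Settled k a L N) (he : s.phase.NewEpoch k r) :
    (s.startEpoch k r).Ready k a L N r := by
  have hweight : 0 < (s.phase.next k r).weight := by
    rw [PhaseData.weight_next_of_newEpoch he]
    exact PhaseData.clean_next_pos he
  obtain ⟨hsub, hcard, hfull⟩ : (s.startEpoch k r).cached ⊆ (s.phase.next k r).pages ∧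
      (s.startEpoch k r).cached.card ≤ k ∧ ((s.startEpoch k r).cached.card = k ∨
        ((s.startEpoch k r).cached.card < k ∧
          (s.phase.next k r).pages = insert r (s.startEpoch k r).cached)) := by
    unfold Conf.startEpoch
    split_ifs with hp
    · have hmarked := h.valid.card_marked
      rw [trim_eq_self hmarked, PhaseData.next_of_newPhase hp]
      exact ⟨Finset.subset_union_left, hmarked, Or.inl (hmarked.antisymm hp.2)⟩
    · rw [h.cache_eq]
      exact ⟨h.cached_subset_next hp, h.card_cached, h.full_next hp⟩
  exact
    { valid := h.valid.next hk r
      cached_subset := hsub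
      ref_subset := le_rfl
      card_cached := hcard
      recent_subset := Finset.empty_subset _
      recent_subset_marked := Finset.empty_subset _
      level_le := Nat.zero_le _
      recent_eq := fun _ ↦ rfl
      ref_eq := fun _ ↦ rfl
      not_fresh := fun _ ↦ rfl
      misses_le := fun _ ↦ Nat.zero_le _
      chosen_lt := nofun
      elapsed_lt := nofun
      fresh_of_chosen := nofun
      queries_eq := nofun
      queries_cases := h.queries_cases
      elapsed_le := h.elapsed_le
      weight_pos := fun _ ↦ hweight
      mem_ref := s.phase.mem_pages_next k r
      mem_marked := s.phase.mem_marked_next k r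
      full := hfull
      mem_of_weight_eq_zero := fun h0 ↦ absurd h0 hweight.ne' }

lemma Settled.climb (hk : 0 < k) (h : s.Settled k a L N) (hf : s.Fails k L r) :
    (s.climb k r).Ready k a L N r := by
  have hp := PhaseData.not_newPhase hf.1
  have hweight : (s.phase.next k r).weight = s.phase.weight := by
    rw [PhaseData.next_of_not_newEpoch hf.1]
  have hcache : (s.climb k r).cached = s.cached := h.cache_eq
  exact
    { valid := h.valid.next hk r
      cached_subset := hcache ▸ h.cached_subset_next hp
      ref_subset := le_rfl
      card_cached := hcache ▸ h.card_cached
      recent_subset := Finset.empty_subset _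
      recent_subset_marked := Finset.empty_subset _
      level_le := hf.2.1
      recent_eq := fun _ ↦ rfl
      ref_eq := fun _ ↦ rfl
      not_fresh := fun _ ↦ rfl
      misses_le := fun _ ↦ Nat.zero_le _
      chosen_lt := nofun
      elapsed_lt := nofun
      fresh_of_chosen := nofun
      queries_eq := nofun
      queries_cases := h.queries_cases
      elapsed_le := h.elapsed_le
      weight_pos := fun hq ↦ hweight ▸ h.weight_pos hq
      mem_ref := s.phase.mem_pages_next k r
      mem_marked := s.phase.mem_marked_next k r
      full := hcache ▸ h.full_next hp
      mem_of_weight_eq_zero := fun h0 ↦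
        hcache ▸ h.mem_cached_of_weight_eq_zero hf.1 (hweight ▸ h0) }

lemma Settled.stay (hk : 0 < k) (h : s.Settled k a L N) (he : ¬ s.phase.NewEpoch k r)
    (hf : ¬ s.Fails k L r) : (s.stay k r).Ready k a L N r := by
  have hp := PhaseData.not_newPhase he
  have hpages := PhaseData.pages_next hp
  have hweight : (s.phase.next k r).weight = s.phase.weight := by
    rw [PhaseData.next_of_not_newEpoch he]
  have hmarked : s.phase.marked ⊆ (s.phase.next k r).marked := by
    rw [PhaseData.marked_next hp]
    exact Finset.subset_insert _ _
  have hcache : (s.stay k r).cached = s.cached := h.cache_eq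
  exact
    { valid := h.valid.next hk r
      cached_subset := hcache ▸ h.cached_subset.trans (Finset.subset_insert _ _)
      ref_subset := hpages ▸ Finset.insert_subset_insert _ h.ref_subset
      card_cached := hcache ▸ h.card_cached
      recent_subset := hcache ▸ h.recent_subset
      recent_subset_marked := h.recent_subset_marked.trans hmarked
      level_le := h.level_le
      recent_eq := h.recent_eq
      ref_eq := fun hL ↦ (congrArg (insert r) (h.ref_eq hL)).trans hpages.symm
      not_fresh := h.not_fresh
      misses_le := fun hL ↦ hweight ▸ not_lt.1 fun hlt ↦ hf ⟨he, hL, hlt⟩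
      chosen_lt := h.chosen_lt
      elapsed_lt := h.elapsed_lt
      fresh_of_chosen := h.fresh_of_chosen
      queries_eq := h.queries_eq
      queries_cases := h.queries_cases
      elapsed_le := h.elapsed_le
      weight_pos := fun hq ↦ hweight ▸ h.weight_pos hq
      mem_ref := Finset.mem_insert_self _ _
      mem_marked := s.phase.mem_marked_next k r
      full := hcache ▸ h.full_next hp
      mem_of_weight_eq_zero := fun h0 ↦
        hcache ▸ h.mem_cached_of_weight_eq_zero he (hweight ▸ h0) }

lemma Settled.update (hk : 0 < k) (h : s.Settled k a L N) (r : Page) :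
    (s.update k L r).Ready k a L N r := by
  by_cases he : s.phase.NewEpoch k r
  · exact update_of_newEpoch he ▸ h.startEpoch hk he
  by_cases hf : s.Fails k L r
  · exact update_of_fails hf ▸ h.climb hk hf
  · exact update_of_not_fails he hf ▸ h.stay hk he hf

end Update

lemma Ready.startPeriod (ha : 0 < a) (h : s.Ready k a L N r) (hs : s.StartsPeriod a L N r)
    {l : ℕ} (hl : l < N s.level) : (s.startPeriod N l).Ready k a L N r :=
  { h with
    not_fresh := fun hL ↦ absurd hL hs.2.2.1.ne
    chosen_lt := fun _ hl' ↦ Option.some.inj hl' ▸ hl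
    elapsed_lt := fun l' _ ↦ Nat.mul_pos l'.succ_pos ha
    fresh_of_chosen := fun _ _ ↦ rfl
    queries_eq := fun _ ↦ rfl
    queries_cases := Or.inr ⟨s.level, hs.2.2.1, rfl⟩
    elapsed_le := Nat.zero_le _
    weight_pos := fun _ ↦ Nat.pos_of_ne_zero fun h0 ↦ hs.2.1 (h.mem_of_weight_eq_zero h0) }

section Evict

lemma Ready.card_recent_lt (h : s.Ready k a L N r) (hr : r ∉ s.cached) : s.recent.card < k :=
  calc s.recent.card < (insert r s.recent).card := by
        rw [Finset.card_insert_of_notMem fun hrecent ↦ hr (h.recent_subset hrecent)]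
        exact Nat.lt_succ_self _
    _ ≤ s.phase.marked.card :=
        Finset.card_le_card (Finset.insert_subset h.mem_marked h.recent_subset_marked)
    _ ≤ k := h.valid.card_marked

lemma Ready.card_cached_sdiff_recent (h : s.Ready k a L N r) (hcard : s.cached.card = k) :
    (s.cached \ s.recent).card = k - s.recent.card := by
  rw [Finset.card_sdiff_of_subset h.recent_subset, hcard]

lemma Ready.cached_sdiff_recent_nonempty (h : s.Ready k a L N r) (hr : r ∉ s.cached)
    (hcard : s.cached.card = k) : (s.cached \ s.recent).Nonempty := by
  rw [← Finset.card_pos, h.card_cached_sdiff_recent hcard]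
  exact Nat.sub_pos_of_lt (h.card_recent_lt hr)

lemma Ready.evict_cases (h : s.Ready k a L N r)
    (hX : X ∈ (evict k r s.cached s.recent).support) :
    (r ∈ s.cached ∧ X = s.cached) ∨ (r ∉ s.cached ∧ s.cached.card < k ∧ X = insert r s.cached) ∨
      (r ∉ s.cached ∧ s.cached.card = k ∧
        ∃ p ∈ s.cached \ s.recent, X = insert r (s.cached.erase p)) :=
  mem_support_evict_cases h.card_cached (fun hr ↦ h.cached_sdiff_recent_nonempty hr) hX

lemma Ready.subset_ref_of_mem_support_evict (h : s.Ready k a L N r)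
    (hX : X ∈ (evict k r s.cached s.recent).support) : X ⊆ s.ref := by
  rcases h.evict_cases hX with ⟨-, rfl⟩ | ⟨-, -, rfl⟩ | ⟨-, -, p, -, rfl⟩
  · exact h.cached_subset
  · exact Finset.insert_subset h.mem_ref h.cached_subset
  · exact Finset.insert_subset h.mem_ref ((Finset.erase_subset _ _).trans h.cached_subset)

lemma Ready.recent_subset_of_mem_support_evict (h : s.Ready k a L N r)
    (hX : X ∈ (evict k r s.cached s.recent).support) : s.recent ⊆ X := by
  rcases h.evict_cases hX with ⟨-, rfl⟩ | ⟨-, -, rfl⟩ | ⟨-, -, p, hp, rfl⟩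
  · exact h.recent_subset
  · exact h.recent_subset.trans (Finset.subset_insert _ _)
  · exact (Finset.subset_erase.2 ⟨h.recent_subset, (Finset.mem_sdiff.1 hp).2⟩).trans
      (Finset.subset_insert _ _)

lemma Ready.card_of_mem_support_evict (h : s.Ready k a L N r)
    (hX : X ∈ (evict k r s.cached s.recent).support) : X.card = min k s.phase.pages.card := by
  have hle := Finset.card_le_card (h.cached_subset.trans h.ref_subset)
  rcases h.evict_cases hX with ⟨hr, rfl⟩ | ⟨hr, hlt, rfl⟩ | ⟨hr, hcard, p, hp, rfl⟩
  · rcases h.full with hfull | ⟨hlt, hpages⟩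
    · omega
    · rw [hpages, Finset.insert_eq_of_mem hr]
      omega
  · have hpages := (h.full.resolve_left hlt.ne).2
    rw [hpages, Finset.card_insert_of_notMem hr]
    omega
  · have hr' : r ∉ s.cached.erase p := fun hmem ↦ hr (Finset.mem_of_mem_erase hmem)
    rw [Finset.card_insert_of_notMem hr',
      Finset.card_erase_add_one (Finset.mem_sdiff.1 hp).1]
    omega

end Evict

section Adopt

lemma Ready.card_erase_ref (h : s.Ready k a L N r) : (s.ref.erase r).card + 1 = s.ref.card :=
  Finset.card_erase_add_one h.mem_ref

lemma adopted_subset (k : ℕ) (h : r ∈ s.ref) (R : Finset Page) : s.adopted k r R ⊆ s.ref :=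
  Finset.insert_subset h
    ((trim_subset _ _).trans (Finset.sdiff_subset.trans (Finset.erase_subset _ _)))

lemma Ready.card_adopted (hk : 0 < k) (h : s.Ready k a L N r)
    (hR : R.card ≤ (s.ref.erase r).card + 1 - k) :
    (s.adopted k r R).card = min k s.phase.pages.card := by
  have hr : r ∉ trim (k - 1) (s.ref.erase r \ R) := fun hmem ↦
    Finset.notMem_erase r s.ref (Finset.mem_sdiff.1 (trim_subset _ _ hmem)).1
  have hlarge : s.ref.card = s.phase.pages.card ∨ k ≤ s.ref.card := by
    rcases h.full with hfull | ⟨-, hpages⟩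
    · exact Or.inr (hfull ▸ Finset.card_le_card h.cached_subset)
    · exact Or.inl (congrArg Finset.card (h.ref_subset.antisymm
        (hpages ▸ Finset.insert_subset h.mem_ref h.cached_subset)))
  have hpages := Finset.card_le_card h.ref_subset
  have herase := h.card_erase_ref
  have hge := Finset.le_card_sdiff R (s.ref.erase r)
  have hle := Finset.card_le_card (Finset.sdiff_subset (s := s.ref.erase r) (t := R))
  rw [adopted, Finset.card_insert_of_notMem hr, card_trim]
  omega

lemma Ready.adopt (hk : 0 < k) (h : s.Ready k a L N r)
    (hR : R.card ≤ (s.ref.erase r).card + 1 - k) (hadopts : s.Adopts a) :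
    (s.adopt k r R).Settled k a L N := by
  have hlevel := h.level_lt_of_chosen hadopts.2
  have hcard := h.card_adopted hk hR
  exact
    { h with
      cached_subset := le_rfl
      ref_subset := (adopted_subset k h.mem_ref R).trans h.ref_subset
      card_cached := hcard.trans_le (min_le_left _ _)
      recent_subset := (h.recent_eq hlevel).trans_subset (Finset.empty_subset _)
      ref_eq := fun hL ↦ absurd hL hlevel.ne
      chosen_lt := nofun
      elapsed_lt := nofun
      fresh_of_chosen := nofun
      elapsed_le := hadopts.1.1
      card_eq := hcard }

end Adopt

lemma Ready.serve (ha : 0 < a) (h : s.Ready k a L N r) (hadopts : ¬ s.Adopts a)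
    (hX : X ∈ (evict k r s.cached s.recent).support) : (s.serve a L r X).Settled k a L N := by
  have hcard := h.card_of_mem_support_evict hX
  have hrecent : (s.serve a L r X).recent ⊆ insert r s.recent := by
    dsimp only [Conf.serve]
    split_ifs
    · exact Finset.subset_insert _ _
    · exact le_rfl
  exact
    { h with
      cached_subset := h.subset_ref_of_mem_support_evict hX
      card_cached := hcard.trans_le (min_le_left _ _)
      recent_subset := hrecent.trans (Finset.insert_subset (mem_of_mem_support_evict hX)
        (h.recent_subset_of_mem_support_evict hX))
      recent_subset_marked :=
        hrecent.trans (Finset.insert_subset h.mem_marked h.recent_subset_marked)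
      recent_eq := fun hL ↦ (if_pos hL).trans (h.recent_eq hL)
      elapsed_lt := fun l hl ↦ by
        have hlt := h.elapsed_succ_lt ha hadopts hl
        dsimp only [Conf.serve]
        split_ifs
        · exact hlt
        · exact (Nat.lt_succ_self _).trans hlt
      elapsed_le := by
        dsimp only [Conf.serve]
        split_ifs with hlt
        · exact hlt
        · exact h.elapsed_le
      card_eq := hcard }

lemma Ready.finish (hk : 0 < k) (ha : 0 < a) (h : s.Ready k a L N r)
    (hR : R.card ≤ (s.ref.erase r).card + 1 - k) (hs' : s' ∈ (s.finish k a L r R).support) :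
    s'.Settled k a L N := by
  rcases mem_support_finish hs' with ⟨hadopts, rfl⟩ | ⟨hadopts, X, hX, rfl⟩
  · exact h.adopt hk hR hadopts
  · exact h.serve ha hadopts hX

end Conf

/-! ### Runs of the algorithm -/

namespace Conf

variable {Page : Type u} {k a L : ℕ} {N : ℕ → ℕ} {p q s s' : Conf Page} {r : Page}
  {R : Finset Page}

/-- `q` is the configuration `p`, with a new period if there has to be one: this is the
configuration in which the request `r` is served. -/
def Opened (a L : ℕ) (N : ℕ → ℕ) (p : Conf Page) (r : Page) (q : Conf Page) : Prop :=
  (p.StartsPeriod a L N r ∧ ∃ l < N p.level, q = p.startPeriod N l) ∨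
    (¬ p.StartsPeriod a L N r ∧ q = p)

lemma Opened.ref_eq (h : p.Opened a L N r q) : q.ref = p.ref := by
  rcases h with ⟨-, l, -, rfl⟩ | ⟨-, rfl⟩ <;> rfl

lemma Opened.cached_eq (h : p.Opened a L N r q) : q.cached = p.cached := by
  rcases h with ⟨-, l, -, rfl⟩ | ⟨-, rfl⟩ <;> rfl

lemma Opened.phase_eq (h : p.Opened a L N r q) : q.phase = p.phase := by
  rcases h with ⟨-, l, -, rfl⟩ | ⟨-, rfl⟩ <;> rfl

lemma Opened.level_eq (h : p.Opened a L N r q) : q.level = p.level := by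
  rcases h with ⟨-, l, -, rfl⟩ | ⟨-, rfl⟩ <;> rfl

lemma Opened.elapsed_mod_le (h : p.Opened a L N r q) : q.elapsed % a ≤ p.elapsed % a := by
  rcases h with ⟨-, l, -, rfl⟩ | ⟨-, rfl⟩
  · exact (Nat.zero_mod a).trans_le (Nat.zero_le _)
  · exact le_rfl

lemma elapsed_mod_add_one_of_asks (ha : 0 < a) (h : s.Asks a) : s.elapsed % a + 1 = a := by
  refine (Nat.succ_le_of_lt (Nat.mod_lt _ ha)).antisymm (not_lt.1 fun hlt ↦ ?_)
  have hdvd : (s.elapsed % a + 1) % a = 0 := by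
    rw [Nat.mod_add_mod]
    exact Nat.mod_eq_zero_of_dvd h.2
  rw [Nat.mod_eq_of_lt hlt] at hdvd
  exact Nat.succ_ne_zero _ hdvd

variable [DecidableEq Page]

lemma Opened.ready (ha : 0 < a) (h : p.Opened a L N r q) (hp : p.Ready k a L N r) :
    q.Ready k a L N r := by
  rcases h with ⟨hs, l, hl, rfl⟩ | ⟨-, rfl⟩
  · exact hp.startPeriod ha hs hl
  · exact hp

lemma Opened.asks_iff (h : (s.update k L r).Opened a L N r q) :
    q.Asks a ↔ (s.lead k a L N r).Asks a := by
  unfold lead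
  rcases h with ⟨hs, l, -, rfl⟩ | ⟨hs, rfl⟩
  · rw [if_pos hs]
    rfl
  · rw [if_neg hs]

lemma exists_opened (h : s' ∈ (s.move k a L N r R).support) :
    ∃ q, (s.update k L r).Opened a L N r q ∧ s' ∈ (q.finish k a L r R).support := by
  rcases mem_support_move h with ⟨hs, l, hl, h⟩ | ⟨hs, h⟩
  · exact ⟨_, Or.inl ⟨hs, l, hl, rfl⟩, h⟩
  · exact ⟨_, Or.inr ⟨hs, rfl⟩, h⟩

lemma phase_of_mem_support_finish (h : s' ∈ (s.finish k a L r R).support) :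
    s'.phase = s.phase := by
  rcases mem_support_finish h with ⟨-, rfl⟩ | ⟨-, X, -, rfl⟩ <;> rfl

lemma level_of_mem_support_finish (h : s' ∈ (s.finish k a L r R).support) :
    s'.level = s.level := by
  rcases mem_support_finish h with ⟨-, rfl⟩ | ⟨-, X, -, rfl⟩ <;> rfl

lemma misses_of_mem_support_finish (h : s' ∈ (s.finish k a L r R).support) :
    s'.misses = s.misses := by
  rcases mem_support_finish h with ⟨-, rfl⟩ | ⟨-, X, -, rfl⟩ <;> rfl

lemma queries_of_mem_support_finish (h : s' ∈ (s.finish k a L r R).support) :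
    s'.queries = s.queries := by
  rcases mem_support_finish h with ⟨-, rfl⟩ | ⟨-, X, -, rfl⟩ <;> rfl

lemma fresh_of_mem_support_finish (h : s' ∈ (s.finish k a L r R).support) :
    s'.fresh = s.fresh := by
  rcases mem_support_finish h with ⟨-, rfl⟩ | ⟨-, X, -, rfl⟩ <;> rfl

lemma elapsed_of_mem_support_finish (h : s' ∈ (s.finish k a L r R).support) :
    s'.elapsed = if s.elapsed < s.queries * a then s.elapsed + 1 else s.elapsed := by
  rcases mem_support_finish h with ⟨hadopts, rfl⟩ | ⟨-, X, -, rfl⟩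
  · exact (if_pos hadopts.1.1).symm
  · rfl

lemma elapsed_mod_le_of_mem_support_finish (h : s' ∈ (s.finish k a L r R).support) :
    s'.elapsed % a ≤ s.elapsed % a + 1 := by
  rw [elapsed_of_mem_support_finish h]
  split_ifs
  · rw [← Nat.mod_add_mod]
    exact Nat.mod_le _ _
  · exact Nat.le_succ _

lemma elapsed_mod_eq_zero_of_asks (h : s' ∈ (s.finish k a L r R).support) (hasks : s.Asks a) :
    s'.elapsed % a = 0 := by
  rw [elapsed_of_mem_support_finish h, if_pos hasks.1]
  exact Nat.mod_eq_zero_of_dvd hasks.2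

/-- The query in reaction to request `r`, made in configuration `q`. -/
def query (k : ℕ) (q : Conf Page) (r : Page) (t : ℕ) : Query Page :=
  ⟨t, q.ref.erase r, (q.ref.erase r).card + 1 - k⟩

/-- The answer of the predictor to the query in configuration `q`, if there is any. -/
def reply (P : Predictor Page k) (a : ℕ) (q : Conf Page) (r : Page) (t : ℕ) : Finset Page :=
  if q.Asks a then P.report t (q.ref.erase r) ((q.ref.erase r).card + 1 - k) else ∅

lemma card_reply_le (P : Predictor Page k) (a : ℕ) (q : Conf Page) (r : Page) (t : ℕ) :
    (q.reply P a r t).card ≤ (q.ref.erase r).card + 1 - k := by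
  unfold reply
  split_ifs
  · exact (P.card_report _ _ _).trans_le (min_le_left _ _)
  · exact Nat.zero_le _

/-- In the run against predictor `P`, the request number `t` leads with positive probability from
configuration `s` to `s'`, by way of the configuration `q` in which the request is served. -/
structure IsTransition (k a L : ℕ) (N : ℕ → ℕ) (init : Finset Page) (P : Predictor Page k)
    (req : ℕ → Page) (t : ℕ) (s q s' : Conf Page) : Prop where
  settled : s.Settled k a L N
  phase_eq : s.phase = phaseAt k init req t
  opened : (s.update k L (req t)).Opened a L N (req t) q
  mem_support : s' ∈ (q.finish k a L (req t) (q.reply P a (req t) t)).support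

namespace IsTransition

variable {init : Finset Page} {P : Predictor Page k} {req : ℕ → Page} {t : ℕ}

lemma ready_update (h : IsTransition k a L N init P req t s q s') (hk : 0 < k) :
    (s.update k L (req t)).Ready k a L N (req t) := h.settled.update hk (req t)

lemma ready (h : IsTransition k a L N init P req t s q s') (hk : 0 < k) (ha : 0 < a) :
    q.Ready k a L N (req t) := h.opened.ready ha (h.ready_update hk)

lemma settled_succ (h : IsTransition k a L N init P req t s q s') (hk : 0 < k) (ha : 0 < a) :
    s'.Settled k a L N :=
  (h.ready hk ha).finish hk ha (card_reply_le _ _ _ _ _) h.mem_support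

lemma phase_opened (h : IsTransition k a L N init P req t s q s') :
    q.phase = phaseAt k init req (t + 1) := by
  rw [h.opened.phase_eq, phase_update, h.phase_eq, phaseAt]

lemma phase_succ (h : IsTransition k a L N init P req t s q s') :
    s'.phase = phaseAt k init req (t + 1) := by
  rw [phase_of_mem_support_finish h.mem_support, h.phase_opened]

end IsTransition

end Conf

section LevelAlgorithm

variable {Page : Type u} [DecidableEq Page] {k a L : ℕ} {N : ℕ → ℕ} (hk : 0 < k)
  {init : Finset Page} (hinit : init.card ≤ k)

lemma finitelyBranching_levelAlgorithm :
    (levelAlgorithm k a L N hk init hinit).FinitelyBranching :=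
  fun s r R ↦ Conf.finite_support_move s r R

lemma answer_eq (P : Predictor Page k) (req : ℕ → Page) (t : ℕ) {s q : Conf Page}
    (h : (s.update k L (req t)).Opened a L N (req t) q) :
    (levelAlgorithm k a L N hk init hinit).answer P req t s = q.reply P a (req t) t := by
  have hask : (levelAlgorithm k a L N hk init hinit).ask s (req t) = s.ask k a L N (req t) := rfl
  unfold OnlineAlgorithm.answer
  rw [hask, Conf.ask, Conf.reply, h.ref_eq]
  by_cases hq : q.Asks a
  · rw [if_pos hq, if_pos (h.asks_iff.1 hq)]
  · rw [if_neg hq, if_neg (mt h.asks_iff.2 hq)]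

lemma newQueries_eq (req : ℕ → Page) (t : ℕ) {s q : Conf Page}
    (h : (s.update k L (req t)).Opened a L N (req t) q) (c : ℕ) (Q : List (Query Page)) :
    (levelAlgorithm k a L N hk init hinit).newQueries req t ⟨s, c, Q⟩
      = if q.Asks a then q.query k (req t) t :: Q else Q := by
  have hask : (levelAlgorithm k a L N hk init hinit).ask s (req t) = s.ask k a L N (req t) := rfl
  unfold OnlineAlgorithm.newQueries
  rw [hask, Conf.ask, Conf.query, h.ref_eq]
  by_cases hq : q.Asks a
  · rw [if_pos hq, if_pos (h.asks_iff.1 hq)]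
  · rw [if_neg hq, if_neg (mt h.asks_iff.2 hq)]

lemma settled_start : Conf.Settled k a L N (levelAlgorithm k a L N hk init hinit).start where
  valid := PhaseData.valid_start hinit
  cached_subset := le_rfl
  ref_subset := Finset.subset_union_left
  card_cached := hinit
  recent_subset := Finset.empty_subset _
  recent_subset_marked := Finset.empty_subset _
  level_le := Nat.zero_le _
  recent_eq := fun _ ↦ rfl
  ref_eq := fun _ ↦ (Finset.union_empty init).symm
  not_fresh := fun _ ↦ rfl
  misses_le := fun _ ↦ Nat.zero_le _
  chosen_lt := nofun
  elapsed_lt := nofun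
  fresh_of_chosen := nofun
  queries_eq := nofun
  queries_cases := Or.inl rfl
  elapsed_le := Nat.zero_le _
  weight_pos := fun hq ↦ absurd rfl hq
  card_eq := by
    simp only [levelAlgorithm, PhaseData.pages, Finset.union_empty]
    exact (min_eq_right hinit).symm

lemma levelAlgorithm_induction (ha : 0 < a) (P : Predictor Page k) (req : ℕ → Page)
    (J : ℕ → Conf Page → List (Query Page) → Prop)
    (zero : J 0 (levelAlgorithm k a L N hk init hinit).start [])
    (step : ∀ t (s q s' : Conf Page) (Q : List (Query Page)),
      Conf.IsTransition k a L N init P req t s q s' → J t s Q →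
      J (t + 1) s' (if q.Asks a then q.query k (req t) t :: Q else Q))
    (T : ℕ) (o : (levelAlgorithm k a L N hk init hinit).Outcome)
    (ho : o ∈ ((levelAlgorithm k a L N hk init hinit).run P req T).support) :
    Conf.Settled k a L N o.state ∧ Conf.phase o.state = phaseAt k init req T ∧
      J T o.state o.queries := by
  refine OnlineAlgorithm.run_induction (A := levelAlgorithm k a L N hk init hinit) P req
    (fun t o ↦ Conf.Settled k a L N o.state ∧ Conf.phase o.state = phaseAt k init req t ∧
      J t o.state o.queries) ⟨settled_start hk hinit, rfl, zero⟩ ?_ T o ho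
  rintro t ⟨s, c, Q⟩ ⟨hsettled, hphase, hJ⟩ s' hs'
  obtain ⟨q, hq, hfinish⟩ := Conf.exists_opened hs'
  rw [answer_eq hk hinit P req t hq] at hfinish
  have htrans : Conf.IsTransition k a L N init P req t s q s' := ⟨hsettled, hphase, hq, hfinish⟩
  refine ⟨htrans.settled_succ hk ha, htrans.phase_succ, ?_⟩
  rw [newQueries_eq hk hinit req t hq]
  exact step t s q s' Q htrans hJ

lemma settled_of_mem_run (ha : 0 < a) (P : Predictor Page k) (req : ℕ → Page) (T : ℕ)
    (o : (levelAlgorithm k a L N hk init hinit).Outcome)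
    (ho : o ∈ ((levelAlgorithm k a L N hk init hinit).run P req T).support) :
    Conf.Settled k a L N o.state ∧ Conf.phase o.state = phaseAt k init req T := by
  obtain ⟨hsettled, hphase, -⟩ := levelAlgorithm_induction hk hinit ha P req
    (fun _ _ _ ↦ True) trivial (fun _ _ _ _ _ _ _ ↦ trivial) T o ho
  exact ⟨hsettled, hphase⟩

lemma wellSeparated_levelAlgorithm (ha : 0 < a) :
    (levelAlgorithm k a L N hk init hinit).WellSeparated a := by
  intro P req T o ho
  refine (levelAlgorithm_induction hk hinit ha P req (fun t s Q ↦
    Q.Pairwise (fun later earlier ↦ earlier.time + a ≤ later.time) ∧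
      ∀ x ∈ Q, x.time + s.elapsed % a < t) ⟨List.Pairwise.nil, by simp⟩ ?_ T o ho).2.2.1
  rintro t s q s' Q h ⟨hpairwise, htime⟩
  have htime' : ∀ x ∈ Q, x.time + q.elapsed % a < t := fun x hx ↦ by
    have hmod := h.opened.elapsed_mod_le
    rw [Conf.elapsed_update] at hmod
    exact (Nat.add_le_add_left hmod _).trans_lt (htime x hx)
  by_cases hasks : q.Asks a
  · have hmod := Conf.elapsed_mod_add_one_of_asks ha hasks
    rw [if_pos hasks, Conf.elapsed_mod_eq_zero_of_asks h.mem_support hasks]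
    refine ⟨List.pairwise_cons.2 ⟨fun x hx ↦ ?_, hpairwise⟩, fun x hx ↦ ?_⟩
    · have hlt := htime' x hx
      change x.time + a ≤ t
      omega
    · rcases List.mem_cons.1 hx with rfl | hx
      · exact t.lt_succ_self
      · have hlt := htime' x hx
        omega
  · rw [if_neg hasks]
    refine ⟨hpairwise, fun x hx ↦ ?_⟩
    have hlt := htime' x hx
    have hmod := Conf.elapsed_mod_le_of_mem_support_finish h.mem_support
    omega

include hk hinit in
lemma pages_phaseAt_subset (req : ℕ → Page) (t : ℕ) :
    (phaseAt k init req t).pages ⊆ init ∪ (Finset.range t).image req := by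
  have h := describes req hk hinit t
  have hrequested {s u : ℕ} (hu : u ≤ t) :
      requested req s u ⊆ init ∪ (Finset.range t).image req := fun p hp ↦ by
    obtain ⟨i, ⟨-, hi⟩, rfl⟩ := mem_requested.1 hp
    exact Finset.mem_union_right _
      (Finset.mem_image_of_mem req (Finset.mem_range.2 (hi.trans_le hu)))
  refine Finset.union_subset ?_ (h.marked_eq ▸ hrequested le_rfl)
  rcases h.base_eq with ⟨-, -, hbase⟩ | ⟨hbase, -⟩
  · rw [hbase]
    exact Finset.subset_union_left
  · exact hbase ▸ hrequested h.phaseStart_le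

lemma asksAboutKnownPages_levelAlgorithm (ha : 0 < a) :
    (levelAlgorithm k a L N hk init hinit).AsksAboutKnownPages := by
  intro P req T o ho
  refine (levelAlgorithm_induction hk hinit ha P req (fun _ _ Q ↦
    ∀ q ∈ Q, q.pages ⊆ init ∪ (Finset.range q.time).image req) (by simp) ?_ T o ho).2.2
  rintro t s q s' Q h hQ
  have hquery : q.ref.erase (req t) ⊆ init ∪ (Finset.range t).image req := by
    have hsub := (h.ready hk ha).ref_subset
    rw [h.phase_opened] at hsub
    have hpages := hsub.trans (pages_phaseAt_subset hk hinit req (t + 1))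
    rwa [Finset.range_add_one, Finset.image_insert, Finset.union_insert,
      Finset.subset_insert_iff] at hpages
  split_ifs
  · exact List.forall_mem_cons.2 ⟨hquery, hQ⟩
  · exact hQ

end LevelAlgorithm

/-! ### The number of predictions -/

namespace Conf

variable {Page : Type u} {a : ℕ} {s : Conf Page}

/-- The number of queries that remain in the current period. -/
def remaining (a : ℕ) (s : Conf Page) : ℕ := s.queries - s.elapsed / a

variable [DecidableEq Page] {k L : ℕ} {N : ℕ → ℕ} {q s' : Conf Page} {r : Page} {R : Finset Page}

/-- The number of pages of the reference set that are not in the cache. -/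
def missing (s : Conf Page) : ℕ := (s.ref \ s.cached).card

/-- A bound for the number of predictions used by one query of the current period. A period that
is no longer fresh was started when the reference set was a different one. -/
def queryBudget (s : Conf Page) : ℕ := if s.fresh then s.missing + 1 else 4 * s.phase.weight

/-- A budget for the predictions used in the periods that will be started on the current level. -/
def levelBudget (N : ℕ → ℕ) (s : Conf Page) : ℕ :=
  (if s.chosen.isSome then 0 else 2 * N s.level * s.missing) +
    3 * N s.level * (7 * s.phase.weight - s.misses) + 4 * s.phase.weight * N s.level

/-- A budget for the predictions that will be used in the current epoch. -/
def budget (a L : ℕ) (N : ℕ → ℕ) (s : Conf Page) : ℕ :=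
  s.remaining a * s.queryBudget +
    if s.level < L then
      s.levelBudget N + 40 * s.phase.weight * ∑ j ∈ Finset.Ico (s.level + 1) L, N j
    else 0

lemma Core.queries_le (h : s.Core k a L N) : s.queries ≤ ∑ j ∈ Finset.range L, N j := by
  rcases h.queries_cases with h0 | ⟨i, hi, hqueries⟩
  · exact h0.trans_le (Nat.zero_le _)
  · exact hqueries.trans_le (Finset.single_le_sum (fun _ _ ↦ Nat.zero_le _) (Finset.mem_range.2 hi))

lemma Core.remaining_le (h : s.Core k a L N) (hfresh : s.fresh = true) :
    s.remaining a ≤ N s.level := (Nat.sub_le _ _).trans (h.queries_eq hfresh).le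

lemma card_insert_sdiff_le (X D : Finset Page) (r : Page) :
    (insert r D \ X).card ≤ (D \ X).card + if r ∈ D then 0 else 1 := by
  split_ifs with hr
  · rw [Finset.insert_eq_of_mem hr, add_zero]
  · refine (Finset.card_le_card ?_).trans (Finset.card_insert_le r (D \ X))
    intro y
    simp only [Finset.mem_sdiff, Finset.mem_insert]
    tauto

section Update

lemma Ready.budget_le (h : s.Ready k a L N r) (hmisses : s.misses = 0) (hchosen : s.chosen = none)
    (hfresh : s.fresh = false) :
    s.budget a L N ≤ s.remaining a * (4 * s.phase.weight) +
      40 * s.phase.weight * ∑ j ∈ Finset.Ico s.level L, N j := by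
  have hquery : s.queryBudget = 4 * s.phase.weight := by simp [queryBudget, hfresh]
  rw [budget, hquery]
  gcongr
  split_ifs with hlevel
  · have hmissing : 2 * N s.level * s.missing ≤ 2 * N s.level * (2 * s.phase.weight) :=
      Nat.mul_le_mul_left _ h.card_sdiff_le
    rw [Finset.sum_eq_sum_Ico_succ_bot hlevel, levelBudget, hmisses, hchosen]
    simp only [Option.isSome_none, Bool.false_eq_true, if_false, Nat.sub_zero]
    nlinarith only [hmissing, Nat.zero_le (N s.level * s.phase.weight)]
  · exact Nat.zero_le _

lemma Settled.budget_startEpoch_le (hk : 0 < k) (h : s.Settled k a L N)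
    (he : s.phase.NewEpoch k r) :
    (s.startEpoch k r).budget a L N
      ≤ 44 * (∑ j ∈ Finset.range L, N j) * (s.phase.next k r).weight := by
  have hready := h.startEpoch hk he
  have hremaining : (s.startEpoch k r).remaining a ≤ ∑ j ∈ Finset.range L, N j :=
    (Nat.sub_le _ _).trans hready.queries_le
  calc (s.startEpoch k r).budget a L N
      ≤ (s.startEpoch k r).remaining a * (4 * (s.phase.next k r).weight) +
          40 * (s.phase.next k r).weight * ∑ j ∈ Finset.Ico 0 L, N j :=
        hready.budget_le rfl rfl rfl
    _ ≤ (∑ j ∈ Finset.range L, N j) * (4 * (s.phase.next k r).weight) +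
          40 * (s.phase.next k r).weight * ∑ j ∈ Finset.range L, N j := by
        rw [← Finset.range_eq_Ico]
        gcongr
    _ = 44 * (∑ j ∈ Finset.range L, N j) * (s.phase.next k r).weight := by ring

lemma Settled.budget_climb_le (hk : 0 < k) (h : s.Settled k a L N) (hf : s.Fails k L r) :
    (s.climb k r).budget a L N ≤ s.budget a L N := by
  have hweight : (s.climb k r).phase.weight = s.phase.weight := by
    rw [Conf.climb, PhaseData.next_of_not_newEpoch hf.1]
  have hbudget : (s.climb k r).budget a L N ≤ s.remaining a * (4 * s.phase.weight) +
      40 * s.phase.weight * ∑ j ∈ Finset.Ico (s.level + 1) L, N j :=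
    hweight ▸ (h.climb hk hf).budget_le rfl rfl rfl
  have hremaining : s.remaining a * (4 * s.phase.weight)
      ≤ s.remaining a * s.queryBudget + 4 * s.phase.weight * N s.level := by
    unfold queryBudget
    split_ifs with hfresh
    · rw [mul_comm (s.remaining a) (4 * _)]
      exact (Nat.mul_le_mul_left _ (h.remaining_le hfresh)).trans (Nat.le_add_left _ _)
    · exact Nat.le_add_right _ _
  refine hbudget.trans ?_
  rw [budget, if_pos hf.2.1, levelBudget]
  omega

lemma Settled.missing_stay_le (h : s.Settled k a L N) (r : Page) :
    (s.stay k r).missing ≤ s.missing + if r ∈ s.ref then 0 else 1 := by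
  have hcache : (s.stay k r).cached = s.cached := h.cache_eq
  rw [missing, hcache]
  exact card_insert_sdiff_le _ _ _

lemma Settled.remaining_mul_queryBudget_stay_le (h : s.Settled k a L N)
    (he : ¬ s.phase.NewEpoch k r) :
    (s.stay k r).remaining a * (s.stay k r).queryBudget
      ≤ s.remaining a * s.queryBudget + if s.level < L ∧ r ∉ s.ref then N s.level else 0 := by
  have hmissing := h.missing_stay_le r
  change s.remaining a * (if s.fresh then (s.stay k r).missing + 1 else
    4 * (s.phase.next k r).weight) ≤ s.remaining a * (if s.fresh then s.missing + 1 else _) + _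
  by_cases hfresh : s.fresh = true
  · have hlevel : s.level < L := h.level_le.lt_of_ne fun hL ↦
      Bool.false_ne_true ((h.not_fresh hL).symm.trans hfresh)
    rw [if_pos hfresh, if_pos hfresh]
    by_cases hr : r ∈ s.ref
    · rw [if_pos hr] at hmissing
      exact (Nat.mul_le_mul_left _ (Nat.succ_le_succ hmissing)).trans (Nat.le_add_right _ _)
    · rw [if_neg hr] at hmissing
      rw [if_pos ⟨hlevel, hr⟩]
      calc s.remaining a * ((s.stay k r).missing + 1)
          ≤ s.remaining a * (s.missing + 1 + 1) := by gcongr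
        _ = s.remaining a * (s.missing + 1) + s.remaining a := Nat.mul_succ _ _
        _ ≤ _ := Nat.add_le_add_left (h.remaining_le hfresh) _
  · rw [if_neg hfresh, if_neg hfresh, PhaseData.next_of_not_newEpoch he]
    exact Nat.le_add_right _ _

lemma Settled.levelBudget_stay_add_le (h : s.Settled k a L N) (he : ¬ s.phase.NewEpoch k r)
    (hf : ¬ s.Fails k L r) (hlevel : s.level < L) :
    (s.stay k r).levelBudget N + (if r ∈ s.ref then 0 else N s.level) ≤ s.levelBudget N := by
  have hmissing := h.missing_stay_le r
  have hmisses : (s.misses + if r ∈ s.ref then 0 else 1) ≤ 7 * s.phase.weight :=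
    not_lt.1 fun hlt ↦ hf ⟨he, hlevel, hlt⟩
  have hweight : (s.phase.next k r).weight = s.phase.weight := by
    rw [PhaseData.next_of_not_newEpoch he]
  change ((if s.chosen.isSome then 0 else 2 * N s.level * (s.stay k r).missing) +
    3 * N s.level * (7 * (s.phase.next k r).weight - (s.misses + if r ∈ s.ref then 0 else 1)) +
    4 * (s.phase.next k r).weight * N s.level) + _ ≤ _
  rw [hweight, levelBudget]
  split_ifs at hmissing hmisses ⊢ with hr
  · exact le_rfl
  · obtain ⟨v, hv⟩ := Nat.exists_eq_add_of_le hmisses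
    rw [hv, show s.misses + 1 + v - s.misses = v + 1 by omega, Nat.add_sub_cancel_left]
    nlinarith only
  · simp only [add_zero] at hmissing ⊢
    gcongr
  · obtain ⟨v, hv⟩ := Nat.exists_eq_add_of_le hmisses
    rw [hv, show s.misses + 1 + v - s.misses = v + 1 by omega, Nat.add_sub_cancel_left]
    nlinarith only [Nat.mul_le_mul_left (2 * N s.level) hmissing]

lemma Settled.budget_stay_le (h : s.Settled k a L N) (he : ¬ s.phase.NewEpoch k r)
    (hf : ¬ s.Fails k L r) : (s.stay k r).budget a L N ≤ s.budget a L N := by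
  have hquery := h.remaining_mul_queryBudget_stay_le he
  have hweight : (s.stay k r).phase.weight = s.phase.weight := by
    rw [Conf.stay, PhaseData.next_of_not_newEpoch he]
  have hstay : (s.stay k r).level = s.level := rfl
  rw [budget, budget, hstay, hweight]
  by_cases hlevel : s.level < L
  · have hbudget := h.levelBudget_stay_add_le he hf hlevel
    rw [if_pos hlevel, if_pos hlevel]
    by_cases hr : r ∈ s.ref
    · rw [if_neg (by tauto)] at hquery
      rw [if_pos hr] at hbudget
      omega
    · rw [if_pos ⟨hlevel, hr⟩] at hquery
      rw [if_neg hr] at hbudget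
      omega
  · rw [if_neg (by tauto)] at hquery
    rw [if_neg hlevel, if_neg hlevel]
    exact hquery

lemma Settled.budget_update_le (hk : 0 < k) (h : s.Settled k a L N) (r : Page) :
    (s.update k L r).budget a L N ≤ s.budget a L N +
      44 * (∑ j ∈ Finset.range L, N j) *
        if s.phase.NewEpoch k r then (s.phase.next k r).weight else 0 := by
  by_cases he : s.phase.NewEpoch k r
  · rw [update_of_newEpoch he, if_pos he]
    exact (h.budget_startEpoch_le hk he).trans (Nat.le_add_left _ _)
  rw [if_neg he, mul_zero, add_zero]
  by_cases hf : s.Fails k L r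
  · exact update_of_fails hf ▸ h.budget_climb_le hk hf
  · exact update_of_not_fails he hf ▸ h.budget_stay_le he hf

end Update

lemma Ready.missing_pos (h : s.Ready k a L N r) (hr : r ∉ s.cached) : 0 < s.missing :=
  Finset.card_pos.2 ⟨r, Finset.mem_sdiff.2 ⟨h.mem_ref, hr⟩⟩

lemma Opened.budget_le (h : s.Ready k a L N r) (hq : s.Opened a L N r q) :
    q.budget a L N ≤ s.budget a L N := by
  rcases hq with ⟨hs, l, -, rfl⟩ | ⟨-, rfl⟩
  · have hmissing := h.missing_pos hs.2.1
    have hperiod : N s.level * (s.missing + 1) ≤ 2 * N s.level * s.missing := by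
      rw [mul_comm 2, mul_assoc]
      exact Nat.mul_le_mul_left _ (by omega)
    have hbudget : (s.startPeriod N l).budget a L N = N s.level * (s.missing + 1) +
        (0 + 3 * N s.level * (7 * s.phase.weight - s.misses) + 4 * s.phase.weight * N s.level +
          40 * s.phase.weight * ∑ j ∈ Finset.Ico (s.level + 1) L, N j) := by
      simp [budget, levelBudget, queryBudget, startPeriod, remaining, missing, hs.2.2.1]
    rw [hbudget, budget, if_pos hs.2.2.1, levelBudget, h.chosen_eq_none hs.1]
    simp only [Option.isSome_none, Bool.false_eq_true, if_false]
    omega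
  · exact le_rfl

section Finish

lemma Ready.card_erase_add_one_sub_le (h : s.Ready k a L N r) :
    (s.ref.erase r).card + 1 - k ≤ s.missing := by
  rw [h.card_erase_ref, missing, Finset.card_sdiff_of_subset h.cached_subset]
  exact Nat.sub_le_sub_left h.card_cached _

lemma missing_adopt (k : ℕ) (s : Conf Page) (r : Page) (R : Finset Page) :
    (s.adopt k r R).missing = 0 := by simp [missing, adopt]

lemma Ready.missing_le_of_mem_support_finish (h : s.Ready k a L N r)
    (hs' : s' ∈ (s.finish k a L r R).support) : s'.missing ≤ s.missing := by
  rcases mem_support_finish hs' with ⟨-, rfl⟩ | ⟨-, X, hX, rfl⟩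
  · exact (missing_adopt k s r R).trans_le (Nat.zero_le _)
  · have hcard := h.card_of_mem_support_evict hX
    have hcached := h.card_cached
    have hpages := Finset.card_le_card (h.cached_subset.trans h.ref_subset)
    change (s.ref \ X).card ≤ (s.ref \ s.cached).card
    rw [Finset.card_sdiff_of_subset (h.subset_ref_of_mem_support_evict hX),
      Finset.card_sdiff_of_subset h.cached_subset]
    omega

lemma Ready.queryBudget_le_of_mem_support_finish (h : s.Ready k a L N r)
    (hs' : s' ∈ (s.finish k a L r R).support) : s'.queryBudget ≤ s.queryBudget := by
  have hmissing := h.missing_le_of_mem_support_finish hs'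
  rw [queryBudget, queryBudget, fresh_of_mem_support_finish hs', phase_of_mem_support_finish hs']
  split_ifs <;> omega

lemma Ready.levelBudget_le_of_mem_support_finish (h : s.Ready k a L N r)
    (hs' : s' ∈ (s.finish k a L r R).support) : s'.levelBudget N ≤ s.levelBudget N := by
  have hchosen : (if s'.chosen.isSome then 0 else 2 * N s.level * s'.missing)
      ≤ if s.chosen.isSome then 0 else 2 * N s.level * s.missing := by
    have hmissing := h.missing_le_of_mem_support_finish hs'
    rcases mem_support_finish hs' with ⟨-, rfl⟩ | ⟨-, X, -, rfl⟩
    · simp [missing_adopt]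
    · change (if s.chosen.isSome then 0 else _) ≤ _
      split_ifs
      · exact le_rfl
      · exact Nat.mul_le_mul_left _ hmissing
  rw [levelBudget, levelBudget, level_of_mem_support_finish hs', phase_of_mem_support_finish hs',
    misses_of_mem_support_finish hs']
  gcongr

lemma Ready.card_erase_lt_queryBudget (h : s.Ready k a L N r) (hasks : s.Asks a) :
    (s.ref.erase r).card + 1 - k + 1 ≤ s.queryBudget := by
  have hmissing : s.missing ≤ 2 * s.phase.weight := h.card_sdiff_le
  have hweight : 0 < s.phase.weight := h.weight_pos fun h0 ↦ by
    have hlt := hasks.1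
    rw [h0, Nat.zero_mul] at hlt
    exact Nat.not_lt_zero _ hlt
  have hnumber := h.card_erase_add_one_sub_le
  unfold queryBudget
  split_ifs <;> omega

lemma remaining_eq_succ_of_asks (ha : 0 < a) (hasks : s.Asks a)
    (hs' : s' ∈ (s.finish k a L r R).support) : s.remaining a = s'.remaining a + 1 := by
  have hlt : s.elapsed / a < s.queries := (Nat.div_lt_iff_lt_mul ha).2 hasks.1
  rw [remaining, remaining, elapsed_of_mem_support_finish hs', if_pos hasks.1,
    queries_of_mem_support_finish hs', Nat.succ_div_of_dvd hasks.2]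
  omega

lemma remaining_le_of_mem_support_finish (hs' : s' ∈ (s.finish k a L r R).support) :
    s'.remaining a ≤ s.remaining a := by
  rw [remaining, remaining, queries_of_mem_support_finish hs', elapsed_of_mem_support_finish hs']
  refine Nat.sub_le_sub_left (Nat.div_le_div_right ?_) _
  split_ifs
  · exact Nat.le_succ _
  · exact le_rfl

lemma Ready.budget_finish_le (ha : 0 < a) (h : s.Ready k a L N r)
    (hs' : s' ∈ (s.finish k a L r R).support) :
    (if s.Asks a then (s.ref.erase r).card + 1 - k + 1 else 0) + s'.budget a L N
      ≤ s.budget a L N := by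
  have hquery := h.queryBudget_le_of_mem_support_finish hs'
  have hperiod : (if s.Asks a then (s.ref.erase r).card + 1 - k + 1 else 0) +
      s'.remaining a * s'.queryBudget ≤ s.remaining a * s.queryBudget := by
    split_ifs with hasks
    · rw [remaining_eq_succ_of_asks ha hasks hs', Nat.succ_mul, add_comm]
      exact Nat.add_le_add (Nat.mul_le_mul_left _ hquery) (h.card_erase_lt_queryBudget hasks)
    · rw [zero_add]
      exact Nat.mul_le_mul (remaining_le_of_mem_support_finish hs') hquery
  have hlevel := h.levelBudget_le_of_mem_support_finish hs'
  rw [budget, budget, level_of_mem_support_finish hs', phase_of_mem_support_finish hs',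
    ← add_assoc]
  refine Nat.add_le_add hperiod ?_
  split_ifs
  · exact Nat.add_le_add_right hlevel _
  · exact le_rfl

end Finish

end Conf

lemma queries_le {Page : Type u} [DecidableEq Page] {k a L : ℕ} {N : ℕ → ℕ} (hk : 0 < k)
    {init : Finset Page} (hinit : init.card ≤ k) (ha : 0 < a) (P : Predictor Page k)
    (req : ℕ → Page) (T : ℕ) (o : (levelAlgorithm k a L N hk init hinit).Outcome)
    (ho : o ∈ ((levelAlgorithm k a L N hk init hinit).run P req T).support) :
    (o.queries.map fun q ↦ q.number + 1).sum
      ≤ 44 * (∑ j ∈ Finset.range L, N j) * totalWeight k init req T := by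
  have hbudget := (levelAlgorithm_induction hk hinit ha P req (fun t s Q ↦
    (Q.map fun q ↦ q.number + 1).sum + s.budget a L N
      ≤ 44 * (∑ j ∈ Finset.range L, N j) * totalWeight k init req t) ?_ ?_ T o ho).2.2
  · exact (Nat.le_add_right _ _).trans hbudget
  · simp [levelAlgorithm, Conf.budget, Conf.levelBudget, Conf.remaining, Conf.missing]
  · intro t s q s' Q h hQ
    have hupdate := h.settled.budget_update_le hk (req t)
    have hopened := h.opened.budget_le (h.ready_update hk)
    have hfinish := (h.ready hk ha).budget_finish_le ha h.mem_support
    have hsum : ((if q.Asks a then q.query k (req t) t :: Q else Q).map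
        fun q ↦ q.number + 1).sum
        = (if q.Asks a then (q.ref.erase (req t)).card + 1 - k + 1 else 0)
          + (Q.map fun q ↦ q.number + 1).sum := by
      split_ifs <;> simp [Conf.query]
    rw [h.phase_eq] at hupdate
    rw [hsum, totalWeight, phaseAt, Nat.mul_add]
    omega

/-! ### The potential of the cost -/

section EvictCost

variable {Page : Type u} [DecidableEq Page] {k : ℕ} {r p : Page} {X M : Finset Page}
  {g : Page → ℝ}

lemma card_insert_erase_sdiff (hr : r ∉ X) : (insert r (X.erase p) \ X).card = 1 := by
  rw [Finset.insert_sdiff_of_notMem _ hr,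
    Finset.sdiff_eq_empty_iff_subset.2 (Finset.erase_subset _ _), insert_empty_eq,
    Finset.card_singleton]

lemma sum_sdiff_insert_erase_le (D : Finset Page) (hg : ∀ y, 0 ≤ g y) (hp : p ∈ X) :
    ∑ y ∈ D \ insert r (X.erase p), g y ≤ ∑ y ∈ (D \ X).erase r, g y + g p := by
  have hsub : D \ insert r (X.erase p) ⊆ insert p ((D \ X).erase r) := by
    intro y
    simp only [Finset.mem_sdiff, Finset.mem_insert, Finset.mem_erase]
    tauto
  have hp' : p ∉ (D \ X).erase r := fun h ↦
    (Finset.mem_sdiff.1 (Finset.mem_of_mem_erase h)).2 hp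
  refine (Finset.sum_le_sum_of_subset_of_nonneg hsub fun y _ _ ↦ hg y).trans_eq ?_
  rw [Finset.sum_insert hp', add_comm]

lemma mean_evict_le {D : Finset Page} {v : ℝ} (hX : X.card ≤ k)
    (hne : r ∉ X → X.card = k → (X \ M).Nonempty) (hg : ∀ y, 0 ≤ g y) (hv : r ∉ X → 1 ≤ v)
    (havg : r ∉ X → X.card = k → (∑ p ∈ X \ M, g p) / (X \ M).card ≤ v - 1) :
    mean (evict k r X M) (fun Y ↦ ((Y \ X).card : ℝ) + ∑ y ∈ D \ Y, g y)
      ≤ (if r ∈ X then 0 else v) + ∑ y ∈ (D \ X).erase r, g y := by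
  unfold evict
  by_cases hr : r ∈ X
  · rw [if_pos hr, if_pos hr, mean_pure,
      Finset.erase_eq_of_notMem fun h ↦ (Finset.mem_sdiff.1 h).2 hr]
    simp
  rw [if_neg hr, if_neg hr]
  by_cases hcard : X.card < k
  · have hD : D \ insert r X = (D \ X).erase r := by
      rw [Finset.sdiff_insert]
    rw [if_pos hcard, mean_pure, Finset.insert_sdiff_of_notMem _ hr, hD, sdiff_self]
    simpa using hv hr
  have hcard : X.card = k := hX.antisymm (not_lt.1 hcard)
  have hout := hne hr hcard
  have hpos : (0 : ℝ) < (X \ M).card := by exact_mod_cast hout.card_pos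
  rw [if_neg hcard.not_lt, dif_pos hout,
    mean_map (by rw [PMF.support_uniformOfFinset]; exact (X \ M).finite_toSet),
    mean_uniformOfFinset, div_le_iff₀ hpos]
  have hevicted : ∀ p ∈ X \ M, ((insert r (X.erase p) \ X).card : ℝ)
      + ∑ y ∈ D \ insert r (X.erase p), g y ≤ 1 + ∑ y ∈ (D \ X).erase r, g y + g p := by
    intro p hp
    rw [card_insert_erase_sdiff hr, Nat.cast_one, add_assoc]
    gcongr
    exact sum_sdiff_insert_erase_le D hg (Finset.mem_sdiff.1 hp).1
  refine (Finset.sum_le_sum hevicted).trans ?_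
  have hsum := (div_le_iff₀ hpos).1 (havg hr hcard)
  rw [Finset.sum_add_distrib, Finset.sum_const, nsmul_eq_mul]
  linarith

end EvictCost

namespace Conf

variable {Page : Type u} [DecidableEq Page] {k a L : ℕ} {N : ℕ → ℕ} {s q : Conf Page} {r : Page}
  {req : ℕ → Page} {T t : ℕ}

/-- An upper bound for the expected cost before the next change of level or epoch, on a level with
predictions. A missing page costs less once a query has been chosen, because the adoption of its
answer is then paid for. -/
noncomputable def levelPotential (k a : ℕ) (req : ℕ → Page) (t : ℕ) (s : Conf Page) : ℝ :=
  ∑ y ∈ s.ref \ s.cached, randWeight k req y t (s.queries * a - s.elapsed)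
    + (if s.chosen.isSome then 1 else 9) * s.missing
    + 17 * (7 * s.phase.weight - s.misses) + 12 * s.phase.weight * s.level + 2 * s.phase.weight

/-- An upper bound for the expected cost before the next epoch, on the last level. -/
noncomputable def lastPotential (k : ℕ) (req : ℕ → Page) (T t : ℕ) (s : Conf Page) : ℝ :=
  ∑ y ∈ s.ref \ s.cached, markWeight k req y s.recent t (T - t)
    + (harmonic k + 1) * (2 * s.phase.weight - s.phase.clean) + 2 * s.phase.weight

/-- The potential for the analysis of the expected cost. -/
noncomputable def potential (k a L : ℕ) (req : ℕ → Page) (T t : ℕ) (s : Conf Page) : ℝ :=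
  if s.level < L then s.levelPotential k a req t else s.lastPotential k req T t

section Bounds

lemma Core.clean_le (h : s.Core k a L N) : (s.phase.clean : ℝ) ≤ 2 * s.phase.weight := by
  have := h.valid.clean_lt
  exact_mod_cast (by omega : s.phase.clean ≤ 2 * s.phase.weight)

lemma Ready.cast_missing_le (h : s.Ready k a L N r) : (s.missing : ℝ) ≤ 2 * s.phase.weight := by
  exact_mod_cast h.card_sdiff_le

lemma le_levelPotential (h : s.misses ≤ 7 * s.phase.weight) :
    12 * s.phase.weight * s.level + 2 * s.phase.weight ≤ s.levelPotential k a req t := by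
  have hsum : 0 ≤ ∑ y ∈ s.ref \ s.cached, randWeight k req y t (s.queries * a - s.elapsed) :=
    Finset.sum_nonneg fun y _ ↦ randWeight_nonneg k req y t _
  have hmissing : 0 ≤ (if s.chosen.isSome then 1 else 9) * (s.missing : ℝ) := by positivity
  have hmisses : (s.misses : ℝ) ≤ 7 * s.phase.weight := by exact_mod_cast h
  rw [levelPotential]
  linarith

lemma Core.le_lastPotential (h : s.Core k a L N) :
    2 * s.phase.weight ≤ s.lastPotential k req T t := by
  have hsum : 0 ≤ ∑ y ∈ s.ref \ s.cached, markWeight k req y s.recent t (T - t) :=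
    Finset.sum_nonneg fun y _ ↦ markWeight_nonneg k req y _ t _
  have hclean : 0 ≤ ((harmonic k : ℝ) + 1) * (2 * s.phase.weight - s.phase.clean) :=
    mul_nonneg (add_nonneg (harmonic_nonneg k) zero_le_one) (sub_nonneg.2 h.clean_le)
  rw [lastPotential]
  linarith

lemma Core.two_mul_weight_le_potential (h : s.Core k a L N) (req : ℕ → Page) (T t : ℕ) :
    2 * s.phase.weight ≤ s.potential k a L req T t := by
  unfold potential
  split_ifs with hlevel
  · refine le_trans ?_ (le_levelPotential (h.misses_le hlevel))
    exact le_add_of_nonneg_left (by positivity)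
  · exact h.le_lastPotential

lemma Core.potential_nonneg (h : s.Core k a L N) (req : ℕ → Page) (T t : ℕ) :
    0 ≤ s.potential k a L req T t :=
  le_trans (by positivity) (h.two_mul_weight_le_potential req T t)

variable (hN : ∀ i < L, N i * a ≤ 2 * k)

include hN in
lemma Core.randWeight_le (h : s.Core k a L N) (req : ℕ → Page) (y : Page) (t : ℕ) :
    randWeight k req y t (s.queries * a - s.elapsed) ≤ 8 := by
  refine (randWeight_le_growth_pow k req y t _).trans (growth_pow_le_eight ?_)
  refine (Nat.sub_le _ _).trans ?_
  rcases h.queries_cases with hzero | ⟨i, hi, hi'⟩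
  · simp [hzero]
  · exact hi' ▸ hN i hi

lemma sum_missing_le {g : Page → ℝ} {c : ℝ} (s : Conf Page) (hg : ∀ y, g y ≤ c) :
    ∑ y ∈ s.ref \ s.cached, g y ≤ c * s.missing := by
  refine (Finset.sum_le_card_nsmul _ _ c fun y _ ↦ hg y).trans_eq ?_
  rw [nsmul_eq_mul, mul_comm, missing]

include hN in
lemma Ready.levelPotential_le (h : s.Ready k a L N r) (hmisses : s.misses = 0)
    (hchosen : s.chosen = none) :
    s.levelPotential k a req t ≤ 155 * s.phase.weight + 12 * s.phase.weight * s.level := by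
  have hmissing := h.cast_missing_le
  have hsum := s.sum_missing_le fun y ↦ h.randWeight_le hN req y t
  rw [levelPotential, hmisses, hchosen]
  simp only [Option.isSome_none, Bool.false_eq_true, if_false, Nat.cast_zero, sub_zero]
  linarith

lemma Ready.lastPotential_le (hH : (harmonic k : ℝ) ≤ 3 * L) (h : s.Ready k a L N r) :
    s.lastPotential k req T t ≤ 12 * s.phase.weight * L + 4 * s.phase.weight := by
  have hsum := s.sum_missing_le fun y ↦ markWeight_le_harmonic k req y s.recent t (T - t)
  have hmissing : (harmonic k : ℝ) * s.missing ≤ harmonic k * (2 * s.phase.weight) :=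
    mul_le_mul_of_nonneg_left h.cast_missing_le (harmonic_nonneg k)
  have hweight : (harmonic k : ℝ) * s.phase.weight ≤ 3 * L * s.phase.weight :=
    mul_le_mul_of_nonneg_right hH (Nat.cast_nonneg _)
  have hclean : 0 ≤ ((harmonic k : ℝ) + 1) * s.phase.clean :=
    mul_nonneg (add_nonneg (harmonic_nonneg k) zero_le_one) (Nat.cast_nonneg _)
  rw [lastPotential]
  linarith

end Bounds

section Update

lemma Settled.cached_update (h : s.Settled k a L N) (he : ¬ s.phase.NewEpoch k r) :
    (s.update k L r).cached = s.cached := by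
  by_cases hf : s.Fails k L r
  · rw [update_of_fails hf]
    exact h.cache_eq
  · rw [update_of_not_fails he hf]
    exact h.cache_eq

lemma Settled.card_marked_sdiff_cached_le (h : s.Settled k a L N) (hp : s.phase.NewPhase k r) :
    (s.phase.marked \ s.cached).card ≤ 2 * s.phase.weight := by
  have hmarked : s.phase.marked.card = k := h.valid.card_marked.antisymm hp.2
  have hcached : s.cached.card = k := by
    rw [h.card_eq, min_eq_left]
    exact hp.2.trans (Finset.card_le_card Finset.subset_union_right)
  have hold : s.cached \ s.phase.marked ⊆ s.phase.base \ s.phase.marked := by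
    intro y hy
    have hy' := h.ref_subset (h.cached_subset (Finset.mem_sdiff.1 hy).1)
    simp only [PhaseData.pages, Finset.mem_sdiff, Finset.mem_union] at hy' hy ⊢
    tauto
  have hclean := h.valid.clean_lt
  calc (s.phase.marked \ s.cached).card = (s.cached \ s.phase.marked).card :=
        Finset.card_sdiff_comm (hmarked.trans hcached.symm)
    _ ≤ (s.phase.base \ s.phase.marked).card := Finset.card_le_card hold
    _ ≤ s.phase.clean := Finset.card_sdiff_le_card_sdiff_iff.2
        (h.valid.card_base.trans hmarked.ge)
    _ ≤ 2 * s.phase.weight := by omega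

lemma Settled.card_startEpoch_sdiff_le (h : s.Settled k a L N) (r : Page) :
    ((s.startEpoch k r).cached \ s.cached).card ≤ 2 * s.phase.weight := by
  rw [Conf.startEpoch]
  split_ifs with hp
  · rw [trim_eq_self h.valid.card_marked]
    exact h.card_marked_sdiff_cached_le hp
  · rw [h.cache_eq, sdiff_self]
    exact Nat.zero_le _

lemma sum_insert_sdiff_le {X D : Finset Page} {g : Page → ℝ} (hg : 0 ≤ g r) :
    ∑ y ∈ insert r D \ X, g y ≤ ∑ y ∈ D \ X, g y + if r ∈ D then 0 else g r := by
  split_ifs with hr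
  · rw [Finset.insert_eq_of_mem hr, add_zero]
  · refine (sum_le_add_sum_erase _ r hg).trans_eq ?_
    have herase : (insert r D \ X).erase r = D \ X := by grind
    rw [herase, add_comm]

variable (hN : ∀ i < L, N i * a ≤ 2 * k)

include hN in
lemma Settled.potential_startEpoch_le (hk : 0 < k) (hL : 0 < L) (h : s.Settled k a L N)
    (he : s.phase.NewEpoch k r) :
    (((s.startEpoch k r).cached \ s.cached).card : ℝ) + (s.startEpoch k r).potential k a L req T t
      ≤ s.potential k a L req T t + 170 * (s.phase.next k r).weight := by
  have hload : (((s.startEpoch k r).cached \ s.cached).card : ℝ) ≤ 2 * s.phase.weight := by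
    exact_mod_cast h.card_startEpoch_sdiff_le r
  have hnew : (s.startEpoch k r).potential k a L req T t
      ≤ 155 * (s.phase.next k r).weight + 12 * (s.phase.next k r).weight * ((0 : ℕ) : ℝ) :=
    (if_pos hL).trans_le ((h.startEpoch hk he).levelPotential_le hN rfl rfl)
  have hold := h.two_mul_weight_le_potential req T t
  have hweight : (0 : ℝ) ≤ (s.phase.next k r).weight := Nat.cast_nonneg _
  rw [Nat.cast_zero] at hnew
  linarith

include hN in
lemma Settled.potential_climb_le (hk : 0 < k) (hH : (harmonic k : ℝ) ≤ 3 * L)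
    (h : s.Settled k a L N) (hf : s.Fails k L r) :
    (s.climb k r).potential k a L req T t ≤ s.potential k a L req T t + 170 * s.phase.weight := by
  have hready := h.climb hk hf
  have hold : 12 * s.phase.weight * s.level + 2 * s.phase.weight ≤ s.potential k a L req T t :=
    (le_levelPotential (h.misses_le hf.2.1)).trans_eq (if_pos hf.2.1).symm
  have hphase : (s.climb k r).phase.weight = s.phase.weight := by
    simp only [Conf.climb, PhaseData.next_of_not_newEpoch hf.1]
  have hlevel : (s.climb k r).level = s.level + 1 := rfl
  rw [potential]
  split_ifs with hl
  · have hnew := hready.levelPotential_le hN (req := req) (t := t) rfl rfl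
    rw [hphase, hlevel, Nat.cast_succ] at hnew
    linarith
  · have hnew := hready.lastPotential_le hH (req := req) (T := T) (t := t)
    have hL : (L : ℝ) = s.level + 1 := by
      exact_mod_cast (not_lt.1 hl).antisymm hf.2.1
    rw [hphase, hL] at hnew
    linarith

include hN in
lemma Settled.levelPotential_stay_le (h : s.Settled k a L N)
    (he : ¬ s.phase.NewEpoch k (req t)) :
    (s.stay k (req t)).levelPotential k a req t ≤ s.levelPotential k a req t := by
  have hsum := sum_insert_sdiff_le (D := s.ref) (X := s.cached)
    (g := fun y ↦ randWeight k req y t (s.queries * a - s.elapsed))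
    (randWeight_nonneg k req (req t) t (s.queries * a - s.elapsed))
  have hle := h.randWeight_le hN req (req t) t
  have hmissing : ((s.stay k (req t)).missing : ℝ)
      ≤ s.missing + if req t ∈ s.ref then 0 else 1 := by
    exact_mod_cast h.missing_stay_le (req t)
  have hfactor : (if s.chosen.isSome then (1 : ℝ) else 9) * (s.stay k (req t)).missing
      ≤ (if s.chosen.isSome then 1 else 9) * s.missing
        + 9 * if req t ∈ s.ref then 0 else 1 := by
    split_ifs at hmissing ⊢ <;> linarith
  have hcache : (s.stay k (req t)).cached = s.cached := h.cache_eq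
  have hweight : (s.stay k (req t)).phase.weight = s.phase.weight := by
    simp only [Conf.stay, PhaseData.next_of_not_newEpoch he]
  have hmisses : ((s.stay k (req t)).misses : ℝ) = s.misses + if req t ∈ s.ref then 0 else 1 := by
    simp only [Conf.stay, Nat.cast_add, Nat.cast_ite, Nat.cast_zero, Nat.cast_one]
  rw [levelPotential, levelPotential, hcache, hweight, hmisses]
  change ∑ y ∈ insert (req t) s.ref \ s.cached,
    randWeight k req y t (s.queries * a - s.elapsed)
      + (if s.chosen.isSome then (1 : ℝ) else 9) * (s.stay k (req t)).missing
      + 17 * (7 * s.phase.weight - (s.misses + _)) + 12 * s.phase.weight * s.level + _ ≤ _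
  split_ifs at hsum hfactor ⊢ <;> linarith

lemma Settled.lastPotential_stay_le (h : s.Settled k a L N) (hlevel : s.level = L)
    (he : ¬ s.phase.NewEpoch k (req t)) :
    (s.stay k (req t)).lastPotential k req T t ≤ s.lastPotential k req T t := by
  have hsum := sum_insert_sdiff_le (D := s.ref) (X := s.cached)
    (g := fun y ↦ markWeight k req y s.recent t (T - t))
    (markWeight_nonneg k req (req t) s.recent t (T - t))
  have hle := markWeight_le_harmonic k req (req t) s.recent t (T - t)
  have hcache : (s.stay k (req t)).cached = s.cached := h.cache_eq
  have hweight : (s.stay k (req t)).phase.weight = s.phase.weight := by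
    simp only [Conf.stay, PhaseData.next_of_not_newEpoch he]
  have hclean : ((s.stay k (req t)).phase.clean : ℝ)
      = s.phase.clean + if req t ∈ s.ref then 0 else 1 := by
    rw [h.ref_eq hlevel]
    exact_mod_cast PhaseData.clean_next (PhaseData.not_newPhase he)
  rw [lastPotential, lastPotential, hcache, hweight, hclean]
  change ∑ y ∈ insert (req t) s.ref \ s.cached, markWeight k req y s.recent t (T - t) + _ + _ ≤ _
  split_ifs at hsum ⊢ <;> linarith

include hN in
lemma Settled.potential_update_le (hk : 0 < k) (hL : 0 < L) (hH : (harmonic k : ℝ) ≤ 3 * L)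
    (h : s.Settled k a L N) :
    (((s.update k L (req t)).cached \ s.cached).card : ℝ)
      + (s.update k L (req t)).potential k a L req T t ≤ s.potential k a L req T t
      + 170 * ((if s.phase.NewEpoch k (req t) then ((s.phase.next k (req t)).weight : ℝ) else 0)
        + if s.Fails k L (req t) then (s.phase.weight : ℝ) else 0) := by
  by_cases he : s.phase.NewEpoch k (req t)
  · rw [update_of_newEpoch he, if_pos he, if_neg fun hf : s.Fails k L (req t) ↦ hf.1 he, add_zero]
    exact h.potential_startEpoch_le hN hk hL he
  rw [h.cached_update he, Finset.sdiff_self, Finset.card_empty, Nat.cast_zero, zero_add, if_neg he,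
    zero_add]
  by_cases hf : s.Fails k L (req t)
  · rw [update_of_fails hf, if_pos hf]
    exact h.potential_climb_le hN hk hH hf
  rw [update_of_not_fails he hf, if_neg hf, mul_zero, add_zero]
  by_cases hlevel : s.level < L
  · exact (if_pos hlevel).trans_le ((h.levelPotential_stay_le hN he).trans_eq (if_pos hlevel).symm)
  · exact (if_neg hlevel).trans_le ((h.lastPotential_stay_le
      (h.level_le.antisymm (not_lt.1 hlevel)) he).trans_eq (if_neg hlevel).symm)

include hN in
lemma Ready.potential_startPeriod_le (h : s.Ready k a L N r) (hs : s.StartsPeriod a L N r)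
    (l : ℕ) : (s.startPeriod N l).potential k a L req T t ≤ s.potential k a L req T t := by
  have hchosen := h.chosen_eq_none hs.1
  have hsum : ∑ y ∈ s.ref \ s.cached, randWeight k req y t (N s.level * a - 0)
      ≤ 8 * s.missing :=
    s.sum_missing_le fun y ↦ (randWeight_le_growth_pow k req y t _).trans
      (growth_pow_le_eight (hN s.level hs.2.2.1))
  have hzero : ∑ y ∈ s.ref \ s.cached, randWeight k req y t (s.queries * a - s.elapsed) = 0 := by
    simp [Nat.sub_eq_zero_of_le hs.1, randWeight]
  rw [potential, potential, if_pos hs.2.2.1, if_pos (c := (s.startPeriod N l).level < L) hs.2.2.1,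
    levelPotential, levelPotential, hzero, hchosen]
  change ∑ y ∈ s.ref \ s.cached, randWeight k req y t (N s.level * a - 0) + 1 * (s.missing : ℝ)
    + 17 * (7 * s.phase.weight - s.misses) + 12 * s.phase.weight * s.level + 2 * s.phase.weight
    ≤ 0 + 9 * s.missing + _ + _ + _
  linarith

end Update

end Conf

namespace Conf

variable {Page : Type u} {k a L : ℕ} {N : ℕ → ℕ} {p q s s' : Conf Page}
  {r : Page} {R X : Finset Page} {req : ℕ → Page} {T t : ℕ}

lemma Opened.elapsed_lt_or_mem_cached (ha : 0 < a) (hN : ∀ i < L, 0 < N i)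
    (h : p.Opened a L N r q) (hlevel : q.level < L) :
    q.elapsed < q.queries * a ∨ r ∈ q.cached := by
  rcases h with ⟨hs, l, -, rfl⟩ | ⟨hs, rfl⟩
  · exact Or.inl (Nat.mul_pos hs.2.2.2 ha)
  · by_contra! hcon
    exact hs ⟨hcon.1, hcon.2, hlevel, hN _ hlevel⟩

variable [DecidableEq Page]

lemma sum_sdiff_eq_add_sum_erase {D : Finset Page} (hr : r ∈ D) (X : Finset Page)
    (g : Page → ℝ) :
    ∑ y ∈ D \ X, g y = (if r ∈ X then 0 else g r) + ∑ y ∈ (D \ X).erase r, g y := by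
  split_ifs with h
  · rw [Finset.erase_eq_of_notMem fun h' ↦ (Finset.mem_sdiff.1 h').2 h, zero_add]
  · rw [Finset.add_sum_erase _ _ (Finset.mem_sdiff.2 ⟨hr, h⟩)]

section Level

lemma Ready.sum_randWeight_eq (h : q.Ready k a L N (req t))
    (hactive : q.elapsed < q.queries * a ∨ req t ∈ q.cached) :
    ∑ y ∈ q.ref \ q.cached, randWeight k req y t (q.queries * a - q.elapsed)
      = (if req t ∈ q.cached then 0 else (1 + 1 / (k : ℝ)) ^ (q.queries * a - q.elapsed - 1))
        + ∑ y ∈ (q.ref \ q.cached).erase (req t),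
          randWeight k req y (t + 1) (q.queries * a - q.elapsed - 1) := by
  cases hn : q.queries * a - q.elapsed with
  | zero =>
    rw [if_pos (hactive.resolve_left (not_lt.2 (Nat.sub_eq_zero_iff_le.1 hn)))]
    simp [randWeight]
  | succ n =>
    rw [sum_sdiff_eq_add_sum_erase h.mem_ref, randWeight_self, Nat.add_sub_cancel]
    congr 1
    exact Finset.sum_congr rfl fun y hy ↦ randWeight_of_ne k req (Finset.ne_of_mem_erase hy) n

lemma Ready.mean_evict_randWeight_le (hk : 0 < k) (h : q.Ready k a L N (req t))
    (hlevel : q.level < L) (hactive : q.elapsed < q.queries * a ∨ req t ∈ q.cached) :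
    mean (evict k (req t) q.cached q.recent) (fun X ↦ ((X \ q.cached).card : ℝ)
        + ∑ y ∈ q.ref \ X, randWeight k req y (t + 1) (q.queries * a - q.elapsed - 1))
      ≤ ∑ y ∈ q.ref \ q.cached, randWeight k req y t (q.queries * a - q.elapsed) := by
  rw [h.sum_randWeight_eq hactive]
  refine mean_evict_le h.card_cached (fun hr hcard ↦ h.cached_sdiff_recent_nonempty hr hcard)
    (fun y ↦ randWeight_nonneg k req y _ _) (fun _ ↦ one_le_pow₀ (one_le_growth k))
    fun _ hcard ↦ ?_
  rw [h.recent_eq hlevel, Finset.sdiff_empty, hcard, div_le_iff₀ (by exact_mod_cast hk)]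
  exact (sum_randWeight_le req hk _ _ _).trans_eq (mul_comm _ _)

lemma Ready.levelPotential_serve_le (h : q.Ready k a L N r) (hadopts : ¬ q.Adopts a)
    (hX : X ∈ (evict k r q.cached q.recent).support) :
    (q.serve a L r X).levelPotential k a req t
      ≤ ∑ y ∈ q.ref \ X, randWeight k req y t (q.queries * a - q.elapsed - 1)
        + ((if q.chosen.isSome then 1 else 9) * q.missing
        + 17 * (7 * q.phase.weight - q.misses) + 12 * q.phase.weight * q.level
        + 2 * q.phase.weight) := by
  have hmem : q.serve a L r X ∈ (q.finish k a L r ∅).support := by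
    rw [Conf.finish, if_neg hadopts, PMF.mem_support_map_iff]
    exact ⟨X, hX, rfl⟩
  have hmissing : ((q.serve a L r X).missing : ℝ) ≤ q.missing := by
    exact_mod_cast h.missing_le_of_mem_support_finish hmem
  have hfactor : (if q.chosen.isSome then (1 : ℝ) else 9) * (q.serve a L r X).missing
      ≤ (if q.chosen.isSome then 1 else 9) * q.missing := by gcongr
  have hn : q.queries * a - (q.serve a L r X).elapsed = q.queries * a - q.elapsed - 1 := by
    simp only [Conf.serve]
    split_ifs <;> omega
  rw [levelPotential]
  change ∑ y ∈ q.ref \ X, randWeight k req y t (q.queries * a - (q.serve a L r X).elapsed)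
    + (if q.chosen.isSome then (1 : ℝ) else 9) * (q.serve a L r X).missing
    + 17 * (7 * q.phase.weight - q.misses) + 12 * q.phase.weight * q.level
    + 2 * q.phase.weight ≤ _
  rw [hn]
  linarith

lemma Ready.mean_serve_level_le (hk : 0 < k) (h : q.Ready k a L N (req t))
    (hadopts : ¬ q.Adopts a) (hlevel : q.level < L)
    (hactive : q.elapsed < q.queries * a ∨ req t ∈ q.cached) :
    mean (evict k (req t) q.cached q.recent) (fun X ↦ ((X \ q.cached).card : ℝ)
        + (q.serve a L (req t) X).levelPotential k a req (t + 1))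
      ≤ q.levelPotential k a req t := by
  have hfin := finite_support_evict k (req t) q.cached q.recent
  refine (mean_mono hfin fun X hX ↦
    (add_le_add_right (h.levelPotential_serve_le hadopts hX) _).trans_eq
      (add_assoc _ _ _).symm).trans ?_
  rw [mean_add hfin, mean_const hfin, levelPotential]
  linarith [h.mean_evict_randWeight_le hk hlevel hactive]

lemma Ready.levelPotential_adopt_le (h : q.Ready k a L N r) (hadopts : q.Adopts a)
    (R : Finset Page) :
    ((q.adopted k r R \ q.cached).card : ℝ) + (q.adopt k r R).levelPotential k a req (t + 1)
      ≤ q.levelPotential k a req t := by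
  have hload : ((q.adopted k r R \ q.cached).card : ℝ) ≤ q.missing := by
    exact_mod_cast Finset.card_le_card
      (Finset.sdiff_subset_sdiff (adopted_subset k h.mem_ref R) le_rfl)
  have hsum : 0 ≤ ∑ y ∈ q.ref \ q.cached, randWeight k req y t (q.queries * a - q.elapsed) :=
    Finset.sum_nonneg fun y _ ↦ randWeight_nonneg k req y t _
  rw [levelPotential, levelPotential, missing_adopt, hadopts.2, Conf.adopt]
  simp only [sdiff_self, Finset.bot_eq_empty, Finset.sum_empty, Nat.cast_zero, mul_zero, zero_add,
    Option.isSome_some, if_true]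
  linarith

end Level

section Last

lemma Ready.sum_markWeight_eq (h : q.Ready k a L N (req t)) (ht : t < T) :
    ∑ y ∈ q.ref \ q.cached, markWeight k req y q.recent t (T - t)
      = (if req t ∈ q.cached then 0 else (harmonic (k - q.recent.card) : ℝ))
        + ∑ y ∈ (q.ref \ q.cached).erase (req t),
          markWeight k req y (insert (req t) q.recent) (t + 1) (T - (t + 1)) := by
  obtain ⟨n, rfl⟩ : ∃ n, T = t + 1 + n := Nat.exists_eq_add_of_le ht
  rw [Nat.add_sub_cancel_left, add_assoc, Nat.add_sub_cancel_left, add_comm 1,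
    sum_sdiff_eq_add_sum_erase h.mem_ref, markWeight_self]
  congr 1
  exact Finset.sum_congr rfl fun y hy ↦ markWeight_of_ne k req (Finset.ne_of_mem_erase hy) _ n

lemma Ready.mean_evict_markWeight_le (h : q.Ready k a L N (req t)) (ht : t < T) :
    mean (evict k (req t) q.cached q.recent) (fun X ↦ ((X \ q.cached).card : ℝ)
        + ∑ y ∈ q.ref \ X, markWeight k req y (insert (req t) q.recent) (t + 1) (T - (t + 1)))
      ≤ ∑ y ∈ q.ref \ q.cached, markWeight k req y q.recent t (T - t) := by
  rw [h.sum_markWeight_eq ht]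
  refine mean_evict_le h.card_cached (fun hr hcard ↦ h.cached_sdiff_recent_nonempty hr hcard)
    (fun y ↦ markWeight_nonneg k req y _ _ _) (fun hr ↦ ?_) fun hr hcard ↦ ?_
  · have hone : 1 ≤ k - q.recent.card := Nat.sub_pos_of_lt (h.card_recent_lt hr)
    simpa [harmonic] using harmonic_mono hone
  · exact sum_markWeight_div_card_le k req Finset.sdiff_disjoint (h.card_cached_sdiff_recent hcard)
      (h.cached_sdiff_recent_nonempty hr hcard).card_pos
      (fun hr' ↦ hr (Finset.mem_sdiff.1 hr').1) (fun hr' ↦ hr (h.recent_subset hr')) _ _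

lemma Ready.mean_serve_last_le (h : q.Ready k a L N (req t)) (hlevel : ¬ q.level < L)
    (ht : t < T) :
    mean (evict k (req t) q.cached q.recent) (fun X ↦ ((X \ q.cached).card : ℝ)
        + (q.serve a L (req t) X).lastPotential k req T (t + 1))
      ≤ q.lastPotential k req T t := by
  have hfin := finite_support_evict k (req t) q.cached q.recent
  have hserve (X : Finset Page) : ((X \ q.cached).card : ℝ)
      + (q.serve a L (req t) X).lastPotential k req T (t + 1)
      = ((X \ q.cached).card
          + ∑ y ∈ q.ref \ X, markWeight k req y (insert (req t) q.recent) (t + 1) (T - (t + 1)))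
        + (((harmonic k : ℝ) + 1) * (2 * q.phase.weight - q.phase.clean)
          + 2 * q.phase.weight) := by
    rw [lastPotential, Conf.serve, if_neg hlevel]
    ring
  simp only [hserve]
  rw [mean_add hfin, mean_const hfin, lastPotential]
  linarith [h.mean_evict_markWeight_le ht]

end Last

lemma Opened.mean_finish_le (hk : 0 < k) (ha : 0 < a) (hN : ∀ i < L, 0 < N i)
    (hp : p.Ready k a L N (req t)) (hq : p.Opened a L N (req t) q) (ht : t < T)
    (R : Finset Page) :
    mean (q.finish k a L (req t) R) (fun s' ↦ ((s'.cached \ q.cached).card : ℝ)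
        + s'.potential k a L req T (t + 1)) ≤ q.potential k a L req T t := by
  have h := hq.ready ha hp
  by_cases hadopts : q.Adopts a
  · have hlevel := h.level_lt_of_chosen hadopts.2
    rw [finish, if_pos hadopts, mean_pure, potential, potential, if_pos hlevel,
      if_pos (c := (q.adopt k (req t) R).level < L) hlevel]
    exact h.levelPotential_adopt_le hadopts R
  rw [finish, if_neg hadopts, mean_map (finite_support_evict _ _ _ _)]
  by_cases hlevel : q.level < L
  · have hserve : ∀ X, (q.serve a L (req t) X).level < L := fun _ ↦ hlevel
    simp only [potential, hserve, if_pos hlevel, if_true]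
    exact h.mean_serve_level_le hk hadopts hlevel (hq.elapsed_lt_or_mem_cached ha hN hlevel)
  · have hserve : ∀ X, ¬ (q.serve a L (req t) X).level < L := fun _ ↦ hlevel
    simp only [potential, hserve, if_neg hlevel, if_false]
    exact h.mean_serve_last_le hlevel ht

lemma mean_move_le {Z g : Conf Page → ℝ} {b : ℝ}
    (hfinish : ∀ q, (s.update k L r).Opened a L N r q → mean (q.finish k a L r R) Z ≤ g q)
    (hupdate : ¬ (s.update k L r).StartsPeriod a L N r → g (s.update k L r) ≤ b)
    (hstart : (s.update k L r).StartsPeriod a L N r →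
      ∑ l ∈ Finset.range (N (s.update k L r).level), g ((s.update k L r).startPeriod N l)
        ≤ N (s.update k L r).level * b) :
    mean (s.move k a L N r R) Z ≤ b := by
  unfold move
  split_ifs with hs
  · have hpos : (0 : ℝ) < N (s.update k L r).level := by exact_mod_cast hs.2.2.2
    rw [mean_bind (by rw [PMF.support_uniformOfFinset]; exact Finset.finite_toSet _) fun l _ ↦
      finite_support_finish _ _ _, mean_uniformOfFinset, Finset.card_range,
      div_le_iff₀' hpos]
    exact (Finset.sum_le_sum fun l hl ↦
      hfinish _ (Or.inl ⟨hs, l, Finset.mem_range.1 hl, rfl⟩)).trans (hstart hs)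
  · exact (hfinish _ (Or.inr ⟨hs, rfl⟩)).trans (hupdate hs)

lemma Opened.mean_cost_finish_le (hk : 0 < k) (ha : 0 < a) (hN : ∀ i < L, 0 < N i)
    (h : s.Settled k a L N) (hq : (s.update k L (req t)).Opened a L N (req t) q) (ht : t < T)
    (R : Finset Page) :
    mean (q.finish k a L (req t) R) (fun s' ↦ ((s'.cache k \ s.cache k).card : ℝ)
        + s'.potential k a L req T (t + 1))
      ≤ ((s.update k L (req t)).cached \ s.cached).card + q.potential k a L req T t := by
  have hp := h.update hk (req t)
  have hfin := finite_support_finish (k := k) (a := a) (L := L) q (req t) R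
  refine (mean_mono hfin (Y := fun s' ↦ (((s.update k L (req t)).cached \ s.cached).card : ℝ)
    + (((s'.cached \ q.cached).card : ℝ) + s'.potential k a L req T (t + 1)))
    fun s' hs' ↦ ?_).trans ?_
  · have hcache : s'.cache k = s'.cached :=
      if_pos (mem_and_card_le_of_mem_support_finish hk (hq.ready ha hp).card_cached hs').2
    have hcard : ((s'.cached \ s.cached).card : ℝ)
        ≤ (q.cached \ s.cached).card + (s'.cached \ q.cached).card := by
      have hsub : s'.cached \ s.cached ⊆ (q.cached \ s.cached) ∪ (s'.cached \ q.cached) := by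
        grind
      exact_mod_cast (Finset.card_le_card hsub).trans (Finset.card_union_le _ _)
    rw [hcache, h.cache_eq, ← hq.cached_eq]
    linarith
  · rw [mean_add hfin, mean_const hfin]
    exact add_le_add_right (hq.mean_finish_le hk ha hN hp ht R) _

lemma Settled.mean_move_potential_le (hk : 0 < k) (ha : 0 < a) (hL : 0 < L)
    (hN₀ : ∀ i < L, 0 < N i) (hN : ∀ i < L, N i * a ≤ 2 * k) (hH : (harmonic k : ℝ) ≤ 3 * L)
    (h : s.Settled k a L N) (ht : t < T) (R : Finset Page) :
    mean (s.move k a L N (req t) R) (fun s' ↦ ((s'.cache k \ s.cache k).card : ℝ)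
        + s'.potential k a L req T (t + 1)) ≤ s.potential k a L req T t
      + 170 * ((if s.phase.NewEpoch k (req t) then ((s.phase.next k (req t)).weight : ℝ) else 0)
        + if s.Fails k L (req t) then (s.phase.weight : ℝ) else 0) := by
  have hupdate := h.potential_update_le hN hk hL hH (T := T) (t := t) (req := req)
  refine mean_move_le (fun q hq ↦ hq.mean_cost_finish_le hk ha hN₀ h ht R) (fun _ ↦ hupdate)
    fun hs ↦ ?_
  refine (Finset.sum_le_card_nsmul _ _ _ fun l _ ↦ (add_le_add_right
    ((h.update hk (req t)).potential_startPeriod_le hN hs l) _).trans hupdate).trans_eq ?_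
  rw [Finset.card_range, nsmul_eq_mul]

end Conf

/-! ### The error of the predictions -/

section Lost

variable {Page : Type u} [DecidableEq Page] {k : ℕ}

lemma Predictor.sdiff_report_eq_state (P : Predictor Page k) (t : ℕ) {E : Finset Page}
    (hcard : k ≤ (E \ P.report t E (E.card + 1 - k)).card) :
    E \ P.report t E (E.card + 1 - k) = P.state t := by
  set R := P.report t E (E.card + 1 - k)
  have hsub : R ⊆ E \ P.state t := P.report_subset _ _ _
  have hcardR : R.card = min (E.card + 1 - k) (E \ P.state t).card := P.card_report _ _ _
  have hcardE := Finset.card_sdiff_add_card_eq_card (hsub.trans Finset.sdiff_subset)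
  have hR_eq : R = E \ P.state t := Finset.eq_of_subset_of_card_le hsub (by omega)
  refine Finset.eq_of_subset_of_card_le ?_ ((P.card_state t).trans hcard)
  rw [hR_eq]
  exact sdiff_sdiff_le

lemma Conf.card_inter_sdiff_adopted_le (hk : 0 < k) (P : Predictor Page k) (t : ℕ) {a : ℕ}
    {q : Conf Page} (hasks : q.Asks a) {r : Page} {C : Finset Page} (hr : r ∈ C) :
    (C ∩ (q.ref \ q.adopted k r (q.reply P a r t))).card ≤ (C \ P.state t).card := by
  rw [adopted, reply, if_pos hasks]
  set E := q.ref.erase r with hE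
  set R := P.report t E (E.card + 1 - k) with hR
  rcases le_or_gt (E \ R).card (k - 1) with hcard | hcard
  · have hsub : R ⊆ E \ P.state t := P.report_subset _ _ _
    refine Finset.card_le_card fun y hy ↦ ?_
    rw [trim_eq_self hcard] at hy
    have := @hsub y
    grind
  · have hstate : E \ R = P.state t := P.sdiff_report_eq_state t (by rw [← hR]; omega)
    rw [hstate] at hcard ⊢
    have hr' : r ∉ P.state t := by
      rw [← hstate]
      simp [hE]
    have hsub : C ∩ (q.ref \ insert r (trim (k - 1) (P.state t)))
        ⊆ (C \ P.state t).erase r ∪ P.state t \ trim (k - 1) (P.state t) := by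
      grind
    have herase := Finset.card_erase_add_one (Finset.mem_sdiff.2 ⟨hr, hr'⟩)
    have htrim := Finset.card_sdiff_of_subset (trim_subset (k - 1) (P.state t))
    rw [card_trim, min_eq_left hcard.le] at htrim
    have hcard_le := (Finset.card_le_card hsub).trans (Finset.card_union_le _ _)
    have hstate_card := P.card_state t
    omega

end Lost

namespace Conf

section Pending

variable {Page : Type u} {a : ℕ} {e : ℕ → ℕ} {t : ℕ} {s : Conf Page}

/-- The step of query number `i` of the current period, where `t` is the current step. -/
def queryTime (a t : ℕ) (s : Conf Page) (i : ℕ) : ℕ := t + ((i + 1) * a - s.elapsed) - 1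

/-- The total error of the remaining predictions of the current period, where `e` is the error of
the predictions as a function of time. -/
def upcoming (a : ℕ) (e : ℕ → ℕ) (t : ℕ) (s : Conf Page) : ℝ :=
  ∑ i ∈ Finset.range s.queries, if s.elapsed < (i + 1) * a then (e (s.queryTime a t i) : ℝ) else 0

/-- The error of the prediction that will be adopted in the current period, times the number of
queries, minus the total error of the remaining predictions of the period. -/
def pending (a : ℕ) (e : ℕ → ℕ) (t : ℕ) (s : Conf Page) : ℝ :=
  (s.chosen.elim 0 fun l ↦ (s.queries : ℝ) * e (s.queryTime a t l)) - s.upcoming a e t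

lemma upcoming_eq_zero (a : ℕ) (e : ℕ → ℕ) (t : ℕ) (h : s.queries * a ≤ s.elapsed) :
    s.upcoming a e t = 0 :=
  Finset.sum_eq_zero fun _ hi ↦
    if_neg (not_lt.2 ((Nat.mul_le_mul_right a (Finset.mem_range.1 hi)).trans h))

lemma asks_iff_exists (ha : 0 < a) :
    s.Asks a ↔ ∃ l < s.queries, s.elapsed + 1 = (l + 1) * a := by
  refine ⟨fun ⟨hlt, c, hc⟩ ↦ ?_, fun ⟨l, hl, h⟩ ↦ ⟨?_, l + 1, by rw [h, mul_comm]⟩⟩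
  · obtain ⟨l, rfl⟩ := Nat.exists_eq_succ_of_ne_zero (n := c) (by rintro rfl; omega)
    refine ⟨l, Nat.lt_of_succ_le (Nat.le_of_mul_le_mul_right ?_ ha), by rw [hc, mul_comm]⟩
    rwa [mul_comm, ← hc]
  · have hle : (l + 1) * a ≤ s.queries * a := Nat.mul_le_mul_right a hl
    omega

lemma sum_ite_elapsed_eq (ha : 0 < a) (s : Conf Page) (x : ℝ) :
    ∑ i ∈ Finset.range s.queries, (if s.elapsed + 1 = (i + 1) * a then x else 0)
      = if s.Asks a then x else 0 := by
  by_cases hasks : s.Asks a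
  · obtain ⟨l, hl, h⟩ := (asks_iff_exists ha).1 hasks
    simp only [h, Nat.mul_left_inj ha.ne', Nat.add_right_cancel_iff]
    rw [Finset.sum_ite_eq, if_pos (Finset.mem_range.2 hl), if_pos hasks]
  · rw [if_neg hasks]
    exact Finset.sum_eq_zero fun i hi ↦
      if_neg fun h ↦ hasks ((asks_iff_exists ha).2 ⟨i, Finset.mem_range.1 hi, h⟩)

lemma upcoming_succ (ha : 0 < a) (e : ℕ → ℕ) (t : ℕ) {s s' : Conf Page}
    (hqueries : s'.queries = s.queries) (helapsed : s'.elapsed = s.elapsed + 1) :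
    s.upcoming a e t = s'.upcoming a e (t + 1) + if s.Asks a then (e t : ℝ) else 0 := by
  rw [← sum_ite_elapsed_eq ha, upcoming, upcoming, hqueries, ← Finset.sum_add_distrib]
  refine Finset.sum_congr rfl fun i _ ↦ ?_
  rw [queryTime, queryTime, helapsed]
  rcases lt_trichotomy (s.elapsed + 1) ((i + 1) * a) with h | h | h
  · rw [if_pos (by omega), if_pos h, if_neg h.ne, add_zero]
    congr 2
    omega
  · rw [if_pos (by omega), if_neg h.not_lt, if_pos h, zero_add]
    congr 2
    omega
  · rw [if_neg (by omega), if_neg h.not_gt, if_neg h.ne', add_zero]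

lemma sum_pending_startPeriod (ha : 0 < a) (e : ℕ → ℕ) (t : ℕ) (N : ℕ → ℕ) (s : Conf Page) :
    ∑ l ∈ Finset.range (N s.level), (s.startPeriod N l).pending a e t = 0 := by
  have hpending (l : ℕ) : (s.startPeriod N l).pending a e t
      = (N s.level : ℝ) * e (t + (l + 1) * a - 1)
        - ∑ i ∈ Finset.range (N s.level), (e (t + (i + 1) * a - 1) : ℝ) := by
    simp only [pending, upcoming, queryTime, startPeriod, Option.elim, Nat.sub_zero]
    congr 1
    exact Finset.sum_congr rfl fun i _ ↦ if_pos (Nat.mul_pos i.succ_pos ha)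
  simp only [hpending]
  rw [Finset.sum_sub_distrib, ← Finset.mul_sum, Finset.sum_const, Finset.card_range,
    nsmul_eq_mul, sub_self]

end Pending

variable {Page : Type u} [DecidableEq Page] {k a L : ℕ} {N : ℕ → ℕ} {s q s' : Conf Page} {r : Page}
  {R : Finset Page} {e : ℕ → ℕ} {t : ℕ}

lemma upcoming_of_mem_support_finish (ha : 0 < a) (e : ℕ → ℕ) (t : ℕ)
    (h : s' ∈ (q.finish k a L r R).support) :
    q.upcoming a e t = s'.upcoming a e (t + 1) + if q.Asks a then (e t : ℝ) else 0 := by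
  have hqueries := queries_of_mem_support_finish h
  have helapsed := elapsed_of_mem_support_finish h
  by_cases hlt : q.elapsed < q.queries * a
  · exact upcoming_succ ha e t hqueries (helapsed.trans (if_pos hlt))
  · rw [if_neg hlt] at helapsed
    rw [upcoming_eq_zero a e t (not_lt.1 hlt), upcoming_eq_zero a e (t + 1)
      (by rw [hqueries, helapsed]; exact not_lt.1 hlt), if_neg fun h ↦ hlt h.1, add_zero]

lemma pending_update_le (k a L : ℕ) (e : ℕ → ℕ) (t : ℕ) (s : Conf Page) (r : Page) :
    (s.update k L r).pending a e t ≤ s.pending a e t := by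
  have hchosen : (s.update k L r).chosen = none ∨ (s.update k L r).chosen = s.chosen := by
    unfold update
    split_ifs
    exacts [Or.inl rfl, Or.inl rfl, Or.inr rfl]
  simp only [pending, upcoming, queryTime, queries_update, elapsed_update]
  refine sub_le_sub_right ?_ _
  rcases hchosen with hchosen | hchosen
  · rw [hchosen]
    rcases s.chosen with _ | l
    · exact le_rfl
    · simp only [Option.elim]
      positivity
  · rw [hchosen]

lemma Core.pending_eq_zero (h : s.Core k a L N) (hle : s.queries * a ≤ s.elapsed) (e : ℕ → ℕ)
    (t : ℕ) : s.pending a e t = 0 := by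
  rw [pending, h.chosen_eq_none hle, upcoming_eq_zero a e t hle, Option.elim, sub_zero]

lemma Ready.pending_adopt (h : q.Ready k a L N r) (hadopts : q.Adopts a) (ha : 0 < a)
    (R : Finset Page) (e : ℕ → ℕ) (t : ℕ) :
    (q.adopt k r R).pending a e (t + 1) + N q.level * e t
      = q.pending a e t + if q.Asks a then (e t : ℝ) else 0 := by
  have hmem : q.adopt k r R ∈ (q.finish k a L r R).support := by
    rw [Conf.finish, if_pos hadopts, PMF.mem_support_pure_iff]
  obtain ⟨l, -, hl⟩ := (asks_iff_exists ha).1 hadopts.1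
  have hchosen : q.chosen = some l := by
    rw [hadopts.2, hl, Nat.mul_div_cancel _ ha, Nat.add_sub_cancel]
  have htime : q.queryTime a t l = t := by
    rw [queryTime]
    omega
  have hqueries := h.queries_eq (h.fresh_of_chosen l hchosen)
  have hold : q.pending a e t = N q.level * e t - q.upcoming a e t := by
    rw [pending, hchosen, Option.elim, htime, hqueries]
  have hnew : (q.adopt k r R).pending a e (t + 1) = 0 - (q.adopt k r R).upcoming a e (t + 1) := rfl
  rw [hold, hnew, upcoming_of_mem_support_finish ha e t hmem]
  ring

lemma Ready.pending_serve (h : q.Ready k a L N r) (hadopts : ¬ q.Adopts a) (ha : 0 < a)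
    {X : Finset Page} (hX : X ∈ (evict k r q.cached q.recent).support) (e : ℕ → ℕ) (t : ℕ) :
    (q.serve a L r X).pending a e (t + 1)
      = q.pending a e t + if q.Asks a then (e t : ℝ) else 0 := by
  have hmem : q.serve a L r X ∈ (q.finish k a L r ∅).support := by
    rw [Conf.finish, if_neg hadopts, PMF.mem_support_map_iff]
    exact ⟨X, hX, rfl⟩
  have hchosen : ((q.serve a L r X).chosen.elim 0 fun l ↦
        ((q.serve a L r X).queries : ℝ) * e ((q.serve a L r X).queryTime a (t + 1) l))
      = q.chosen.elim 0 fun l ↦ (q.queries : ℝ) * e (q.queryTime a t l) := by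
    rw [show (q.serve a L r X).chosen = q.chosen from rfl]
    rcases hl : q.chosen with _ | l
    · rfl
    · have hlt := h.elapsed_succ_lt ha hadopts hl
      have hle : (l + 1) * a ≤ q.queries * a := Nat.mul_le_mul_right a (h.chosen_lt l hl)
      have htime : (q.serve a L r X).queryTime a (t + 1) l = q.queryTime a t l := by
        rw [queryTime, queryTime, elapsed_of_mem_support_finish hmem, if_pos (by omega)]
        omega
      rw [Option.elim, Option.elim, htime, queries_of_mem_support_finish hmem]
  rw [pending, pending, hchosen, upcoming_of_mem_support_finish ha e t hmem]
  ring

end Conf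

section Counting

variable {Page : Type u} [DecidableEq Page]

lemma card_inter_sdiff_insert_add_le {B B' : Finset Page} {r : Page} (h : B' ⊆ insert r B)
    (A S : Finset Page) :
    ((B' ∩ insert r A) \ insert r S).card + (if r ∈ S then 0 else 1)
      ≤ ((B ∩ A) \ S).card + (if r ∈ A then 0 else 1) + if r ∈ B then 0 else 1 := by
  have hsub : (B' ∩ insert r A) \ insert r S ⊆ ((B ∩ A) \ S).erase r := fun y hy ↦ by
    have := @h y
    grind
  have hcard := Finset.card_le_card hsub
  by_cases hr : r ∈ (B ∩ A) \ S
  · have := Finset.card_erase_add_one hr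
    grind
  · rw [Finset.erase_eq_of_notMem hr] at hcard
    grind

end Counting

namespace Conf

variable {Page : Type u} [DecidableEq Page] {k a L : ℕ} {N : ℕ → ℕ} {init : Finset Page}
  {req : ℕ → Page} {T : ℕ} {B : ℕ → Finset Page} {s q s' : Conf Page} {r : Page}
  {P : Predictor Page k} {R : Finset Page} {t : ℕ}

/-- The number of requests outside of the reference set, and of pages in Belady's cache that are
not in the reference set, beyond those that are explained by new pages and faults of Belady's
algorithm. -/
noncomputable def excess (k : ℕ) (init : Finset Page) (req : ℕ → Page) (B : ℕ → Finset Page)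
    (t : ℕ) (s : Conf Page) : ℝ :=
  s.misses + ((B t ∩ s.phase.pages) \ s.ref).card - s.phase.clean
    - ((faults req t B : ℝ) - faults req (phaseStart k init req t) B)

/-- The error of the prediction at step `t`, or `0` after the last step. -/
def errorAt (P : Predictor Page k) (B : ℕ → Finset Page) (T t : ℕ) : ℕ :=
  if t < T then (B (t + 1) \ P.state t).card else 0

/-- The excess on the current level, weighted with the number of queries in a period. -/
noncomputable def charge (k L : ℕ) (N : ℕ → ℕ) (init : Finset Page) (req : ℕ → Page)
    (B : ℕ → Finset Page) (t : ℕ) (s : Conf Page) : ℝ :=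
  if s.level < L then N s.level * max (s.excess k init req B t) 0 else 0

lemma charge_nonneg (k L : ℕ) (N : ℕ → ℕ) (init : Finset Page) (req : ℕ → Page)
    (B : ℕ → Finset Page) (t : ℕ) (s : Conf Page) : 0 ≤ s.charge k L N init req B t := by
  unfold charge
  split_ifs
  · exact mul_nonneg (Nat.cast_nonneg _) (le_max_right _ _)
  · exact le_rfl

lemma excess_stay_le (hB : IsBelady k init req T B) (ht : t < T)
    (hphase : s.phase = phaseAt k init req t) (he : ¬ s.phase.NewEpoch k (req t)) :
    (s.stay k (req t)).excess k init req B (t + 1) ≤ s.excess k init req B t := by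
  have hp := PhaseData.not_newPhase he
  have hcount := card_inter_sdiff_insert_add_le (hB.subset_insert ht) s.phase.pages s.ref
  have hnat : ((s.misses + if req t ∈ s.ref then 0 else 1)
      + ((B (t + 1) ∩ insert (req t) s.phase.pages) \ insert (req t) s.ref).card
        + s.phase.clean + faults req t B : ℕ)
      ≤ s.misses + ((B t ∩ s.phase.pages) \ s.ref).card + (s.phase.next k (req t)).clean
        + faults req (t + 1) B := by
    rw [PhaseData.clean_next hp, faults_succ]
    omega
  have hreal := (Nat.cast_le (α := ℝ)).2 hnat
  have hstart : phaseStart k init req (t + 1) = phaseStart k init req t :=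
    phaseStart_succ req (hphase ▸ hp)
  simp only [excess, stay, PhaseData.pages_next hp, hstart]
  push_cast at hreal ⊢
  linarith

lemma weight_le_excess_stay (hk : 0 < k) (hinit : init.card ≤ k) (hB : IsBelady k init req T B)
    (ht : t < T) (hphase : s.phase = phaseAt k init req t) (hf : s.Fails k L (req t)) :
    (s.phase.weight : ℝ) ≤ (s.stay k (req t)).excess k init req B (t + 1) := by
  have hnext : phaseAt k init req (t + 1) = s.phase.next k (req t) := by rw [hphase, phaseAt]
  have hfaults := faults_le_add_clean (t := t + 1) hk hinit hB ht
  have hclean := (describes req hk hinit (t + 1)).valid.clean_lt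
  rw [hnext, PhaseData.next_of_not_newEpoch hf.1] at hfaults hclean
  have hnat : s.phase.weight + (s.phase.next k (req t)).clean + faults req (t + 1) B
      ≤ (s.misses + if req t ∈ s.ref then 0 else 1)
        + faults req (phaseStart k init req (t + 1)) B := by
    have := hf.2.2
    rw [PhaseData.next_of_not_newEpoch hf.1]
    simp only at hclean
    omega
  have hreal := (Nat.cast_le (α := ℝ)).2 hnat
  have : (0 : ℝ) ≤ ((B (t + 1) ∩ (s.phase.next k (req t)).pages)
    \ insert (req t) s.ref).card := Nat.cast_nonneg _
  simp only [excess, stay]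
  push_cast at hreal ⊢
  linarith

lemma charge_eq_zero (N : ℕ → ℕ) (hk : 0 < k) (hinit : init.card ≤ k) (B : ℕ → Finset Page)
    (href : s.ref = s.phase.pages) (hmisses : s.misses = 0) :
    s.charge k L N init req B t = 0 := by
  have hexcess : s.excess k init req B t ≤ 0 := by
    have hfaults : (faults req (phaseStart k init req t) B : ℝ) ≤ faults req t B := by
      exact_mod_cast faults_mono req B (describes req hk hinit t).phaseStart_le
    rw [excess, href, hmisses, Finset.sdiff_eq_empty_iff_subset.2 Finset.inter_subset_right,
      Finset.card_empty, Nat.cast_zero]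
    linarith [s.phase.clean.cast_nonneg (α := ℝ)]
  rw [charge, max_eq_right hexcess, mul_zero, ite_self]

lemma charge_update_le (N : ℕ → ℕ) (hk : 0 < k) (hinit : init.card ≤ k)
    (hB : IsBelady k init req T B) (ht : t < T) (hphase : s.phase = phaseAt k init req t) :
    (s.update k L (req t)).charge k L N init req B (t + 1)
      ≤ s.charge k L N init req B t
        - if s.Fails k L (req t) then (N s.level : ℝ) * s.phase.weight else 0 := by
  by_cases he : s.phase.NewEpoch k (req t)
  · rw [if_neg fun hf ↦ hf.1 he, sub_zero, update_of_newEpoch he,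
      charge_eq_zero N hk hinit B rfl rfl]
    exact charge_nonneg k L N init req B t s
  have hexcess := excess_stay_le hB ht hphase he
  by_cases hf : s.Fails k L (req t)
  · rw [if_pos hf, update_of_fails hf, charge_eq_zero N hk hinit B rfl rfl, sub_nonneg, charge,
      if_pos hf.2.1]
    gcongr
    exact ((weight_le_excess_stay hk hinit hB ht hphase hf).trans hexcess).trans (le_max_left _ _)
  · rw [if_neg hf, sub_zero, update_of_not_fails he hf]
    change (if s.level < L then (N s.level : ℝ) * _ else 0) ≤ if s.level < L then _ else _
    split_ifs
    · gcongr
    · exact le_rfl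

lemma excess_adopt_le (hk : 0 < k) (hB : IsBelady k init req T B) (ht : t < T)
    (hasks : q.Asks a) :
    (q.adopt k (req t) (q.reply P a (req t) t)).excess k init req B (t + 1)
      ≤ q.excess k init req B (t + 1) + errorAt P B T t := by
  have hlost := card_inter_sdiff_adopted_le hk P t hasks (hB.mem_succ ht)
  set A := q.adopted k (req t) (q.reply P a (req t) t) with hA
  have hsub : (B (t + 1) ∩ q.phase.pages) \ A
      ⊆ (B (t + 1) ∩ q.phase.pages) \ q.ref ∪ B (t + 1) ∩ (q.ref \ A) := by
    grind
  have hnat : ((B (t + 1) ∩ q.phase.pages) \ A).card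
      ≤ ((B (t + 1) ∩ q.phase.pages) \ q.ref).card + errorAt P B T t := by
    rw [errorAt, if_pos ht]
    exact (Finset.card_le_card hsub).trans
      ((Finset.card_union_le _ _).trans (Nat.add_le_add_left hlost _))
  have hreal := (Nat.cast_le (α := ℝ)).2 hnat
  simp only [excess, adopt, ← hA]
  push_cast at hreal
  linarith

lemma charge_adopt_le (N : ℕ → ℕ) (hk : 0 < k) (hB : IsBelady k init req T B) (ht : t < T)
    (hasks : q.Asks a) :
    (q.adopt k (req t) (q.reply P a (req t) t)).charge k L N init req B (t + 1)
      ≤ q.charge k L N init req B (t + 1) + N q.level * errorAt P B T t := by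
  have hexcess := excess_adopt_le (P := P) hk hB ht hasks
  have herror : (0 : ℝ) ≤ errorAt P B T t := Nat.cast_nonneg _
  change (if q.level < L then (N q.level : ℝ) * _ else 0) ≤ (if q.level < L then _ else _) + _
  split_ifs
  · rw [← mul_add]
    gcongr
    refine max_le (hexcess.trans ?_) (add_nonneg (le_max_right _ _) herror)
    gcongr
    exact le_max_left _ _
  · positivity

lemma Ready.charge_finish_le (hk : 0 < k) (ha : 0 < a) (h : q.Ready k a L N (req t))
    (hB : IsBelady k init req T B) (ht : t < T)
    (hs' : s' ∈ (q.finish k a L (req t) (q.reply P a (req t) t)).support) :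
    s'.charge k L N init req B (t + 1) + s'.pending a (errorAt P B T) (t + 1)
      ≤ q.charge k L N init req B (t + 1) + q.pending a (errorAt P B T) t
        + if q.Asks a then (errorAt P B T t : ℝ) else 0 := by
  rcases mem_support_finish hs' with ⟨hadopts, rfl⟩ | ⟨hadopts, X, hX, rfl⟩
  · have hcharge := charge_adopt_le (L := L) (P := P) N hk hB ht hadopts.1
    have hpending := h.pending_adopt hadopts ha (q.reply P a (req t) t) (errorAt P B T) t
    linarith
  · rw [h.pending_serve hadopts ha hX, ← add_assoc]
    exact le_rfl

lemma Settled.mean_move_charge_le (hk : 0 < k) (ha : 0 < a) (hinit : init.card ≤ k)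
    (h : s.Settled k a L N) (hB : IsBelady k init req T B) (ht : t < T)
    (hphase : s.phase = phaseAt k init req t)
    (hR : ∀ q, (s.update k L (req t)).Opened a L N (req t) q → R = q.reply P a (req t) t) :
    mean (s.move k a L N (req t) R) (fun s' ↦ s'.charge k L N init req B (t + 1)
        + s'.pending a (errorAt P B T) (t + 1))
      ≤ s.charge k L N init req B t + s.pending a (errorAt P B T) t
        + (if (s.lead k a L N (req t)).Asks a then (errorAt P B T t : ℝ) else 0)
        - if s.Fails k L (req t) then (N s.level : ℝ) * s.phase.weight else 0 := by
  have hp := h.update hk (req t)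
  have hcharge := charge_update_le (L := L) N hk hinit hB ht hphase
  have hpending := pending_update_le k a L (errorAt P B T) t s (req t)
  refine mean_move_le (g := fun q ↦ q.charge k L N init req B (t + 1)
    + (q.pending a (errorAt P B T) t
    + if (s.lead k a L N (req t)).Asks a then (errorAt P B T t : ℝ) else 0)) (fun q hq ↦ ?_)
    (fun _ ↦ by linarith) fun hs ↦ ?_
  · refine mean_le_of_forall_le (finite_support_finish _ _ _) fun s' hs' ↦ ?_
    rw [hR q hq] at hs'
    have := (hq.ready ha hp).charge_finish_le hk ha hB ht hs'
    simp only [hq.asks_iff] at this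
    linarith
  · have hzero := hp.toCore.pending_eq_zero hs.1 (errorAt P B T) t
    have hsame (l : ℕ) : ((s.update k L (req t)).startPeriod N l).charge k L N init req B (t + 1)
      = (s.update k L (req t)).charge k L N init req B (t + 1) := rfl
    simp only [hsame]
    rw [Finset.sum_add_distrib, Finset.sum_add_distrib, sum_pending_startPeriod ha, zero_add,
      Finset.sum_const, Finset.sum_const, Finset.card_range, nsmul_eq_mul, nsmul_eq_mul, ← mul_add]
    gcongr
    linarith

end Conf

/-! ### The balance of cost and error -/

/-- The price `G i` of an epoch on level `i`, per unit of weight: it is at most `S - σ` at the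
start of the epoch, and pays `σ` for each increase of the level, with a subsidy of `c` per query in
a period of the level. -/
structure IsPricing (L : ℕ) (N : ℕ → ℕ) (σ c S : ℝ) (G : ℕ → ℝ) : Prop where
  step_nonneg : 0 ≤ σ
  subsidy_nonneg : 0 ≤ c
  nonneg : ∀ i ≤ L, 0 ≤ G i
  add_zero_le : σ + G 0 ≤ S
  succ_add_le : ∀ i < L, G (i + 1) + σ ≤ G i + c * N i

namespace Conf

variable {Page : Type u} [DecidableEq Page] {k a L : ℕ} {N : ℕ → ℕ} {s s' : Conf Page} {r : Page}

lemma opened_lead (k a L : ℕ) (N : ℕ → ℕ) (s : Conf Page) (r : Page) :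
    (s.update k L r).Opened a L N r (s.lead k a L N r) := by
  unfold lead
  split_ifs with h
  · exact Or.inl ⟨h, 0, h.2.2.2, rfl⟩
  · exact Or.inr ⟨h, rfl⟩

lemma level_of_mem_support_move {R : Finset Page} (h : s' ∈ (s.move k a L N r R).support) :
    s'.level = (s.update k L r).level := by
  obtain ⟨q, hq, hs'⟩ := exists_opened h
  rw [level_of_mem_support_finish hs', hq.level_eq]

lemma phase_of_mem_support_move {R : Finset Page} (h : s' ∈ (s.move k a L N r R).support) :
    s'.phase = s.phase.next k r := by
  obtain ⟨q, hq, hs'⟩ := exists_opened h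
  rw [phase_of_mem_support_finish hs', hq.phase_eq, phase_update]

lemma pending_nonneg (a : ℕ) (P : Predictor Page k) (B : ℕ → Finset Page) (T : ℕ)
    (s : Conf Page) : 0 ≤ s.pending a (errorAt P B T) T := by
  have hzero : s.upcoming a (errorAt P B T) T = 0 := Finset.sum_eq_zero fun i _ ↦ by
    split_ifs with hi
    · rw [errorAt, if_neg (by rw [queryTime]; omega), Nat.cast_zero]
    · rfl
  rw [pending, hzero, sub_zero]
  cases s.chosen with
  | none => exact le_rfl
  | some l => exact mul_nonneg (Nat.cast_nonneg _) (Nat.cast_nonneg _)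

end Conf

lemma IsPricing.update_le {Page : Type u} [DecidableEq Page] (k : ℕ) {L : ℕ} {N : ℕ → ℕ}
    {σ c S : ℝ} {G : ℕ → ℝ} (hG : IsPricing L N σ c S G) {s : Conf Page} (hlevel : s.level ≤ L)
    (r : Page) :
    (s.phase.next k r).weight * G (s.update k L r).level
      + σ * ((if s.phase.NewEpoch k r then ((s.phase.next k r).weight : ℝ) else 0)
        + if s.Fails k L r then (s.phase.weight : ℝ) else 0)
      ≤ s.phase.weight * G s.level
        + S * (if s.phase.NewEpoch k r then ((s.phase.next k r).weight : ℝ) else 0)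
        + c * if s.Fails k L r then (N s.level : ℝ) * s.phase.weight else 0 := by
  have hweight : (0 : ℝ) ≤ s.phase.weight := Nat.cast_nonneg _
  by_cases he : s.phase.NewEpoch k r
  · have hf : ¬ s.Fails k L r := fun hf ↦ hf.1 he
    have hstart := mul_le_mul_of_nonneg_left hG.add_zero_le
      ((s.phase.next k r).weight.cast_nonneg (α := ℝ))
    have hold := mul_nonneg hweight (hG.nonneg _ hlevel)
    rw [Conf.update_of_newEpoch he, if_pos he, if_neg hf, if_neg hf]
    simp only [Conf.startEpoch]
    linarith
  rw [if_neg he, PhaseData.next_of_not_newEpoch he]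
  by_cases hf : s.Fails k L r
  · have hclimb := mul_le_mul_of_nonneg_left (hG.succ_add_le _ hf.2.1) hweight
    rw [Conf.update_of_fails hf, if_pos hf, if_pos hf]
    simp only [Conf.climb]
    linarith
  · rw [Conf.update_of_not_fails he hf, if_neg hf, if_neg hf]
    simp only [Conf.stay, mul_zero, add_zero, le_refl]

section LevelAlgorithm

variable {Page : Type u} [DecidableEq Page] {k a L : ℕ} {N : ℕ → ℕ} (hk : 0 < k)
  {init : Finset Page} (hinit : init.card ≤ k)

lemma totalError_newQueries (P : Predictor Page k) (req : ℕ → Page) (B : ℕ → Finset Page)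
    {T t : ℕ} (ht : t < T) (s : Conf Page) (c : ℕ) (Q : List (Query Page)) :
    (totalError P B ((levelAlgorithm k a L N hk init hinit).newQueries req t ⟨s, c, Q⟩) : ℝ)
      = totalError P B Q
        + if (s.lead k a L N (req t)).Asks a then (Conf.errorAt P B T t : ℝ) else 0 := by
  rw [newQueries_eq hk hinit req t (Conf.opened_lead k a L N s (req t))]
  split_ifs
  · rw [Conf.errorAt, if_pos ht, totalError, totalError, List.map_cons, List.sum_cons, add_comm,
      Nat.cast_add]
    rfl
  · rw [add_zero]

/-- The quantity that drops in expectation in each step. It is `σ` times the cost, minus the bound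
of `mul_mean_cost_le` on it, plus potentials that are nonnegative at the end of the run. -/
noncomputable def balance (P : Predictor Page k) (req : ℕ → Page) (T : ℕ) (B : ℕ → Finset Page)
    (σ c S : ℝ) (G : ℕ → ℝ) (t : ℕ) (o : (levelAlgorithm k a L N hk init hinit).Outcome) : ℝ :=
  σ * (o.cost + Conf.potential k a L req T t o.state)
    + 170 * ((Conf.phase o.state).weight * G (Conf.level o.state)
      + c * (Conf.charge k L N init req B t o.state
        + Conf.pending a (Conf.errorAt P B T) t o.state - totalError P B o.queries)
      - S * totalWeight k init req t)

variable {P : Predictor Page k} {req : ℕ → Page} {T t : ℕ} {B : ℕ → Finset Page} {σ c S : ℝ}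
  {G : ℕ → ℝ}

lemma balance_start (hL : 0 < L) :
    balance hk hinit P req T B σ c S G 0 ⟨(levelAlgorithm k a L N hk init hinit).start, 0, []⟩
      = 0 := by
  have hcharge : Conf.charge k L N init req B 0 (levelAlgorithm k a L N hk init hinit).start = 0 :=
    Conf.charge_eq_zero N hk hinit B (by simp [levelAlgorithm, PhaseData.pages]) rfl
  rw [balance, hcharge]
  simp [levelAlgorithm, Conf.potential, Conf.levelPotential, Conf.pending, Conf.upcoming,
    Conf.missing, totalError, totalWeight, hL]

lemma IsPricing.le_balance (hG : IsPricing L N σ c S G)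
    {o : (levelAlgorithm k a L N hk init hinit).Outcome} (h : Conf.Settled k a L N o.state) :
    σ * o.cost + -(170 * (S * totalWeight k init req T + c * totalError P B o.queries))
      ≤ balance hk hinit P req T B σ c S G T o := by
  have hpotential := mul_nonneg hG.step_nonneg (h.potential_nonneg req T T)
  have hlevel := mul_nonneg (Nat.cast_nonneg (α := ℝ) (Conf.phase o.state).weight)
    (hG.nonneg _ h.level_le)
  have hcharge := mul_nonneg hG.subsidy_nonneg (add_nonneg
    (Conf.charge_nonneg k L N init req B T o.state) (Conf.pending_nonneg a P B T o.state))
  unfold balance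
  linarith

lemma balance_of_mem_support_move {s s' : Conf Page} {R : Finset Page}
    (hs' : s' ∈ (s.move k a L N (req t) R).support) (C : ℕ) (Q : List (Query Page)) :
    balance hk hinit (a := a) (L := L) (N := N) P req T B σ c S G (t + 1)
        ⟨s', C + (s'.cache k \ s.cache k).card, Q⟩
      = σ * ((s'.cache k \ s.cache k).card + s'.potential k a L req T (t + 1))
        + (170 * c * (s'.charge k L N init req B (t + 1)
          + s'.pending a (Conf.errorAt P B T) (t + 1))
        + (σ * C + 170 * ((s.phase.next k (req t)).weight * G (s.update k L (req t)).level
          - c * totalError P B Q - S * totalWeight k init req (t + 1)))) := by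
  simp only [balance, Conf.level_of_mem_support_move hs', Conf.phase_of_mem_support_move hs']
  push_cast
  ring

lemma IsPricing.mean_balance_le (ha : 0 < a) (hL : 0 < L) (hN₀ : ∀ i < L, 0 < N i)
    (hN : ∀ i < L, N i * a ≤ 2 * k) (hH : (harmonic k : ℝ) ≤ 3 * L) (hG : IsPricing L N σ c S G)
    (hB : IsBelady k init req T B) (ht : t < T)
    {o : (levelAlgorithm k a L N hk init hinit).Outcome} (h : Conf.Settled k a L N o.state)
    (hphase : Conf.phase o.state = phaseAt k init req t) :
    mean ((levelAlgorithm k a L N hk init hinit).step P req t o)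
        (balance hk hinit P req T B σ c S G (t + 1))
      ≤ balance hk hinit P req T B σ c S G t o := by
  obtain ⟨(s : Conf Page), C, Q⟩ := o
  change s.Settled k a L N at h
  change s.phase = _ at hphase
  rw [(finitelyBranching_levelAlgorithm hk hinit).mean_step]
  set R := (levelAlgorithm k a L N hk init hinit).answer P req t s
  have hfin : (s.move k a L N (req t) R).support.Finite := Conf.finite_support_move s (req t) R
  have hpotential := mul_le_mul_of_nonneg_left
    (h.mean_move_potential_le (req := req) hk ha hL hN₀ hN hH ht R) hG.step_nonneg
  have hcharge := mul_le_mul_of_nonneg_left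
    (h.mean_move_charge_le hk ha hinit hB ht hphase fun q hq ↦ answer_eq hk hinit P req t hq)
    hG.subsidy_nonneg
  have hprice := hG.update_le k h.level_le (req t)
  have herror := totalError_newQueries (a := a) (L := L) (N := N) hk hinit P req B ht s C Q
  have hweight : (totalWeight k init req (t + 1) : ℝ) = totalWeight k init req t
      + if s.phase.NewEpoch k (req t) then ((s.phase.next k (req t)).weight : ℝ) else 0 := by
    rw [hphase, totalWeight, phaseAt]
    push_cast
    rfl
  refine (mean_mono hfin fun s' hs' ↦
    (balance_of_mem_support_move hk hinit hs' C _).le).trans ?_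
  rw [mean_add hfin, mean_add hfin, mean_const hfin, mean_const_mul hfin, mean_const_mul hfin,
    hweight, herror]
  simp only [balance]
  linarith

lemma IsPricing.mul_mean_cost_le (ha : 0 < a) (hL : 0 < L) (hN₀ : ∀ i < L, 0 < N i)
    (hN : ∀ i < L, N i * a ≤ 2 * k) (hH : (harmonic k : ℝ) ≤ 3 * L) (hG : IsPricing L N σ c S G)
    (P : Predictor Page k) (hB : IsBelady k init req T B) :
    σ * mean ((levelAlgorithm k a L N hk init hinit).run P req T) (fun o ↦ (o.cost : ℝ))
      ≤ 170 * (S * totalWeight k init req T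
        + c * mean ((levelAlgorithm k a L N hk init hinit).run P req T)
          fun o ↦ (totalError P B o.queries : ℝ)) := by
  have hA := finitelyBranching_levelAlgorithm hk hinit (a := a) (L := L) (N := N)
  have hdrop := hA.mean_run_le_of_mean_step_le P req (balance hk hinit P req T B σ c S G) T
    fun t ht o ho ↦ by
      obtain ⟨hsettled, hphase⟩ := settled_of_mem_run hk hinit ha P req t o ho
      exact hG.mean_balance_le hk hinit ha hL hN₀ hN hH hB ht hsettled hphase
  have hlower := mean_mono (hA.run P req T) fun o ho ↦
    hG.le_balance (P := P) (req := req) (T := T) (B := B) hk hinit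
      (settled_of_mem_run hk hinit ha P req T o ho).1
  rw [balance_start hk hinit hL] at hdrop
  have hbound := hlower.trans hdrop
  simp only [mul_add, neg_add, ← mul_assoc, ← neg_mul] at hbound
  rw [mean_add (hA.run P req T), mean_add (hA.run P req T), mean_const (hA.run P req T),
    mean_const_mul (hA.run P req T), mean_const_mul (hA.run P req T)] at hbound
  linarith

end LevelAlgorithm

/-! ### The parameters -/

/-- The functions that can be prescribed as the number of queries in terms of the competitive
ratio. -/
structure IsRateFunction (f : ℝ → ℝ) : Prop where
  convexOn : ConvexOn ℝ (Set.Ici 0) f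
  map_zero : f 0 = 0
  one_le_map_one : 1 ≤ f 1

/-- The increment of `f` between `i` and `i + 1`. -/
def increment (f : ℝ → ℝ) (i : ℕ) : ℝ := f (i + 1) - f i

/-- The number of queries in a period on level `i`. -/
noncomputable def periodLength (f : ℝ → ℝ) (a i : ℕ) : ℕ := ⌈increment f i / a⌉₊

section Rate

variable {f : ℝ → ℝ} {a : ℕ}

lemma map_succ_eq_add_increment (f : ℝ → ℝ) (i : ℕ) :
    f ((i + 1 : ℕ) : ℝ) = f i + increment f i := by
  rw [increment, Nat.cast_add_one, add_sub_cancel]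

lemma increment_mono (hf : ConvexOn ℝ (Set.Ici 0) f) : Monotone (increment f) := by
  refine monotone_nat_of_le_succ fun i ↦ ?_
  have hi : (0 : ℝ) ≤ i := Nat.cast_nonneg i
  have hslope := hf.slope_mono_adjacent (x := i) (y := i + 1) (z := i + 1 + 1) hi
    (Set.mem_Ici.2 (by linarith)) (by linarith) (by linarith)
  simpa only [increment, Nat.cast_add_one, add_sub_cancel_left, div_one] using hslope

lemma add_increment_mul_le (hf : ConvexOn ℝ (Set.Ici 0) f) (i j : ℕ) :
    f j + increment f j * ((i : ℝ) - j) ≤ f i := by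
  rcases le_total j i with h | h
  · induction i, h using Nat.le_induction with
    | base => simp only [sub_self, mul_zero, add_zero, le_refl]
    | succ m hm ih =>
      have := increment_mono hf hm
      rw [map_succ_eq_add_increment f, Nat.cast_add_one]
      linarith
  · induction j, h using Nat.le_induction with
    | base => simp only [sub_self, mul_zero, add_zero, le_refl]
    | succ m hm ih =>
      have hdist : (0 : ℝ) ≤ (m : ℝ) + 1 - i := by
        have : (i : ℝ) ≤ m := by exact_mod_cast hm
        linarith
      have := mul_le_mul_of_nonneg_right (increment_mono hf m.le_succ) hdist
      rw [map_succ_eq_add_increment f, Nat.cast_add_one]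
      linarith

namespace IsRateFunction

lemma one_le_increment (hf : IsRateFunction f) (i : ℕ) : 1 ≤ increment f i := by
  refine le_trans ?_ (increment_mono hf.convexOn (Nat.zero_le i))
  simpa [increment, hf.map_zero] using hf.one_le_map_one

lemma natCast_le (hf : IsRateFunction f) (i : ℕ) : (i : ℝ) ≤ f i := by
  have hsecant := add_increment_mul_le hf.convexOn i 0
  have := mul_le_mul_of_nonneg_right (hf.one_le_increment 0) (Nat.cast_nonneg (α := ℝ) i)
  rw [Nat.cast_zero, hf.map_zero] at hsecant
  linarith

lemma map_le_map (hf : IsRateFunction f) {x y : ℝ} (hx : 0 ≤ x) (hxy : x ≤ y) (hy : 1 ≤ y) :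
    f x ≤ f y := by
  have hy₀ : y ∈ Set.Ici (0 : ℝ) := zero_le_one.trans hy
  have h01 : f 0 ≤ f 1 := hf.map_zero.trans_le (zero_le_one.trans hf.one_le_map_one)
  have h1y : f 1 ≤ f y :=
    hf.convexOn.le_right_of_left_le'' Set.self_mem_Ici hy₀ zero_lt_one hy h01
  exact (hf.convexOn.le_max_of_mem_Icc Set.self_mem_Ici hy₀ ⟨hx, hxy⟩).trans
    (max_le (h01.trans h1y) le_rfl)

lemma map_log_le_map_logb (hf : IsRateFunction f) {k : ℕ} (hk : 2 ≤ k) :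
    f (Nat.log 2 k : ℕ) ≤ f (Real.logb 2 k) := by
  have hlog : (Nat.log 2 k : ℝ) ≤ Real.logb 2 k := by exact_mod_cast Real.natLog_le_logb k 2
  have hone : (1 : ℝ) ≤ Nat.log 2 k := by exact_mod_cast Nat.log_pos one_lt_two hk
  exact hf.map_le_map (Nat.cast_nonneg _) hlog (hone.trans hlog)

lemma surjOn (hf : IsRateFunction f) : Set.SurjOn f (Set.Ici 0) (Set.Ici 0) := by
  intro y hy
  rcases (Set.mem_Ici.1 hy).eq_or_lt with rfl | hy
  · exact ⟨0, Set.self_mem_Ici, hf.map_zero⟩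
  have hpos : 0 < f 1 := zero_lt_one.trans_le hf.one_le_map_one
  -- A convex function can be discontinuous at `0`: the intermediate value theorem starts at `x₀`.
  obtain ⟨x₀, hx₀, hx₀_le, hfx₀⟩ : ∃ x₀ : ℝ, 0 < x₀ ∧ x₀ ≤ 1 ∧ f x₀ ≤ y := by
    refine ⟨min 1 (y / f 1), lt_min one_pos (div_pos hy hpos), min_le_left _ _, ?_⟩
    set x₀ := min 1 (y / f 1)
    have hconv := hf.convexOn.2 Set.self_mem_Ici (Set.mem_Ici.2 zero_le_one)
      (sub_nonneg.2 (min_le_left _ _ : x₀ ≤ 1)) (lt_min one_pos (div_pos hy hpos)).le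
      (sub_add_cancel _ _)
    simp only [smul_eq_mul, mul_zero, mul_one, zero_add, hf.map_zero] at hconv
    exact hconv.trans ((le_div_iff₀ hpos).1 (min_le_right _ _))
  set n := ⌈y⌉₊ + 1
  have hyn : y ≤ f n := by
    refine le_trans ?_ (hf.natCast_le n)
    push_cast [n]
    linarith [Nat.le_ceil y]
  have hx₀n : x₀ ≤ n := hx₀_le.trans (by exact_mod_cast Nat.le_add_left 1 _)
  have hcont : ContinuousOn f (Set.Icc x₀ n) := by
    have hinterior := hf.convexOn.continuousOn_interior
    rw [interior_Ici] at hinterior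
    exact hinterior.mono fun x hx ↦ hx₀.trans_le hx.1
  obtain ⟨x, hx, hxy⟩ := intermediate_value_Icc hx₀n hcont ⟨hfx₀, hyn⟩
  exact ⟨x, hx₀.le.trans hx.1, hxy⟩

lemma sum_increment (hf : IsRateFunction f) (n : ℕ) :
    ∑ i ∈ Finset.range n, increment f i = f n := by
  have htelescope := Finset.sum_range_sub (fun i : ℕ ↦ f i) n
  simpa only [increment, Nat.cast_zero, hf.map_zero, sub_zero, Nat.cast_add_one] using htelescope

lemma periodLength_pos (hf : IsRateFunction f) (ha : 0 < a) (i : ℕ) : 0 < periodLength f a i :=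
  Nat.ceil_pos.2 (div_pos (zero_lt_one.trans_le (hf.one_le_increment i)) (Nat.cast_pos.2 ha))

lemma periodLength_lt (hf : IsRateFunction f) (a i : ℕ) :
    (periodLength f a i : ℝ) < increment f i / a + 1 :=
  Nat.ceil_lt_add_one
    (div_nonneg (zero_le_one.trans (hf.one_le_increment i)) (Nat.cast_nonneg a))

lemma sum_periodLength_le (hf : IsRateFunction f) (ha : 0 < a) (n : ℕ) :
    ((∑ i ∈ Finset.range n, periodLength f a i : ℕ) : ℝ) ≤ 2 * f n := by
  rw [← hf.sum_increment n, Finset.mul_sum, Nat.cast_sum]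
  refine Finset.sum_le_sum fun i _ ↦ ?_
  have hone := hf.one_le_increment i
  have hlt := hf.periodLength_lt a i
  have hdiv : increment f i / a ≤ increment f i :=
    div_le_self (by linarith) (by exact_mod_cast ha)
  linarith

lemma periodLength_mul_le (hf : IsRateFunction f) (hpow : ∀ i : ℕ, f i ≤ 2 ^ i - 1) {k : ℕ}
    (ha : 0 < a) (hak : a ≤ k) {i : ℕ} (hi : i < Nat.log 2 k) :
    periodLength f a i * a ≤ 2 * k := by
  have hincrement : increment f i ≤ k := by
    have hle : f (i + 1) ≤ f (Nat.log 2 k : ℕ) :=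
      hf.map_le_map (by positivity) (by exact_mod_cast hi)
        (by exact_mod_cast (Nat.zero_le i).trans_lt hi)
    have hlog : (2 : ℝ) ^ Nat.log 2 k ≤ k := by
      exact_mod_cast Nat.pow_log_le_self 2 (ha.trans_le hak).ne'
    have hnonneg := (Nat.cast_nonneg i).trans (hf.natCast_le i)
    rw [increment]
    linarith [hpow (Nat.log 2 k)]
  have hlength := mul_le_mul_of_nonneg_right (hf.periodLength_lt a i).le
    (Nat.cast_nonneg (α := ℝ) a)
  rw [add_mul, one_mul, div_mul_cancel₀ _ (Nat.cast_ne_zero.2 ha.ne')] at hlength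
  have hak' : (a : ℝ) ≤ k := Nat.cast_le.2 hak
  exact_mod_cast (by linarith : (periodLength f a i : ℝ) * a ≤ 2 * k)

end IsRateFunction

lemma increment_le_mul_periodLength (f : ℝ → ℝ) (ha : 0 < a) (i : ℕ) :
    increment f i ≤ a * periodLength f a i :=
  (div_le_iff₀' (Nat.cast_pos.2 ha)).1 (Nat.le_ceil _)

end Rate

/-! ### The guarantees -/

lemma isPricing_sub (L : ℕ) (N : ℕ → ℕ) : IsPricing L N 1 0 (1 + L) fun i ↦ (L : ℝ) - i where
  step_nonneg := zero_le_one
  subsidy_nonneg := le_rfl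
  nonneg i hi := sub_nonneg.2 (Nat.cast_le.2 hi)
  add_zero_le := by simp
  succ_add_le i _ := by
    push_cast
    linarith

-- The price is the gap between `f` and its secant line through `j` and `j + 1`.
lemma IsRateFunction.isPricing {f : ℝ → ℝ} (hf : IsRateFunction f) {a : ℕ} (ha : 0 < a)
    (L j : ℕ) :
    IsPricing L (periodLength f a) (increment f j) a (increment f j * (1 + j) - f j) fun i ↦
      f i - (f j + increment f j * ((i : ℝ) - j)) where
  step_nonneg := zero_le_one.trans (hf.one_le_increment j)
  subsidy_nonneg := Nat.cast_nonneg a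
  nonneg i _ := sub_nonneg.2 (add_increment_mul_le hf.convexOn i j)
  add_zero_le := by
    rw [Nat.cast_zero, hf.map_zero]
    linarith
  succ_add_le i _ := by
    have := increment_le_mul_periodLength f ha i
    rw [map_succ_eq_add_increment f, Nat.cast_add_one]
    linarith

section PredictionAlgorithm

variable {Page : Type u} [DecidableEq Page] {f : ℝ → ℝ} {k a : ℕ} {init : Finset Page}

/-- The level algorithm for the rate function `f`, with about `log₂ k` levels and one query per `a`
units of the increment of `f` on the level. -/
noncomputable def predictionAlgorithm (f : ℝ → ℝ) (a : ℕ) (hk : 2 ≤ k) (hinit : init.card ≤ k) :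
    OnlineAlgorithm Page k init :=
  levelAlgorithm k a (Nat.log 2 k) (periodLength f a) (zero_lt_two.trans_le hk) init hinit

lemma finitelyBranching_predictionAlgorithm (f : ℝ → ℝ) (a : ℕ) (hk : 2 ≤ k)
    (hinit : init.card ≤ k) : (predictionAlgorithm f a hk hinit).FinitelyBranching :=
  finitelyBranching_levelAlgorithm _ hinit

lemma usesPredictions_predictionAlgorithm (hf : IsRateFunction f) (ha : 0 < a) (hk : 2 ≤ k)
    (hinit : init.card ≤ k) :
    (predictionAlgorithm f a hk hinit).UsesPredictions (352 * f (Real.logb 2 k)) := by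
  intro P req T B hB o ho
  have hk₀ := zero_lt_two.trans_le hk
  set n := ∑ i ∈ Finset.range (Nat.log 2 k), periodLength f a i
  have hqueries : (o.queries.map fun q ↦ q.number).sum + o.queries.length
      ≤ 44 * n * totalWeight k init req T := by
    have := queries_le hk₀ hinit ha P req T o ho
    simpa [List.sum_map_add] using this
  have hn : (n : ℝ) ≤ 2 * f (Real.logb 2 k) := by
    have := hf.map_log_le_map_logb hk
    have := hf.sum_periodLength_le ha (Nat.log 2 k)
    linarith
  have hfaults : ((n * totalWeight k init req T : ℕ) : ℝ)
      ≤ 2 * f (Real.logb 2 k) * (4 * faults req T B) := by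
    rw [Nat.cast_mul]
    exact mul_le_mul hn (by exact_mod_cast totalWeight_le hk₀ hinit hB le_rfl)
      (Nat.cast_nonneg _) ((Nat.cast_nonneg n).trans hn)
  have htotal : (((o.queries.map fun q ↦ q.number).sum + o.queries.length : ℕ) : ℝ)
      ≤ 352 * f (Real.logb 2 k) * faults req T B := by
    have : (((o.queries.map fun q ↦ q.number).sum + o.queries.length : ℕ) : ℝ)
        ≤ 44 * (n * totalWeight k init req T : ℕ) := by
      exact_mod_cast hqueries.trans_eq (mul_assoc _ _ _)
    linarith
  exact ⟨(Nat.cast_le.2 (Nat.le_add_left _ _)).trans htotal,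
    (Nat.cast_le.2 (Nat.le_add_right _ _)).trans htotal⟩

section Cost

variable (hf : IsRateFunction f) (hpow : ∀ i : ℕ, f i ≤ 2 ^ i - 1) (ha : 0 < a) (hak : a ≤ k)
  (hk : 2 ≤ k) (hinit : init.card ≤ k) {P : Predictor Page k} {req : ℕ → Page} {T : ℕ}
  {B : ℕ → Finset Page}

include hf hpow ha hak

lemma IsPricing.mul_mean_cost_predictionAlgorithm_le {σ c S : ℝ} {G : ℕ → ℝ}
    (hG : IsPricing (Nat.log 2 k) (periodLength f a) σ c S G) (P : Predictor Page k)
    (hB : IsBelady k init req T B) :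
    σ * mean ((predictionAlgorithm f a hk hinit).run P req T) (fun o ↦ (o.cost : ℝ))
      ≤ 680 * S * faults req T B
        + 170 * (c * ((predictionAlgorithm f a hk hinit).expectedError P req T B).toReal) := by
  have hk₀ := zero_lt_two.trans_le hk
  have hcost := hG.mul_mean_cost_le hk₀ hinit ha (Nat.log_pos one_lt_two hk)
    (fun i _ ↦ hf.periodLength_pos ha i) (fun i hi ↦ hf.periodLength_mul_le hpow ha hak hi)
    (harmonic_le_three_mul_log hk) P hB
  have hS : 0 ≤ S :=
    (add_nonneg hG.step_nonneg (hG.nonneg 0 (Nat.zero_le _))).trans hG.add_zero_le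
  have hweight : (totalWeight k init req T : ℝ) ≤ 4 * faults req T B := by
    exact_mod_cast totalWeight_le hk₀ hinit hB le_rfl
  have := mul_le_mul_of_nonneg_left hweight hS
  rw [(finitelyBranching_predictionAlgorithm f a hk hinit).toReal_expectedError]
  refine hcost.trans ?_
  unfold predictionAlgorithm
  linarith

lemma mean_cost_le_logb (P : Predictor Page k) (hB : IsBelady k init req T B) :
    mean ((predictionAlgorithm f a hk hinit).run P req T) (fun o ↦ (o.cost : ℝ))
      ≤ 1360 * Real.logb 2 k * faults req T B := by
  have hcost := (isPricing_sub _ _).mul_mean_cost_predictionAlgorithm_le hf hpow ha hak hk hinit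
    P hB
  rw [one_mul, zero_mul, mul_zero, add_zero] at hcost
  have hlog : (Nat.log 2 k : ℝ) ≤ Real.logb 2 k := by exact_mod_cast Real.natLog_le_logb k 2
  have hone : (1 : ℝ) ≤ Nat.log 2 k := by exact_mod_cast Nat.log_pos one_lt_two hk
  exact hcost.trans (mul_le_mul_of_nonneg_right (by linarith) (Nat.cast_nonneg _))

lemma mean_cost_le_of_perfect (hB : IsBelady k init req T B)
    (hP : ∀ t < T, P.state t = B (t + 1)) :
    mean ((predictionAlgorithm f a hk hinit).run P req T) (fun o ↦ (o.cost : ℝ))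
      ≤ 680 * faults req T B := by
  have hcost := (hf.isPricing ha _ 0).mul_mean_cost_predictionAlgorithm_le hf hpow ha hak hk hinit
    P hB
  rw [OnlineAlgorithm.expectedError_eq_zero _ hP, Nat.cast_zero, hf.map_zero] at hcost
  refine le_of_mul_le_mul_left ?_ (zero_lt_one.trans_le (hf.one_le_increment 0))
  refine hcost.trans_eq ?_
  simp only [ENNReal.toReal_zero]
  ring

-- The price at `j = ⌊ζ⌋₊` balances both terms, since then `f ζ ≤ f (j + 1)`.
lemma mean_cost_le_of_map_eq (hB : IsBelady k init req T B) {ζ : ℝ} (hζ : 0 ≤ ζ)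
    (herror : f ζ
      = a * ((predictionAlgorithm f a hk hinit).expectedError P req T B).toReal / faults req T B) :
    mean ((predictionAlgorithm f a hk hinit).run P req T) (fun o ↦ (o.cost : ℝ))
      ≤ 850 * (1 + ζ) * faults req T B := by
  rcases (faults req T B).eq_zero_or_pos with hzero | hpos
  · simpa only [hzero, Nat.cast_zero, mul_zero] using
      mean_cost_le_logb hf hpow ha hak hk hinit P hB
  set F := faults req T B
  have hF : (0 : ℝ) < F := Nat.cast_pos.2 hpos
  set j := ⌊ζ⌋₊
  set δ := increment f j
  have hδ : 0 < δ := zero_lt_one.trans_le (hf.one_le_increment j)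
  have hcost := (hf.isPricing ha _ j).mul_mean_cost_predictionAlgorithm_le hf hpow ha hak hk hinit
    P hB
  rw [← (eq_div_iff hF.ne').1 herror] at hcost
  have hnext : f ζ ≤ f j + δ := by
    rw [← map_succ_eq_add_increment f, Nat.cast_add_one]
    exact hf.map_le_map hζ (Nat.lt_floor_add_one ζ).le (le_add_of_nonneg_left (Nat.cast_nonneg j))
  have hprice : 680 * (δ * (1 + j) - f j) + 170 * f ζ ≤ 850 * (δ * (1 + j)) := by
    have := (Nat.cast_nonneg j).trans (hf.natCast_le j)
    have := mul_nonneg hδ.le (Nat.cast_nonneg (α := ℝ) j)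
    linarith
  refine le_of_mul_le_mul_left (a := δ) ?_ hδ
  calc
    _ ≤ 680 * (δ * (1 + j) - f j) * F + 170 * (f ζ * F) := hcost
    _ = (680 * (δ * (1 + j) - f j) + 170 * f ζ) * F := by ring
    _ ≤ 850 * (δ * (1 + j)) * F := mul_le_mul_of_nonneg_right hprice hF.le
    _ ≤ 850 * (δ * (1 + ζ)) * F := by
      gcongr
      exact Nat.floor_le hζ
    _ = δ * (850 * (1 + ζ) * F) := by ring

lemma isRobust_predictionAlgorithm :
    (predictionAlgorithm f a hk hinit).IsRobust (1360 * Real.logb 2 k) 0 := fun P req T B hB ↦ by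
  rw [(finitelyBranching_predictionAlgorithm f a hk hinit).expectedCost_eq, add_zero]
  exact ENNReal.ofReal_le_ofReal (mean_cost_le_logb hf hpow ha hak hk hinit P hB)

lemma isConsistent_predictionAlgorithm :
    (predictionAlgorithm f a hk hinit).IsConsistent 680 0 := fun P req T B hB hP ↦ by
  rw [(finitelyBranching_predictionAlgorithm f a hk hinit).expectedCost_eq, add_zero]
  exact ENNReal.ofReal_le_ofReal (mean_cost_le_of_perfect hf hpow ha hak hk hinit hB hP)

lemma isSmooth_predictionAlgorithm {g : ℝ → ℝ} (hg : Set.MapsTo g (Set.Ici 0) (Set.Ici 0))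
    (hfg : Set.RightInvOn g f (Set.Ici 0)) :
    (predictionAlgorithm f a hk hinit).IsSmooth (fun η OPT ↦ 850 * (1 + g (a * η / OPT))) 0 := by
  intro P req T B hB
  rw [(finitelyBranching_predictionAlgorithm f a hk hinit).expectedCost_eq, add_zero]
  have hnonneg : a * ((predictionAlgorithm f a hk hinit).expectedError P req T B).toReal
      / faults req T B ∈ Set.Ici (0 : ℝ) := Set.mem_Ici.2 (by positivity)
  exact ENNReal.ofReal_le_ofReal
    (mean_cost_le_of_map_eq hf hpow ha hak hk hinit hB (hg hnonneg) (hfg hnonneg))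

end Cost

end PredictionAlgorithm

end Caching

open Caching in
theorem theorem4_general :
    ∃ C : ℝ, 0 < C ∧
      ∀ (k a : ℕ), 2 ≤ k → 1 ≤ a → a ≤ k →
      ∀ f : ℝ → ℝ, IsRateFunction f → (∀ i : ℕ, f i ≤ 2 ^ i - 1) →
      ∀ (Page : Type u) [DecidableEq Page] (init : Finset Page), init.card ≤ k →
      ∃ A : OnlineAlgorithm Page k init,
        A.WellSeparated a ∧
        A.AsksAboutKnownPages ∧
        A.UsesPredictions (C * f (Real.logb 2 k)) ∧
        A.IsConsistent C 0 ∧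
        A.IsRobust (C * Real.logb 2 k) 0 ∧
        ∀ g : ℝ → ℝ, Set.MapsTo g (Set.Ici 0) (Set.Ici 0) → Set.RightInvOn g f (Set.Ici 0) →
          A.IsSmooth (fun η OPT ↦ C * (1 + g (a * η / OPT))) 0 := by
  refine ⟨1360, by norm_num, fun k a hk ha hak f hf hpow Page _ init hinit ↦
    ⟨predictionAlgorithm f a hk hinit, wellSeparated_levelAlgorithm _ hinit ha,
      asksAboutKnownPages_levelAlgorithm _ hinit ha,
      (usesPredictions_predictionAlgorithm hf ha hk hinit).mono ?_,
      (isConsistent_predictionAlgorithm hf hpow ha hak hk hinit).mono (by norm_num),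
      isRobust_predictionAlgorithm hf hpow ha hak hk hinit, fun g hg hfg ↦
      (isSmooth_predictionAlgorithm hf hpow ha hak hk hinit hg hfg).mono fun η x hη hx ↦ ?_⟩⟩
  · have : 0 ≤ f (Real.logb 2 k) :=
      (Nat.cast_nonneg _).trans ((hf.natCast_le _).trans (hf.map_log_le_map_logb hk))
    linarith
  · have : 0 ≤ g (a * η / x) := hg (Set.mem_Ici.2 (by positivity))
    linarith

theorem theorem4 :
    ∃ C : ℝ, 0 < C ∧
      ∀ (k a : ℕ), 2 ≤ k → 1 ≤ a → a ≤ k →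
      ∀ f : ℝ → ℝ, StrictMonoOn f (Set.Ici 0) → ConvexOn ℝ (Set.Ici 0) f → f 0 = 0 →
        (∀ i : ℕ, f i ≤ 2 ^ i - 1) → 1 ≤ f 1 →
      ∃ α : ℝ, ∀ (Page : Type u) [DecidableEq Page] (init : Finset Page), init.card ≤ k →
      ∃ A : Caching.OnlineAlgorithm Page k init,
        A.WellSeparated a ∧
        A.AsksAboutKnownPages ∧
        A.UsesPredictions (C * f (Real.logb 2 k)) ∧
        A.IsConsistent C α ∧
        A.IsRobust (C * Real.logb 2 k) α ∧
        A.IsSmooth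
          (fun η OPT => C * (1 + Function.invFunOn f (Set.Ici 0) (a * η / OPT))) α := by
  obtain ⟨C, hC, hmain⟩ := theorem4_general
  refine ⟨C, hC, fun k a hk ha hak f _ hconv h0 hpow h1 ↦ ⟨0, fun Page _ init hinit ↦ ?_⟩⟩
  have hf : Caching.IsRateFunction f := ⟨hconv, h0, h1⟩
  obtain ⟨A, hsep, hknown, huses, hcons, hrobust, hsmooth⟩ :=
    hmain k a hk ha hak f hf hpow Page init hinit
  exact ⟨A, hsep, hknown, huses, hcons, hrobust,
    hsmooth _ hf.surjOn.mapsTo_invFunOn hf.surjOn.rightInvOn_invFunOn⟩
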